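/- Let $I\subset\mathbb R$ be an open interval and let $S\subset\mathbb R^3\setminus\{0\}$ be finite with $-S=S$. Let $$u(t,x)=\sum_{n\in S}u_n(t)\,e^{i n\cdot x},\qquad t\in I,\ x\in\mathbb R^3,\qquad u_n:I\to\mathbb C^3,$$ be a real divergence-free field with Fourier support $S$; that is, for every $n\in S$ the function $u_n$ is not identically zero on $I$, and $u_{-n}=\overline{u_n}$ and $n\cdot u_n=0$ on $I$. Put $u_n=0$ for $n\notin S$. Here $\cdot$ is the $\mathbb C$-bilinear dot product. Suppose that $u$ solves the projected Euler system: for all $t\in I$ and all $n\in S\cup\big((S+S)\setminus\{0\}\big)$, the function $u_n$ is differentiable at $t$ and $$\partial_t u_n+\frac i2\,\hat{\mathbb P}_n\sum_{\substack{n_1,n_2\in S\\ n_1+n_2=n}}\big[(u_{n_1}\cdot n_2)\,u_{n_2}+(u_{n_2}\cdot n_1)\,u_{n_1}\big]=0,$$ where $\hat{\mathbb P}_n$ is the orthogonal projection of $\mathbb C^3$ onto $\{v: n\cdot v=0\}$. If $S$ is not contained in a plane, then $u$ is a stationary Beltrami flow: there is a field $b(x)=\sum_{n\in S}b_n e^{in\cdot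 x}$ with $u(t,x)=b(x)$ for all $t\in I$, $x\in\mathbb R^3$ and $u_n(t)=b_n$ for all $n\in S$, $t\in I$, such that $\nabla\times b=\mu b$ for some $\mu\in\mathbb C$; the field $b$ is real and divergence-free and all its coefficients $b_n$, $n\in S$, are nonzero. Moreover: 1. $S$ lies on a sphere centered at the origin; 2. either $i\,n\times b_n=|n|\,b_n$ for all $n\in S$ (all coefficients are positive Beltrami vectors), or $i\,n\times b_n=-|n|\,b_n$ for all $n\in S$ (all are negative Beltrami vectors); 3. every point of $S$ is a vertex of the convex hull of $S$. -/

import Mathlib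

noncomputable section

namespace FiniteModeEuler

/-- Physical space and frequency space. -/
abbrev R3 := EuclideanSpace ℝ (Fin 3)

/-- The space of Fourier coefficient vectors. -/
abbrev C3 := EuclideanSpace ℂ (Fin 3)

/-- The inclusion of real vectors into complex vectors. -/
def toC3 (n : R3) : C3 := WithLp.toLp 2 fun i => (n i : ℂ)

/-- Componentwise complex conjugation. -/
def conjC3 (v : C3) : C3 := WithLp.toLp 2 fun i => (starRingEnd ℂ) (v i)

/-- The complex-bilinear dot product on complex vectors (no conjugation). -/
def dotC3 (v w : C3) : ℂ := ∑ i, v i * w i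

/-- The cross product `n × v` of a real frequency with a complex vector. -/
def crossC3 (n : R3) (v : C3) : C3 :=
  WithLp.toLp 2 (crossProduct (WithLp.ofLp (toC3 n)) (WithLp.ofLp v))

/-- The character `x ↦ exp(i n·x)`. -/
def mode (n x : R3) : ℂ := Complex.exp (Complex.I * ((inner ℝ n x : ℝ) : ℂ))

/-- The orthogonal projection of the Hermitian space `C3` onto the subspace `n · v = 0`,
which is the orthogonal complement of the complex line through `n`. -/
def helmholtz (n : R3) (v : C3) : C3 := (ℂ ∙ toC3 n)ᗮ.starProjection v

/-- A real, mean-zero, divergence-free field `b` on space with finite Fourier support `S` and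
nonzero coefficients `a n` for `n ∈ S`, extended by zero off `S`. -/
structure HasFiniteModes (S : Finset R3) (a : R3 → C3) (b : R3 → R3) : Prop where
  zero_notMem : (0 : R3) ∉ S
  neg_mem : ∀ n ∈ S, -n ∈ S
  coeff_ne_zero : ∀ n ∈ S, a n ≠ 0
  coeff_off : ∀ n ∉ S, a n = 0
  coeff_neg : ∀ n ∈ S, a (-n) = conjC3 (a n)
  div_free : ∀ n ∈ S, dotC3 (toC3 n) (a n) = 0
  expansion : ∀ x i, ((b x i : ℝ) : ℂ) = ∑ n ∈ S, a n i * mode n x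

/-- The class `H`. -/
def H : Set (R3 → R3) := {b | ∃ S a, HasFiniteModes S a b}

/-- The time-dependent class `H_I`: `u` has Fourier support `S` and coefficients `c n t`, where
for `n ∈ S` the coefficient does not vanish identically on `I`; off `S` it is zero. -/
structure HasFiniteModesOn (I : Set ℝ) (S : Finset R3) (c : R3 → ℝ → C3)
    (u : ℝ → R3 → R3) : Prop where
  zero_notMem : (0 : R3) ∉ S
  neg_mem : ∀ n ∈ S, -n ∈ S
  coeff_ne_zero : ∀ n ∈ S, ∃ t ∈ I, c n t ≠ 0
  coeff_off : ∀ n ∉ S, ∀ t ∈ I, c n t = 0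
  coeff_neg : ∀ n ∈ S, ∀ t ∈ I, c (-n) t = conjC3 (c n t)
  div_free : ∀ n ∈ S, ∀ t ∈ I, dotC3 (toC3 n) (c n t) = 0
  expansion : ∀ t ∈ I, ∀ x i, ((u t x i : ℝ) : ℂ) = ∑ n ∈ S, c n t i * mode n x

open Classical in
/-- The sum over `n₁, n₂ ∈ S` with `n₁ + n₂ = n` of
`(v n₁ · n₂) v n₂ + (v n₂ · n₁) v n₁`. -/
def interaction (S : Finset R3) (v : R3 → C3) (n : R3) : C3 :=
  ∑ q ∈ (S ×ˢ S).filter (fun q => q.1 + q.2 = n),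
    (dotC3 (v q.1) (toC3 q.2) • v q.2 + dotC3 (v q.2) (toC3 q.1) • v q.1)

/-- The frequencies at which the equations are imposed: `S ∪ ((S + S) \ {0})`. -/
def outputSet (S : Finset R3) : Set R3 :=
  {n | n ∈ S} ∪ {n | n ≠ 0 ∧ ∃ n₁ ∈ S, ∃ n₂ ∈ S, n₁ + n₂ = n}

/-- The projected Euler system for the Fourier coefficients: each coefficient is differentiable
in time on `I` and `∂ₜ uₙ + (i/2) Pₙ (interaction) = 0`. -/
def SolvesProjectedEuler (I : Set ℝ) (S : Finset R3) (c : R3 → ℝ → C3) : Prop :=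
  ∀ n ∈ outputSet S, ∀ t ∈ I,
    HasDerivAt (c n)
      (-((Complex.I / 2) • helmholtz n (interaction S (fun m => c m t) n))) t

/-- The partial derivative `∂ᵢ bⱼ` at `x`. -/
def pderiv (i j : Fin 3) (b : R3 → R3) (x : R3) : ℝ :=
  fderiv ℝ (fun y => b y j) x (EuclideanSpace.single i 1)

/-- The curl of a vector field. -/
def curl (b : R3 → R3) (x : R3) : R3 :=
  !₂[pderiv 1 2 b x - pderiv 2 1 b x,
     pderiv 2 0 b x - pderiv 0 2 b x,
     pderiv 0 1 b x - pderiv 1 0 b x]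

/-- A Beltrami flow: a field in `H` with `curl b = μ b` for some complex number `μ`. -/
def IsBeltramiFlow (b : R3 → R3) : Prop :=
  b ∈ H ∧ ∃ μ : ℂ, ∀ x i, ((curl b x i : ℝ) : ℂ) = μ * ((b x i : ℝ) : ℂ)

/-- A positive Beltrami vector at `n`: an eigenvector of `i n ×` with eigenvalue `|n|`. -/
def IsPosBeltramiVector (n : R3) (v : C3) : Prop :=
  v ≠ 0 ∧ Complex.I • crossC3 n v = ((‖n‖ : ℝ) : ℂ) • v

/-- A negative Beltrami vector at `n`: an eigenvector of `i n ×` with eigenvalue `-|n|`. -/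
def IsNegBeltramiVector (n : R3) (v : C3) : Prop :=
  v ≠ 0 ∧ Complex.I • crossC3 n v = (-((‖n‖ : ℝ) : ℂ)) • v

/-- The set `A` lies in a plane (a two-dimensional affine subspace). -/
def IsContainedInPlane (A : Set R3) : Prop :=
  ∃ P : AffineSubspace ℝ R3, Module.finrank ℝ P.direction = 2 ∧ A ⊆ P

end FiniteModeEuler

end

/-! Take a time at which the number of nonzero coefficients is maximal. By continuity the active set
is constant near that time, so the equation at any frequency outside it becomes algebraic: the
quadratic interaction there is parallel to the frequency (`isCollisionFree_support`). The active set
still spans space, because modes that lie in a plane through the origin at one time stay there by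
ODE uniqueness. The core is that this algebraic system forces i n × v_n = μ v_n with a single real μ
(`IsCollisionFree.exists_defect_eq_zero`). Such a field is a stationary solution, and uniqueness
extends it to all of `I` (`exists_beltrami_coefficients`). Then |n| = |μ| on `S`, which gives the
sphere, the common sign and, by strict convexity of the ball, extremality.

Edges. If p and q lie on an edge of the convex hull, with direction d, then p + q lies outside `S`
and splits only into points of that edge. The equations there are identities between exponential
sums in one variable. A Wronskian identity shows that the ratio of v_p · d to v_p · e is constant
along the edge, where e is normal to the plane through the edge and the origin
(`IsEdge.proportional`). A Hirota identity shows that, unless v_p · d = 0, the edge has only two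
points, of equal length (`IsEdge.regular`).

One isotropic coefficient on an edge suffices. An isotropic vector orthogonal to p is an eigenvector
of i p ×; the edge relations pass its eigenvalue μ to the other endpoint. If some modes failed the
eigenvector equation, the topmost of them would interact with an endpoint alone, and the vorticity
form of the nonlinearity rules this out (`OnEdge.defect_eq_zero`).

An isotropic coefficient exists by a holonomy argument (`FacetFrame.exists_isotropic`). Otherwise
each point on an edge of a facet carries a nonzero ratio of its two circular components, and in
stereographic coordinates a, b the edge relation multiplies this ratio by exp(4iθ) with θ = arg(1 +
conj a · b). Once around the facet the total of θ must be a multiple of π/2. If the facet is seen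
from a suitable axis under an angle of at most π/2, comparison of triangles puts the total in (-π/2,
0], with 0 only for collinear points. Such a facet is found through the polar body
(`exists_facetFrame`). -/

noncomputable section

namespace FiniteModeEuler

open Finset

/-! ### Bilinear identities for exponential sums in one variable -/

section Combinatorics

variable {ι : Type*}

theorem sum_filter_add_swap (E : Finset ι) (s : ι → ℝ) (σ : ℝ) (f : ι → ι → ℂ) :
    ∑ q ∈ (E ×ˢ E).filter (fun q => s q.1 + s q.2 = σ), f q.2 q.1 =
      ∑ q ∈ (E ×ˢ E).filter (fun q => s q.1 + s q.2 = σ), f q.1 q.2 := by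
  refine Finset.sum_nbij' Prod.swap Prod.swap ?_ ?_ ?_ ?_ ?_
  · rintro ⟨a, b⟩ h
    simp only [mem_filter, mem_product, Prod.swap] at h ⊢
    exact ⟨⟨h.1.2, h.1.1⟩, by rw [add_comm]; exact h.2⟩
  · rintro ⟨a, b⟩ h
    simp only [mem_filter, mem_product, Prod.swap] at h ⊢
    exact ⟨⟨h.1.2, h.1.1⟩, by rw [add_comm]; exact h.2⟩
  · intros; rfl
  · intros; rfl
  · intros; rfl

theorem sum_antisymm_eq_zero (E : Finset ι) (s : ι → ℝ) (σ : ℝ) (f : ι → ℂ) :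
    ∑ q ∈ (E ×ˢ E).filter (fun q => s q.1 + s q.2 = σ),
      ((s q.2 - s q.1 : ℝ) : ℂ) * (f q.1 * f q.2) = 0 := by
  have h := sum_filter_add_swap E s σ (fun a b => ((s b - s a : ℝ) : ℂ) * (f a * f b))
  have h2 : ∑ q ∈ (E ×ˢ E).filter (fun q => s q.1 + s q.2 = σ),
      ((s q.1 - s q.2 : ℝ) : ℂ) * (f q.2 * f q.1) =
      - ∑ q ∈ (E ×ˢ E).filter (fun q => s q.1 + s q.2 = σ),
      ((s q.2 - s q.1 : ℝ) : ℂ) * (f q.1 * f q.2) := by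
    rw [← Finset.sum_neg_distrib]
    refine Finset.sum_congr rfl fun q _ => ?_
    push_cast; ring
  rw [h2] at h
  linear_combination (-1 / 2 : ℂ) * h

/-- Two exponential sums with vanishing Wronskian are proportional. -/
theorem proportional_of_wronskian (E : Finset ι) (s : ι → ℝ) (hs : Set.InjOn s E)
    (α β : ι → ℂ) (h0 : ∀ p ∈ E, α p ≠ 0 ∨ β p ≠ 0)
    (hW : ∀ p₀ ∈ E, ∀ q₀ ∈ E,
      ∑ q ∈ (E ×ˢ E).filter (fun q => s q.1 + s q.2 = s p₀ + s q₀),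
        ((s q.2 - s q.1 : ℝ) : ℂ) * (β q.1 * α q.2) = 0) :
    ∀ p ∈ E, ∀ q ∈ E, α p * β q = α q * β p := by
  intro p hp q hq
  obtain ⟨p₀, hp₀, hmin⟩ := E.exists_min_image s ⟨p, hp⟩
  have hγ : ∀ q ∈ E, α q * β p₀ - α p₀ * β q = 0 := by
    by_contra hcon
    push Not at hcon
    obtain ⟨r, hr, hr0⟩ := hcon
    -- The combination β(p₀) α - α(p₀) β also has vanishing Wronskian with α and with β. With q₀ its
    -- lowest nonzero term, the coefficient at s p₀ + s q₀ comes from the pair (p₀, q₀) alone.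
    obtain ⟨q₀, hq₀, hqmin⟩ := (E.filter (fun q => α q * β p₀ - α p₀ * β q ≠ 0)).exists_min_image s
      ⟨r, by simp [hr, hr0]⟩
    rw [mem_filter] at hq₀
    have hW' := hW p₀ hp₀ q₀ hq₀.1
    have hW'' : ∑ q ∈ (E ×ˢ E).filter (fun q => s q.1 + s q.2 = s p₀ + s q₀),
        ((s q.2 - s q.1 : ℝ) : ℂ) * (α q.1 * β q.2) = 0 := by
      have h := sum_filter_add_swap E s (s p₀ + s q₀)
        (fun a b => ((s b - s a : ℝ) : ℂ) * (β a * α b))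
      simp only [hW'] at h
      rw [← neg_eq_zero, ← h, ← Finset.sum_neg_distrib]
      refine Finset.sum_congr rfl fun q _ => ?_
      push_cast; ring
    have hsingle : ∀ f : ι → ℂ,
        ∑ q ∈ (E ×ˢ E).filter (fun q => s q.1 + s q.2 = s p₀ + s q₀),
          ((s q.2 - s q.1 : ℝ) : ℂ) * (f q.1 * (α q.2 * β p₀ - α p₀ * β q.2)) =
        ((s q₀ - s p₀ : ℝ) : ℂ) * (f p₀ * (α q₀ * β p₀ - α p₀ * β q₀)) := by
      intro f
      refine Finset.sum_eq_single (p₀, q₀) ?_ ?_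
      · rintro ⟨a, b⟩ hab hne
        simp only [mem_filter, mem_product] at hab
        by_cases hb : α b * β p₀ - α p₀ * β b = 0
        · simp [hb]
        exfalso
        have h1 := hqmin b (by simp [hab.1.2, hb])
        have h2 := hmin a hab.1.1
        have ha : s a = s p₀ := by linarith [hab.2]
        have hb' : s b = s q₀ := by linarith [hab.2]
        exact hne (Prod.ext (hs hab.1.1 hp₀ ha) (hs hab.1.2 hq₀.1 hb'))
      · intro h
        simp [hp₀, hq₀.1] at h
    have hne : s q₀ - s p₀ ≠ 0 := by
      intro h
      have : q₀ = p₀ := hs hq₀.1 hp₀ (by linarith)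
      subst this
      exact hq₀.2 (by ring)
    have e1 := hsingle β
    have e2 := hsingle α
    have z1 : ∑ q ∈ (E ×ˢ E).filter (fun q => s q.1 + s q.2 = s p₀ + s q₀),
          ((s q.2 - s q.1 : ℝ) : ℂ) * (β q.1 * (α q.2 * β p₀ - α p₀ * β q.2)) = 0 := by
      have := sum_antisymm_eq_zero E s (s p₀ + s q₀) β
      calc _ = β p₀ * (∑ q ∈ (E ×ˢ E).filter (fun q => s q.1 + s q.2 = s p₀ + s q₀),
            ((s q.2 - s q.1 : ℝ) : ℂ) * (β q.1 * α q.2)) -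
            α p₀ * (∑ q ∈ (E ×ˢ E).filter (fun q => s q.1 + s q.2 = s p₀ + s q₀),
            ((s q.2 - s q.1 : ℝ) : ℂ) * (β q.1 * β q.2)) := by
              rw [Finset.mul_sum, Finset.mul_sum, ← Finset.sum_sub_distrib]
              exact Finset.sum_congr rfl fun q _ => by ring
        _ = 0 := by rw [hW', this]; ring
    have z2 : ∑ q ∈ (E ×ˢ E).filter (fun q => s q.1 + s q.2 = s p₀ + s q₀),
          ((s q.2 - s q.1 : ℝ) : ℂ) * (α q.1 * (α q.2 * β p₀ - α p₀ * β q.2)) = 0 := by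
      have := sum_antisymm_eq_zero E s (s p₀ + s q₀) α
      calc _ = β p₀ * (∑ q ∈ (E ×ˢ E).filter (fun q => s q.1 + s q.2 = s p₀ + s q₀),
            ((s q.2 - s q.1 : ℝ) : ℂ) * (α q.1 * α q.2)) -
            α p₀ * (∑ q ∈ (E ×ˢ E).filter (fun q => s q.1 + s q.2 = s p₀ + s q₀),
            ((s q.2 - s q.1 : ℝ) : ℂ) * (α q.1 * β q.2)) := by
              rw [Finset.mul_sum, Finset.mul_sum, ← Finset.sum_sub_distrib]
              exact Finset.sum_congr rfl fun q _ => by ring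
        _ = 0 := by rw [hW'', this]; ring
    rw [z1] at e1
    rw [z2] at e2
    have hne' : ((s q₀ - s p₀ : ℝ) : ℂ) ≠ 0 := by exact_mod_cast hne
    rcases h0 p₀ hp₀ with h | h
    · exact (mul_ne_zero hne' (mul_ne_zero h hq₀.2)) e2.symm
    · exact (mul_ne_zero hne' (mul_ne_zero h hq₀.2)) e1.symm
  have hp' := hγ p hp
  have hq' := hγ q hq
  rcases h0 p₀ hp₀ with h | h
  · apply mul_left_cancel₀ h
    linear_combination -α p * hq' + α q * hp'
  · apply mul_left_cancel₀ h
    linear_combination -β p * hq' + β q * hp'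

variable [DecidableEq ι]

/-- For f = Σ w_p exp(s_p x), the sums are twice the coefficients of f f'' - f'². The two lowest
exponents form the only pair of distinct indices with their sum, and equal indices have weight zero.
That coefficient is therefore nonzero, and the two lowest exponents must add up to the exceptional
value σ₀. -/
theorem le_add_of_hirota (E : Finset ι) (s : ι → ℝ) (hs : Set.InjOn s E)
    (w : ι → ℂ) (hw : ∀ p ∈ E, w p ≠ 0) (σ₀ : ℝ)
    (hH : ∀ p₀ ∈ E, ∀ q₀ ∈ E, s p₀ + s q₀ ≠ σ₀ →
      ∑ q ∈ (E ×ˢ E).filter (fun q => s q.1 + s q.2 = s p₀ + s q₀),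
        (((s q.2 - s q.1) ^ 2 : ℝ) : ℂ) * (w q.1 * w q.2) = 0) :
    ∀ p ∈ E, ∀ q ∈ E, p ≠ q → σ₀ ≤ s p + s q := by
  intro p hp q hq hpq
  obtain ⟨p₀, hp₀, hmin⟩ := E.exists_min_image s ⟨p, hp⟩
  have hne : (E.erase p₀).Nonempty := by
    by_cases h : p = p₀
    · exact ⟨q, mem_erase.2 ⟨fun h' => hpq (h.trans h'.symm), hq⟩⟩
    · exact ⟨p, mem_erase.2 ⟨h, hp⟩⟩
  obtain ⟨p₁, hp₁, hmin1⟩ := (E.erase p₀).exists_min_image s hne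
  rw [mem_erase] at hp₁
  have hlt : s p₀ < s p₁ := lt_of_le_of_ne (hmin p₁ hp₁.2)
    (fun h => hp₁.1 (hs hp₁.2 hp₀ h.symm))
  have key : s p₀ + s p₁ = σ₀ := by
    by_contra hcon
    have h := hH p₀ hp₀ p₁ hp₁.2 hcon
    rw [← Finset.sum_subset (s₁ := {(p₀, p₁), (p₁, p₀)}), Finset.sum_pair] at h
    · have h1 : (((s p₁ - s p₀) ^ 2 : ℝ) : ℂ) ≠ 0 := by
        exact_mod_cast pow_ne_zero 2 (by linarith : s p₁ - s p₀ ≠ 0)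
      have h2 : (2 : ℂ) * ((((s p₁ - s p₀) ^ 2 : ℝ) : ℂ) * (w p₀ * w p₁)) = 0 := by
        rw [← h]; push_cast; ring
      exact mul_ne_zero two_ne_zero (mul_ne_zero h1 (mul_ne_zero (hw _ hp₀) (hw _ hp₁.2))) h2
    · intro h'
      exact hp₁.1 (congrArg Prod.snd h')
    · intro x hx
      simp only [mem_insert, mem_singleton] at hx
      rcases hx with rfl | rfl
      · simp [hp₀, hp₁.2]
      · simp [hp₀, hp₁.2, add_comm]
    · rintro ⟨a, b⟩ hab hnot
      simp only [mem_filter, mem_product] at hab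
      simp only [mem_insert, mem_singleton, Prod.mk.injEq, not_or, not_and] at hnot
      by_cases heq : a = b
      · subst heq; simp
      exfalso
      by_cases ha : a = p₀
      · subst ha
        exact hnot.1 rfl (hs hab.1.2 hp₁.2 (by linarith [hab.2]))
      by_cases hb : b = p₀
      · subst hb
        exact hnot.2 (hs hab.1.1 hp₁.2 (by linarith [hab.2])) rfl
      have h1 := hmin1 a (mem_erase.2 ⟨ha, hab.1.1⟩)
      have h2 := hmin1 b (mem_erase.2 ⟨hb, hab.1.2⟩)
      linarith [hab.2]
  rw [← key]
  by_cases h : p = p₀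
  · subst h
    linarith [hmin1 q (mem_erase.2 ⟨fun h' => hpq h'.symm, hq⟩)]
  · linarith [hmin1 p (mem_erase.2 ⟨h, hp⟩), hmin q hq]

/-- The lower bound for s and for -s. Since s is injective, at most two indices can exist. -/
theorem add_eq_of_hirota (E : Finset ι) (s : ι → ℝ) (hs : Set.InjOn s E)
    (w : ι → ℂ) (hw : ∀ p ∈ E, w p ≠ 0) (σ₀ : ℝ)
    (hH : ∀ p₀ ∈ E, ∀ q₀ ∈ E, s p₀ + s q₀ ≠ σ₀ →
      ∑ q ∈ (E ×ˢ E).filter (fun q => s q.1 + s q.2 = s p₀ + s q₀),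
        (((s q.2 - s q.1) ^ 2 : ℝ) : ℂ) * (w q.1 * w q.2) = 0) :
    ∀ p ∈ E, ∀ q ∈ E, p ≠ q → s p + s q = σ₀ := by
  intro p hp q hq hpq
  have h1 := le_add_of_hirota E s hs w hw σ₀ hH p hp q hq hpq
  have h2 := le_add_of_hirota E (fun i => -s i) (fun a ha b hb h => hs ha hb (by simpa using h))
    w hw (-σ₀) (fun p₀ hp₀ q₀ hq₀ hne => by
      have h := hH p₀ hp₀ q₀ hq₀ (fun h => hne (by linarith))
      rw [← h]
      have hf : ∀ a : ι × ι, (-s a.1 + -s a.2 = -s p₀ + -s q₀) ↔ (s a.1 + s a.2 = s p₀ + s q₀) :=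
        fun a => ⟨fun h => by linarith, fun h => by linarith⟩
      simp only [hf]
      refine Finset.sum_congr rfl fun a _ => ?_
      push_cast; ring) p hp q hq hpq
  linarith

end Combinatorics

/-! ### Complex vectors as functionals on real frequencies -/

/-- The real-linear functional `x ↦ v · x` attached to a complex vector. -/
def ev (v : C3) : R3 →ₗ[ℝ] ℂ where
  toFun x := ∑ i, v i * (x i : ℂ)
  map_add' x y := by
    simp only [PiLp.add_apply, Complex.ofReal_add, mul_add, Finset.sum_add_distrib]
  map_smul' c x := by
    simp only [PiLp.smul_apply, smul_eq_mul, Complex.ofReal_mul, RingHom.id_apply,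
      Complex.real_smul, Finset.mul_sum]
    exact Finset.sum_congr rfl fun i _ => by ring

theorem ev_apply (v : C3) (x : R3) : ev v x = v 0 * x 0 + v 1 * x 1 + v 2 * x 2 := by
  simp [ev, Fin.sum_univ_three]

theorem dotC3_toC3 (v : C3) (x : R3) : dotC3 v (toC3 x) = ev v x := rfl

theorem dotC3_comm (v w : C3) : dotC3 v w = dotC3 w v := by
  simp [dotC3, mul_comm]

theorem ev_add_left (v w : C3) (x : R3) : ev (v + w) x = ev v x + ev w x := by
  simp [ev_apply]; ring

theorem ev_sub_left (v w : C3) (x : R3) : ev (v - w) x = ev v x - ev w x := by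
  simp [ev_apply]; ring

theorem ev_smul_left (c : ℂ) (v : C3) (x : R3) : ev (c • v) x = c * ev v x := by
  simp [ev_apply]; ring

theorem ev_zero_left (x : R3) : ev 0 x = 0 := by
  simp [ev_apply]

theorem ev_sum_left {ι : Type*} (s : Finset ι) (f : ι → C3) (x : R3) :
    ev (∑ i ∈ s, f i) x = ∑ i ∈ s, ev (f i) x := by
  classical
  induction s using Finset.induction_on with
  | empty => simp [ev_zero_left]
  | insert a s ha ih => rw [Finset.sum_insert ha, Finset.sum_insert ha, ev_add_left, ih]

theorem inner_eq_sum (x y : R3) : inner ℝ x y = x 0 * y 0 + x 1 * y 1 + x 2 * y 2 := by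
  simp [PiLp.inner_apply, Fin.sum_univ_three]; ring

theorem ev_toC3 (n x : R3) : ev (toC3 n) x = ((inner ℝ n x : ℝ) : ℂ) := by
  rw [inner_eq_sum, ev_apply]; simp [toC3]

theorem exists_smul_of_orthogonal {p d e x : R3} (h : LinearIndependent ℝ ![p, d]) (he : e ≠ 0)
    (hep : inner ℝ p e = 0) (hed : inner ℝ d e = 0) (hxp : inner ℝ p x = 0)
    (hxd : inner ℝ d x = 0) : ∃ c : ℝ, x = c • e := by
  have hfin : Module.finrank ℝ (Submodule.span ℝ (Set.range ![p, d])) = 2 := by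
    have := finrank_span_eq_card h
    simpa using this
  have hsum := Submodule.finrank_add_finrank_orthogonal
    (Submodule.span ℝ (Set.range ![p, d]))
  have hR : Module.finrank ℝ R3 = 3 := by simp
  have h1 : Module.finrank ℝ (Submodule.span ℝ (Set.range ![p, d]))ᗮ = 1 := by omega
  have hmem : ∀ y : R3, inner ℝ p y = 0 → inner ℝ d y = 0 →
      y ∈ (Submodule.span ℝ (Set.range ![p, d]))ᗮ := by
    intro y hp hd
    rw [Submodule.mem_orthogonal]
    intro u hu
    induction hu using Submodule.span_induction with
    | mem u hu =>
      obtain ⟨i, rfl⟩ := hu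
      fin_cases i
      · simpa using hp
      · simpa using hd
    | zero => simp
    | add a b _ _ ha hb => rw [inner_add_left, ha, hb, add_zero]
    | smul c a _ ha => rw [inner_smul_left, ha, mul_zero]
  obtain ⟨c, hc⟩ := (finrank_eq_one_iff_of_nonzero' (⟨e, hmem e hep hed⟩ :
    (Submodule.span ℝ (Set.range ![p, d]))ᗮ) (by simpa [Subtype.ext_iff] using he)).1 h1
      ⟨x, hmem x hxp hxd⟩
  exact ⟨c, (congrArg Subtype.val hc).symm⟩

theorem eq_zero_of_orthogonal {p d e x : R3} (h : LinearIndependent ℝ ![p, d]) (he : e ≠ 0)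
    (hep : inner ℝ p e = 0) (hed : inner ℝ d e = 0) (hxp : inner ℝ p x = 0)
    (hxd : inner ℝ d x = 0) (hxe : inner ℝ e x = 0) : x = 0 := by
  obtain ⟨c, rfl⟩ := exists_smul_of_orthogonal h he hep hed hxp hxd
  rw [inner_smul_right, mul_eq_zero] at hxe
  rcases hxe with rfl | h
  · simp
  · exact absurd (inner_self_eq_zero.1 h) he

theorem exists_orthogonal (p d : R3) : ∃ e : R3, e ≠ 0 ∧ inner ℝ p e = 0 ∧ inner ℝ d e = 0 := by
  have hlt : Module.finrank ℝ (Submodule.span ℝ (Set.range ![p, d])) < Module.finrank ℝ R3 := by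
    have := finrank_range_le_card (R := ℝ) ![p, d]
    simp only [Set.finrank, Fintype.card_fin] at this
    have hR : Module.finrank ℝ R3 = 3 := by simp
    omega
  have hne : (Submodule.span ℝ (Set.range ![p, d]))ᗮ ≠ ⊥ := by
    intro h
    rw [Submodule.orthogonal_eq_bot_iff] at h
    rw [h, finrank_top] at hlt
    exact lt_irrefl _ hlt
  obtain ⟨e, he, he0⟩ := Submodule.exists_mem_ne_zero_of_ne_bot hne
  rw [Submodule.mem_orthogonal] at he
  exact ⟨e, he0, he p (Submodule.subset_span ⟨0, rfl⟩), he d (Submodule.subset_span ⟨1, rfl⟩)⟩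

/-- Componentwise real part. -/
def reC3 (v : C3) : R3 := WithLp.toLp 2 fun i => (v i).re

/-- Componentwise imaginary part. -/
def imC3 (v : C3) : R3 := WithLp.toLp 2 fun i => (v i).im

theorem ev_re (v : C3) (x : R3) : (ev v x).re = inner ℝ x (reC3 v) := by
  rw [inner_eq_sum, ev_apply]; simp [reC3]; ring

theorem ev_im (v : C3) (x : R3) : (ev v x).im = inner ℝ x (imC3 v) := by
  rw [inner_eq_sum, ev_apply]; simp [imC3]; ring

theorem ext_C3 {v w : C3} (h0 : v 0 = w 0) (h1 : v 1 = w 1) (h2 : v 2 = w 2) : v = w := by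
  ext i; fin_cases i <;> assumption

theorem eq_zero_of_re_im {v : C3} (hr : reC3 v = 0) (hi : imC3 v = 0) : v = 0 := by
  have h : ∀ i, v i = 0 := fun i => Complex.ext
    (by simpa [reC3] using congrArg (fun w : R3 => w i) hr)
    (by simpa [imC3] using congrArg (fun w : R3 => w i) hi)
  exact ext_C3 (by simpa using h 0) (by simpa using h 1) (by simpa using h 2)

theorem eq_zero_of_ev {p d e : R3} {v : C3} (h : LinearIndependent ℝ ![p, d]) (he : e ≠ 0)
    (hep : inner ℝ p e = 0) (hed : inner ℝ d e = 0) (hxp : ev v p = 0)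
    (hxd : ev v d = 0) (hxe : ev v e = 0) : v = 0 :=
  eq_zero_of_re_im
    (eq_zero_of_orthogonal h he hep hed (by rw [← ev_re, hxp]; rfl) (by rw [← ev_re, hxd]; rfl)
      (by rw [← ev_re, hxe]; rfl))
    (eq_zero_of_orthogonal h he hep hed (by rw [← ev_im, hxp]; rfl) (by rw [← ev_im, hxd]; rfl)
      (by rw [← ev_im, hxe]; rfl))

/-! ### The algebraic system and its restriction to edges -/

/-- The algebraic content of the projected Euler system at a time where exactly the
coefficients in `S` are nonzero: the equations at the frequencies outside `S`. -/
structure IsCollisionFree (S : Finset R3) (v : R3 → C3) : Prop where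
  zero_notMem : (0 : R3) ∉ S
  neg_mem : ∀ n ∈ S, -n ∈ S
  ne_zero : ∀ n ∈ S, v n ≠ 0
  conj : ∀ n ∈ S, v (-n) = conjC3 (v n)
  div_free : ∀ n ∈ S, ev (v n) n = 0
  parallel : ∀ n ∉ S, n ≠ 0 → ∃ l : ℂ, interaction S v n = l • toC3 n
  spans : ∀ x : R3, (∀ n ∈ S, inner ℝ n x = 0) → x = 0

open Classical in
theorem sum_filter_swap (S : Finset R3) (n : R3) (f : R3 → R3 → ℂ) :
    ∑ q ∈ (S ×ˢ S).filter (fun q => q.1 + q.2 = n), f q.2 q.1 =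
      ∑ q ∈ (S ×ˢ S).filter (fun q => q.1 + q.2 = n), f q.1 q.2 := by
  refine Finset.sum_nbij' Prod.swap Prod.swap ?_ ?_ ?_ ?_ ?_
  · rintro ⟨a, b⟩ h
    simp only [mem_filter, mem_product, Prod.swap] at h ⊢
    exact ⟨⟨h.1.2, h.1.1⟩, by rw [add_comm]; exact h.2⟩
  · rintro ⟨a, b⟩ h
    simp only [mem_filter, mem_product, Prod.swap] at h ⊢
    exact ⟨⟨h.1.2, h.1.1⟩, by rw [add_comm]; exact h.2⟩
  · intros; rfl
  · intros; rfl
  · intros; rfl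

open Classical in
theorem ev_interaction (S : Finset R3) (v : R3 → C3) (n t : R3) :
    ev (interaction S v n) t =
      2 * ∑ q ∈ (S ×ˢ S).filter (fun q => q.1 + q.2 = n), ev (v q.1) q.2 * ev (v q.2) t := by
  rw [interaction, ev_sum_left]
  simp only [ev_add_left, ev_smul_left, dotC3_toC3, Finset.sum_add_distrib]
  rw [sum_filter_swap S n (fun a b => ev (v a) b * ev (v b) t), two_mul]

namespace IsCollisionFree

variable {S : Finset R3} {v : R3 → C3}

open Classical in
-- Testing against t orthogonal to n removes the unknown multiple of n, that is, the pressure.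
theorem sum_eq_zero (h : IsCollisionFree S v) {n t : R3} (hn : n ∉ S) (hn0 : n ≠ 0)
    (ht : inner ℝ n t = 0) :
    ∑ q ∈ (S ×ˢ S).filter (fun q => q.1 + q.2 = n), ev (v q.1) q.2 * ev (v q.2) t = 0 := by
  obtain ⟨l, hl⟩ := h.parallel n hn hn0
  have h1 := ev_interaction S v n t
  rw [hl, ev_smul_left, ev_toC3, ht] at h1
  simpa using h1.symm

end IsCollisionFree

/-- `p` and `q` lie in the face `φ = M` of `S`, which is contained in a line of direction `d`. -/
structure IsEdge {G : Type*} [AddCommGroup G] [LinearOrder G] [IsOrderedAddMonoid G]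
    (S : Finset R3) (φ : R3 →+ G) (M : G) (d : R3) : Prop where
  le : ∀ p ∈ S, φ p ≤ M
  pos : 0 < M
  dir_ne_zero : d ≠ 0
  ker : ∀ x, φ x = 0 ↔ ∃ s : ℝ, x = s • d

namespace IsEdge

variable {G : Type*} [AddCommGroup G] [LinearOrder G] [IsOrderedAddMonoid G]
variable {S : Finset R3} {v : R3 → C3} {φ : R3 →+ G} {M : G} {d : R3}

theorem sub_eq (hE : IsEdge S φ M d) {x y : R3} (hxy : φ x = φ y) :
    y = x + ((inner ℝ y d - inner ℝ x d) / ‖d‖ ^ 2) • d := by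
  have : φ (y - x) = 0 := by rw [map_sub, hxy, sub_self]
  obtain ⟨s, hs⟩ := (hE.ker _).1 this
  have hy : y = x + s • d := by rw [← hs]; abel
  have hd : ‖d‖ ^ 2 ≠ 0 := pow_ne_zero 2 (norm_ne_zero_iff.2 hE.dir_ne_zero)
  have : (inner ℝ y d - inner ℝ x d) / ‖d‖ ^ 2 = s := by
    rw [hy, inner_add_left, inner_smul_left, real_inner_self_eq_norm_sq]
    simp only [conj_trivial, add_sub_cancel_left]
    exact mul_div_cancel_right₀ s hd
  rw [this]; exact hy

theorem injOn (hE : IsEdge S φ M d) :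
    Set.InjOn (fun p : R3 => (inner ℝ p d : ℝ)) {p | p ∈ S ∧ φ p = M} := by
  intro x hx y hy hxy
  have := hE.sub_eq (hx.2.trans hy.2.symm)
  simp only at hxy
  rw [hxy, sub_self, zero_div, zero_smul, add_zero] at this
  exact this.symm

theorem linearIndependent (hE : IsEdge S φ M d) {p : R3} (hp : φ p = M) :
    LinearIndependent ℝ ![p, d] := by
  rw [LinearIndependent.pair_symm_iff, LinearIndependent.pair_iff' hE.dir_ne_zero]
  intro a ha
  have : φ p = 0 := (hE.ker p).2 ⟨a, ha.symm⟩
  exact hE.pos.ne' (hp ▸ this)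

open Classical in
-- Since φ ≤ M on `S`, a sum at level M + M has both summands at level M. Conversely, vectors at the
-- same level differ by a multiple of d, so the coordinate along d identifies the sum. The
-- convolution thus becomes one-dimensional.
theorem filter_eq (hE : IsEdge S φ M d) {p q : R3} (hp : φ p = M) (hq : φ q = M) :
    (S ×ˢ S).filter (fun a => a.1 + a.2 = p + q) =
      ((S.filter (fun x => φ x = M)) ×ˢ (S.filter (fun x => φ x = M))).filter
        (fun a => (inner ℝ a.1 d : ℝ) + inner ℝ a.2 d = inner ℝ p d + inner ℝ q d) := by
  ext ⟨a, b⟩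
  simp only [mem_filter, mem_product]
  constructor
  · rintro ⟨⟨ha, hb⟩, hab⟩
    have h1 := hE.le a ha
    have h2 := hE.le b hb
    have h3 : φ a + φ b = M + M := by rw [← map_add, hab, map_add, hp, hq]
    have ha' : φ a = M := by
      by_contra hne
      exact absurd h3 (add_lt_add_of_lt_of_le (lt_of_le_of_ne h1 hne) h2).ne
    have hb' : φ b = M := by rw [ha'] at h3; exact add_left_cancel h3
    refine ⟨⟨⟨ha, ha'⟩, hb, hb'⟩, ?_⟩
    rw [← inner_add_left, hab, inner_add_left]
  · rintro ⟨⟨⟨ha, ha'⟩, hb, hb'⟩, hab⟩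
    refine ⟨⟨ha, hb⟩, ?_⟩
    have := hE.sub_eq (x := p + q) (y := a + b) (by rw [map_add, map_add, hp, hq, ha', hb'])
    rw [inner_add_left, inner_add_left, hab, sub_self, zero_div, zero_smul, add_zero] at this
    exact this

theorem notMem_add (hE : IsEdge S φ M d) {p q : R3} (hp : φ p = M) (hq : φ q = M) :
    p + q ∉ S ∧ p + q ≠ 0 := by
  have h : φ (p + q) = M + M := by rw [map_add, hp, hq]
  constructor
  · intro hmem
    exact absurd (hE.le _ hmem) (not_le.2 (by rw [h]; exact lt_add_of_pos_left _ hE.pos))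
  · intro h0
    rw [h0, map_zero] at h
    exact absurd h (add_pos hE.pos hE.pos).ne

theorem ev_eq (hE : IsEdge S φ M d) (hv : IsCollisionFree S v) {p q : R3} (hp : p ∈ S)
    (hp' : φ p = M) (hq' : φ q = M) :
    ev (v p) q = (((inner ℝ q d - inner ℝ p d) / ‖d‖ ^ 2 : ℝ) : ℂ) * ev (v p) d := by
  conv_lhs => rw [hE.sub_eq (hp'.trans hq'.symm)]
  rw [map_add, hv.div_free p hp, map_smul, zero_add, Complex.real_smul]

/-- Test the equations at sums of two edge points against e, the normal to the plane through the
origin and the edge. As v_a · a = 0, the factor v_a · b is a multiple of ((b - a) · d)(v_a · d), so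
the equations say that the exponential sums with coefficients v_p · e and v_p · d have zero
Wronskian. -/
theorem proportional (hE : IsEdge S φ M d) (hv : IsCollisionFree S v) {e : R3}
    {p q : R3} (hp : p ∈ S) (hq : q ∈ S) (hp' : φ p = M) (hq' : φ q = M)
    (hed : inner ℝ d e = 0) (hep : inner ℝ p e = 0) :
    ev (v p) e * ev (v q) d = ev (v q) e * ev (v p) d := by
  classical
  by_cases he : e = 0
  · simp [he]
  have hperp : ∀ a, φ a = M → inner ℝ a e = 0 := by
    intro a ha
    rw [hE.sub_eq (hp'.trans ha.symm), inner_add_left, inner_smul_left, hed, hep]; simp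
  refine proportional_of_wronskian (S.filter (fun x => φ x = M)) (fun p => inner ℝ p d) ?_
    (fun p => ev (v p) e) (fun p => ev (v p) d) ?_ ?_ p (by simp [hp, hp']) q (by simp [hq, hq'])
  · intro x hx y hy hxy
    exact hE.injOn (by simpa using hx) (by simpa using hy) hxy
  · intro a ha
    rw [mem_filter] at ha
    by_contra hcon
    push Not at hcon
    exact hv.ne_zero a ha.1 (eq_zero_of_ev (hE.linearIndependent ha.2) he (hperp a ha.2) hed
      (hv.div_free a ha.1) hcon.2 hcon.1)
  · intro a ha b hb
    rw [mem_filter] at ha hb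
    have hn := hE.notMem_add ha.2 hb.2
    have h := hv.sum_eq_zero hn.1 hn.2 (t := e)
      (by rw [inner_add_left, hperp a ha.2, hperp b hb.2, add_zero])
    rw [hE.filter_eq ha.2 hb.2] at h
    have hd : ((‖d‖ ^ 2 : ℝ) : ℂ) ≠ 0 := by
      exact_mod_cast pow_ne_zero 2 (norm_ne_zero_iff.2 hE.dir_ne_zero)
    calc _ = ((‖d‖ ^ 2 : ℝ) : ℂ) * (∑ q ∈ ((S.filter (fun x => φ x = M)) ×ˢ
          (S.filter (fun x => φ x = M))).filter
        (fun x => (inner ℝ x.1 d : ℝ) + inner ℝ x.2 d = inner ℝ a d + inner ℝ b d),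
        ev (v q.1) q.2 * ev (v q.2) e) := by
          rw [Finset.mul_sum]
          refine Finset.sum_congr rfl fun x hx => ?_
          simp only [mem_filter, mem_product] at hx
          rw [hE.ev_eq hv hx.1.1.1 hx.1.1.2 hx.1.2.2, Complex.ofReal_div]
          field_simp
      _ = 0 := by rw [h, mul_zero]

/-- Here the test vector lies in the plane of the edge and is orthogonal to a + b. One part of the
sum is antisymmetric and vanishes; the other symmetrizes to the Hirota form, with a factor (a + b) ·
d. The exceptional value is therefore 0. -/
theorem inner_add_eq_zero (hE : IsEdge S φ M d) (hv : IsCollisionFree S v)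
    {p q : R3} (hp : p ∈ S) (hq : q ∈ S) (hp' : φ p = M) (hq' : φ q = M)
    (hpq : p ≠ q) (hreg : ∀ r ∈ S, φ r = M → ev (v r) d ≠ 0) :
    (inner ℝ p d : ℝ) + inner ℝ q d = 0 := by
  classical
  refine add_eq_of_hirota (S.filter (fun x => φ x = M)) (fun p => inner ℝ p d) ?_
    (fun p => ev (v p) d) ?_ 0 ?_ p (by simp [hp, hp']) q (by simp [hq, hq']) hpq
  · intro x hx y hy hxy
    exact hE.injOn (by simpa using hx) (by simpa using hy) hxy
  · intro a ha
    rw [mem_filter] at ha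
    exact hreg a ha.1 ha.2
  · intro a ha b hb hab
    rw [mem_filter] at ha hb
    have hn := hE.notMem_add ha.2 hb.2
    have h := hv.sum_eq_zero hn.1 hn.2
      (t := (inner ℝ (a + b) d : ℝ) • p - (inner ℝ (a + b) p : ℝ) • d)
      (by rw [inner_sub_right, inner_smul_right, inner_smul_right]; ring)
    rw [hE.filter_eq ha.2 hb.2] at h
    have hD : ((‖d‖ ^ 2 : ℝ) : ℂ) ≠ 0 := by
      exact_mod_cast pow_ne_zero 2 (norm_ne_zero_iff.2 hE.dir_ne_zero)
    have hσ : ((inner ℝ (a + b) d : ℝ) : ℂ) ≠ 0 := by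
      rw [inner_add_left]; exact_mod_cast hab
    set T := ((S.filter (fun x => φ x = M)) ×ˢ (S.filter (fun x => φ x = M))).filter
        (fun x => (inner ℝ x.1 d : ℝ) + inner ℝ x.2 d = inner ℝ a d + inner ℝ b d) with hT
    set σ := ((inner ℝ (a + b) d : ℝ) : ℂ) with hσd
    set τ := ((inner ℝ (a + b) p : ℝ) : ℂ) with hτd
    set D := ((‖d‖ ^ 2 : ℝ) : ℂ) with hDd
    have hanti := sum_antisymm_eq_zero (S.filter (fun x => φ x = M)) (fun p => inner ℝ p d)
      (inner ℝ a d + inner ℝ b d) (fun p => ev (v p) d)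
    have hterm : ∀ x ∈ T, ev (v x.1) x.2 * ev (v x.2)
        ((inner ℝ (a + b) d : ℝ) • p - (inner ℝ (a + b) p : ℝ) • d) =
        (σ * (inner ℝ p d : ℝ) / D ^ 2 - τ / D) * ((((inner ℝ x.2 d - inner ℝ x.1 d : ℝ)) : ℂ) *
          (ev (v x.1) d * ev (v x.2) d)) - σ / D ^ 2 *
          (((inner ℝ x.2 d : ℝ) : ℂ) * ((((inner ℝ x.2 d - inner ℝ x.1 d : ℝ)) : ℂ) *
            (ev (v x.1) d * ev (v x.2) d))) := by
      intro x hx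
      simp only [hT, mem_filter, mem_product] at hx
      rw [hE.ev_eq hv hx.1.1.1 hx.1.1.2 hx.1.2.2, map_sub, map_smul, map_smul,
        hE.ev_eq hv hx.1.2.1 hx.1.2.2 hp', Complex.real_smul, Complex.real_smul,
        Complex.ofReal_div, Complex.ofReal_div, ← hσd, ← hτd, ← hDd]
      push_cast
      field_simp
      ring
    rw [Finset.sum_congr rfl hterm, Finset.sum_sub_distrib, ← Finset.mul_sum, ← Finset.mul_sum,
      hanti, mul_zero, zero_sub, neg_eq_zero, mul_eq_zero] at h
    have h1 := h.resolve_left (div_ne_zero hσ (pow_ne_zero 2 hD))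
    -- With s = x · d, adding the swapped sum turns s₂(s₂ - s₁) into s₂(s₂ - s₁) + s₁(s₁ - s₂) = (s₂
    -- - s₁)².
    have h2 := sum_filter_add_swap (S.filter (fun x => φ x = M)) (fun p => inner ℝ p d)
      (inner ℝ a d + inner ℝ b d) (fun x y => ((inner ℝ y d : ℝ) : ℂ) *
        ((((inner ℝ y d - inner ℝ x d : ℝ)) : ℂ) * (ev (v x) d * ev (v y) d)))
    rw [← hT, h1] at h2
    calc _ = (∑ q ∈ T, ((inner ℝ q.2 d : ℝ) : ℂ) * ((((inner ℝ q.2 d - inner ℝ q.1 d : ℝ)) : ℂ) *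
            (ev (v q.1) d * ev (v q.2) d))) +
          ∑ q ∈ T, ((inner ℝ q.1 d : ℝ) : ℂ) * ((((inner ℝ q.1 d - inner ℝ q.2 d : ℝ)) : ℂ) *
            (ev (v q.2) d * ev (v q.1) d)) := by
          rw [← Finset.sum_add_distrib]
          refine Finset.sum_congr rfl fun x _ => ?_
          push_cast; ring
      _ = 0 := by rw [h1, h2, add_zero]

theorem ne_zero_of_ne_zero (hE : IsEdge S φ M d) (hv : IsCollisionFree S v)
    {p q : R3} (hp : p ∈ S) (hq : q ∈ S) (hp' : φ p = M) (hq' : φ q = M)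
    (hreg : ev (v p) d ≠ 0) : ev (v q) d ≠ 0 := by
  intro h0
  obtain ⟨e, he, hep, hed⟩ := exists_orthogonal p d
  have h := hE.proportional hv hp hq hp' hq' hed hep
  rw [h0, mul_zero, eq_comm, mul_eq_zero] at h
  refine hv.ne_zero q hq (eq_zero_of_ev (hE.linearIndependent hq') he ?_ hed
    (hv.div_free q hq) h0 (h.resolve_right hreg))
  rw [hE.sub_eq (hp'.trans hq'.symm), inner_add_left, inner_smul_left, hed, hep]; simp

/-- Equal norms follow from (p + q) · d = 0, since q - p is a multiple of d. A third point would
have the same coordinate along d as q. -/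
theorem regular (hE : IsEdge S φ M d) (hv : IsCollisionFree S v)
    {p q : R3} (hp : p ∈ S) (hq : q ∈ S) (hp' : φ p = M) (hq' : φ q = M)
    (hpq : p ≠ q) (hreg : ev (v p) d ≠ 0) :
    ‖p‖ = ‖q‖ ∧ ∀ r ∈ S, φ r = M → r = p ∨ r = q := by
  have hall : ∀ r ∈ S, φ r = M → ev (v r) d ≠ 0 := fun r hr hr' =>
    hE.ne_zero_of_ne_zero hv hp hr hp' hr' hreg
  have h := hE.inner_add_eq_zero hv hp hq hp' hq' hpq hall
  constructor
  · have hsub := hE.sub_eq (hp'.trans hq'.symm)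
    have h0 : inner ℝ (p + q) (q - p) = (0 : ℝ) := by
      have : q - p = ((inner ℝ q d - inner ℝ p d) / ‖d‖ ^ 2) • d := by
        rw [sub_eq_iff_eq_add']; exact hsub
      rw [this, inner_smul_right, inner_add_left, h, mul_zero]
    rw [inner_sub_right, inner_add_left, inner_add_left, real_inner_self_eq_norm_sq,
      real_inner_self_eq_norm_sq, real_inner_comm p q] at h0
    exact (sq_eq_sq₀ (norm_nonneg _) (norm_nonneg _)).1 (by linarith)
  · intro r hr hr'
    by_contra hcon
    push Not at hcon
    have h1 := hE.inner_add_eq_zero hv hp hr hp' hr' (Ne.symm hcon.1) hall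
    exact hcon.2 (hE.injOn ⟨hr, hr'⟩ ⟨hq, hq'⟩ (by simp only; linarith))

end IsEdge

/-! ### Cross products and the vorticity form of the interaction -/

/-- The complex cross product. -/
def crossCC (v w : C3) : C3 := WithLp.toLp 2 (crossProduct (WithLp.ofLp v) (WithLp.ofLp w))

theorem crossCC_zero (v w : C3) : crossCC v w 0 = v 1 * w 2 - v 2 * w 1 := by
  simp [crossCC, cross_apply]

theorem crossCC_one (v w : C3) : crossCC v w 1 = v 2 * w 0 - v 0 * w 2 := by
  simp [crossCC, cross_apply]

theorem crossCC_two (v w : C3) : crossCC v w 2 = v 0 * w 1 - v 1 * w 0 := by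
  simp [crossCC, cross_apply]

theorem crossC3_zero (n : R3) (w : C3) : crossC3 n w 0 = n 1 * w 2 - n 2 * w 1 := by
  simp [crossC3, cross_apply, toC3]

theorem crossC3_one (n : R3) (w : C3) : crossC3 n w 1 = n 2 * w 0 - n 0 * w 2 := by
  simp [crossC3, cross_apply, toC3]

theorem crossC3_two (n : R3) (w : C3) : crossC3 n w 2 = n 0 * w 1 - n 1 * w 0 := by
  simp [crossC3, cross_apply, toC3]

/-- The real cross product. -/
def crossRR (v w : R3) : R3 := WithLp.toLp 2 (crossProduct (WithLp.ofLp v) (WithLp.ofLp w))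

theorem crossRR_zero (v w : R3) : crossRR v w 0 = v 1 * w 2 - v 2 * w 1 := by
  simp [crossRR, cross_apply]

theorem crossRR_one (v w : R3) : crossRR v w 1 = v 2 * w 0 - v 0 * w 2 := by
  simp [crossRR, cross_apply]

theorem crossRR_two (v w : R3) : crossRR v w 2 = v 0 * w 1 - v 1 * w 0 := by
  simp [crossRR, cross_apply]

theorem crossRR_ne_zero {v w : R3} (h : LinearIndependent ℝ ![v, w]) : crossRR v w ≠ 0 := by
  intro h0
  have h1 : crossProduct (WithLp.ofLp v) (WithLp.ofLp w) = 0 := by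
    simpa [crossRR] using congrArg WithLp.ofLp h0
  refine (crossProduct_ne_zero_iff_linearIndependent.2 ?_) h1
  have := h.map' (WithLp.linearEquiv 2 ℝ (Fin 3 → ℝ)).toLinearMap (LinearEquiv.ker _)
  have he : (⇑(WithLp.linearEquiv 2 ℝ (Fin 3 → ℝ)).toLinearMap ∘ ![v, w]) =
      ![WithLp.ofLp v, WithLp.ofLp w] := by
    ext i j
    fin_cases i <;> rfl
  rw [he] at this
  exact this

theorem inner_crossRR_left (v w : R3) : inner ℝ v (crossRR v w) = (0 : ℝ) := by
  rw [inner_eq_sum, crossRR_zero, crossRR_one, crossRR_two]; ring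

theorem inner_crossRR_right (v w : R3) : inner ℝ w (crossRR v w) = (0 : ℝ) := by
  rw [inner_eq_sum, crossRR_zero, crossRR_one, crossRR_two]; ring

theorem ev_crossC3_left (n x : R3) (v : C3) : ev (crossC3 n v) x = ev v (crossRR x n) := by
  simp only [ev_apply, crossC3_zero, crossC3_one, crossC3_two, crossRR_zero, crossRR_one,
    crossRR_two]
  push_cast; ring

/-- The failure of `v` to be an eigenvector of `i n ×` with eigenvalue `μ`. -/
def defect (μ : ℝ) (n : R3) (v : C3) : C3 := Complex.I • crossC3 n v - (μ : ℂ) • v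

theorem defect_neg (μ : ℝ) (n : R3) (v : C3) :
    defect μ (-n) (conjC3 v) = conjC3 (defect μ n v) := by
  apply ext_C3 <;>
  simp [defect, crossC3_zero, crossC3_one, crossC3_two, conjC3] <;> ring

theorem ev_defect_self {μ : ℝ} {n : R3} {v : C3} (h : ev v n = 0) : ev (defect μ n v) n = 0 := by
  have h0 : crossRR n n = 0 := by
    ext i; fin_cases i
    · simp [crossRR_zero]; ring
    · simp [crossRR_one]; ring
    · simp [crossRR_two]; ring
  rw [defect, ev_sub_left, ev_smul_left, ev_smul_left, ev_crossC3_left, h, h0]; simp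

theorem ev_crossCC_defect {μ : ℝ} {p t : R3} {v w : C3} :
    ev (crossCC (defect μ p v) w) t =
      Complex.I * (ev v t * ev w p - (inner ℝ p t : ℝ) * dotC3 v w) -
        μ * ev (crossCC v w) t := by
  simp only [ev_apply, crossCC_zero, crossCC_one, crossCC_two, defect, PiLp.sub_apply,
    PiLp.smul_apply, smul_eq_mul, crossC3_zero, crossC3_one, crossC3_two, inner_eq_sum, dotC3,
    Fin.sum_univ_three]
  push_cast; ring

namespace IsCollisionFree

variable {S : Finset R3} {v : R3 → C3}

open Classical in
-- This is (u · ∇)u = ω × u + ∇|u|²/2 with ω = curl u: the gradient is invisible to t, and since u ×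
-- u = 0 the vorticity ω may be replaced by ω - μu, whose coefficients are the defects.
theorem sum_crossCC_eq_zero (h : IsCollisionFree S v) (μ : ℝ) {n t : R3} (hn : n ∉ S)
    (hn0 : n ≠ 0) (ht : inner ℝ n t = 0) :
    ∑ q ∈ (S ×ˢ S).filter (fun q => q.1 + q.2 = n),
      ev (crossCC (defect μ q.1 (v q.1)) (v q.2)) t = 0 := by
  have h1 := h.sum_eq_zero hn hn0 ht
  have h2 := sum_filter_swap S n (fun a b => ev (v a) b * ev (v b) t)
  have h3 := sum_filter_swap S n (fun a b => ((inner ℝ a t : ℝ) : ℂ) * dotC3 (v a) (v b))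
  have h4 := sum_filter_swap S n (fun a b => ev (crossCC (v a) (v b)) t)
  have h3' : ∑ q ∈ (S ×ˢ S).filter (fun q => q.1 + q.2 = n),
      ((inner ℝ q.1 t : ℝ) : ℂ) * dotC3 (v q.1) (v q.2) = 0 := by
    have : ∑ q ∈ (S ×ˢ S).filter (fun q => q.1 + q.2 = n),
        (((inner ℝ q.2 t : ℝ) : ℂ) * dotC3 (v q.2) (v q.1)) = 
        - ∑ q ∈ (S ×ˢ S).filter (fun q => q.1 + q.2 = n),
          ((inner ℝ q.1 t : ℝ) : ℂ) * dotC3 (v q.1) (v q.2) := by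
      rw [← Finset.sum_neg_distrib]
      refine Finset.sum_congr rfl fun q hq => ?_
      rw [mem_filter] at hq
      have : (inner ℝ q.2 t : ℝ) = - inner ℝ q.1 t := by
        rw [← hq.2, inner_add_left] at ht; linarith
      rw [this, dotC3_comm]; push_cast; ring
    rw [this] at h3
    linear_combination (-1 / 2 : ℂ) * h3
  have h4' : ∑ q ∈ (S ×ˢ S).filter (fun q => q.1 + q.2 = n),
      ev (crossCC (v q.1) (v q.2)) t = 0 := by
    have : ∑ q ∈ (S ×ˢ S).filter (fun q => q.1 + q.2 = n),
        ev (crossCC (v q.2) (v q.1)) t =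
        - ∑ q ∈ (S ×ˢ S).filter (fun q => q.1 + q.2 = n), ev (crossCC (v q.1) (v q.2)) t := by
      rw [← Finset.sum_neg_distrib]
      refine Finset.sum_congr rfl fun q hq => ?_
      simp only [ev_apply, crossCC_zero, crossCC_one, crossCC_two]; ring
    rw [this] at h4
    linear_combination (-1 / 2 : ℂ) * h4
  rw [h1] at h2
  calc _ = Complex.I * (∑ q ∈ (S ×ˢ S).filter (fun q => q.1 + q.2 = n),
          ev (v q.2) q.1 * ev (v q.1) t) -
        Complex.I * (∑ q ∈ (S ×ˢ S).filter (fun q => q.1 + q.2 = n),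
          ((inner ℝ q.1 t : ℝ) : ℂ) * dotC3 (v q.1) (v q.2)) -
        μ * (∑ q ∈ (S ×ˢ S).filter (fun q => q.1 + q.2 = n),
          ev (crossCC (v q.1) (v q.2)) t) := by
        rw [Finset.mul_sum, Finset.mul_sum, Finset.mul_sum, ← Finset.sum_sub_distrib,
          ← Finset.sum_sub_distrib]
        refine Finset.sum_congr rfl fun q _ => ?_
        rw [ev_crossCC_defect]; ring
    _ = 0 := by rw [h2, h3', h4']; ring

/-- Only the pair (p, q) contributes at p + q, so w × v_q is parallel to p + q, where w is the
defect at p. Crossing with p + q gives w (v_q · p) = v_q (w · q). Dotting with p and using w · p = 0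
and w ≠ 0 yields v_q · p = 0. The eigenvector equation at q then also gives v_q · (p × q) = 0, so
v_q would vanish if p and q were independent. -/
theorem parallel_of_unique (h : IsCollisionFree S v) {μ : ℝ} {p q : R3} (hp : p ∈ S) (hq : q ∈ S)
    (hwp : defect μ p (v p) ≠ 0) (hwq : defect μ q (v q) = 0) (hn : p + q ∉ S) (hn0 : p + q ≠ 0)
    (huniq : ∀ a ∈ S, ∀ b ∈ S, a + b = p + q → defect μ a (v a) ≠ 0 → a = p) :
    ∃ s : ℝ, p = s • q := by
  classical
  have hq0 : q ≠ 0 := fun h0 => h.zero_notMem (h0 ▸ hq)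
  set w := defect μ p (v p) with hw
  have hcross : ∀ t : R3, inner ℝ (p + q) t = 0 → ev (crossCC w (v q)) t = 0 := by
    intro t ht
    rw [← h.sum_crossCC_eq_zero μ hn hn0 ht]
    symm
    refine Finset.sum_eq_single (p, q) ?_ ?_
    · rintro ⟨a, b⟩ hab hne
      simp only [mem_filter, mem_product] at hab
      by_cases ha : defect μ a (v a) = 0
      · simp [ha, ev_apply, crossCC_zero, crossCC_one, crossCC_two]
      · exfalso
        have := huniq a hab.1.1 b hab.1.2 hab.2 ha
        subst this
        exact hne (Prod.ext rfl (add_left_cancel hab.2))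
    · intro h'
      simp [hp, hq] at h'
  have hwp' : ev w p = 0 := ev_defect_self (h.div_free p hp)
  have hvq := h.div_free q hq
  have key : ∀ i, w i * ev (v q) p = v q i * ev w q := by
    -- The three test vectors read off the components of (p + q) × (w × v_q).
    have e0 := hcross !₂[0, -(p + q) 2, (p + q) 1] (by simp [inner_eq_sum]; ring)
    have e1 := hcross !₂[(p + q) 2, 0, -(p + q) 0] (by simp [inner_eq_sum]; ring)
    have e2 := hcross !₂[-(p + q) 1, (p + q) 0, 0] (by simp [inner_eq_sum]; ring)
    rw [ev_apply] at hwp' hvq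
    simp only [ev_apply, crossCC_zero, crossCC_one, crossCC_two] at e0 e1 e2 ⊢
    simp at e0 e1 e2
    intro i
    fin_cases i
    · simp only [Fin.zero_eta]
      linear_combination e0 + v q 0 * hwp' - w 0 * hvq
    · simp only [Fin.mk_one]
      linear_combination e1 + v q 1 * hwp' - w 1 * hvq
    · simp only [Fin.reduceFinMk]
      linear_combination e2 + v q 2 * hwp' - w 2 * hvq
  have hvp : ev (v q) p = 0 := by
    by_contra hne
    have h1 : ev w p * ev (v q) p = ev (v q) p * ev w q := by
      rw [ev_apply w p, ev_apply (v q) p] at *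
      have k0 := key 0
      have k1 := key 1
      have k2 := key 2
      linear_combination (p 0 : ℂ) * k0 + (p 1 : ℂ) * k1 + (p 2 : ℂ) * k2
    rw [hwp', zero_mul, eq_comm, mul_eq_zero] at h1
    have h2 := h1.resolve_left hne
    refine hwp (ext_C3 ?_ ?_ ?_) <;>
    · have := key
      simp only [h2, mul_zero, mul_eq_zero, hne, or_false] at this
      simp [this]
  by_contra hcon
  have hli : LinearIndependent ℝ ![p, q] := by
    rw [LinearIndependent.pair_symm_iff, LinearIndependent.pair_iff' hq0]
    exact fun a ha => hcon ⟨a, ha.symm⟩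
  refine h.ne_zero q hq (eq_zero_of_ev hli (crossRR_ne_zero hli) (inner_crossRR_left p q)
    (inner_crossRR_right p q) hvp hvq ?_)
  have h1 : ev (defect μ q (v q)) p = 0 := by rw [hwq, ev_zero_left]
  rw [defect, ev_sub_left, ev_smul_left, ev_smul_left, ev_crossC3_left, hvp] at h1
  simpa using h1

/-- An injective order functional makes the decomposition into two topmost elements unique. Both
tops are positive because `S` and the set of modes with nonzero defect are symmetric under negation.
-/
theorem parallel_of_top (h : IsCollisionFree S v) {G : Type*} [AddCommGroup G] [LinearOrder G]
    [IsOrderedAddMonoid G] (φ : R3 →+ G) (hφ : ∀ x, φ x = 0 → x = 0) {μ : ℝ} {p n : R3}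
    (hp : p ∈ S) (hptop : ∀ a ∈ S, φ a ≤ φ p) (hwp : defect μ p (v p) = 0) (hn : n ∈ S)
    (hwn : defect μ n (v n) ≠ 0) (hntop : ∀ a ∈ S, defect μ a (v a) ≠ 0 → φ a ≤ φ n) :
    ∃ s : ℝ, n = s • p := by
  have hpos : ∀ a ∈ S, φ (-a) ≤ φ a → 0 < φ a := by
    intro a ha hle
    have h0 : φ a ≠ 0 := fun h0 => h.zero_notMem (hφ a h0 ▸ ha)
    rw [map_neg, neg_le_self_iff] at hle
    exact lt_of_le_of_ne hle h0.symm
  have hnpos : 0 < φ n := hpos n hn (hntop (-n) (h.neg_mem n hn) (by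
    rw [h.conj n hn, defect_neg]
    intro h0
    apply hwn
    apply ext_C3
    · simpa [conjC3] using congrArg (fun w : C3 => w 0) h0
    · simpa [conjC3] using congrArg (fun w : C3 => w 1) h0
    · simpa [conjC3] using congrArg (fun w : C3 => w 2) h0))
  have hppos : 0 < φ p := hpos p hp (hptop _ (h.neg_mem p hp))
  refine h.parallel_of_unique hn hp hwn hwp ?_ ?_ ?_
  · intro hmem
    have := hptop _ hmem
    rw [map_add] at this
    exact absurd this (not_le.2 (lt_add_of_pos_left _ hnpos))
  · intro h0
    have : φ (n + p) = 0 := by rw [h0, map_zero]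
    rw [map_add] at this
    exact (add_pos hnpos hppos).ne' this
  · intro a ha b hb hab hwa
    have h1 := hntop a ha hwa
    have h2 := hptop b hb
    have h3 : φ a + φ b = φ n + φ p := by rw [← map_add, hab, map_add]
    have h4 : φ a = φ n := by
      by_contra hne
      exact absurd h3 (add_lt_add_of_lt_of_le (lt_of_le_of_ne h1 hne) h2).ne
    have := hφ (a - n) (by rw [map_sub, h4, sub_self])
    exact sub_eq_zero.1 this

end IsCollisionFree

/-! ### Lexicographic orders and propagation of the eigenvalue from an edge -/

/-- Lexicographic comparison by two linear functionals. -/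
def lexPair (ν k : R3) : R3 →+ ℝ ×ₗ ℝ where
  toFun x := toLex (inner ℝ ν x, inner ℝ k x)
  map_zero' := by simp
  map_add' x y := by simp only [inner_add_right]; rfl

/-- Lexicographic comparison by three linear functionals. -/
def lexTriple (ν k g : R3) : R3 →+ ℝ ×ₗ ℝ ×ₗ ℝ where
  toFun x := toLex (inner ℝ ν x, toLex (inner ℝ k x, inner ℝ g x))
  map_zero' := by simp
  map_add' x y := by simp only [inner_add_right]; rfl

theorem lexPair_le {ν k x y : R3} : lexPair ν k x ≤ lexPair ν k y ↔
    (inner ℝ ν x : ℝ) < inner ℝ ν y ∨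
      (inner ℝ ν x : ℝ) = inner ℝ ν y ∧ (inner ℝ k x : ℝ) ≤ inner ℝ k y := by
  simp [lexPair, Prod.Lex.le_iff]

theorem lexPair_eq {ν k x y : R3} : lexPair ν k x = lexPair ν k y ↔
    (inner ℝ ν x : ℝ) = inner ℝ ν y ∧ (inner ℝ k x : ℝ) = inner ℝ k y := by
  simp [lexPair]

theorem lexTriple_le {ν k g x y : R3} : lexTriple ν k g x ≤ lexTriple ν k g y ↔
    (inner ℝ ν x : ℝ) < inner ℝ ν y ∨ (inner ℝ ν x : ℝ) = inner ℝ ν y ∧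
      ((inner ℝ k x : ℝ) < inner ℝ k y ∨
        (inner ℝ k x : ℝ) = inner ℝ k y ∧ (inner ℝ g x : ℝ) ≤ inner ℝ g y) := by
  simp [lexTriple, Prod.Lex.le_iff]

theorem linearIndependent_of_inner_eq_zero {ν k : R3} (hν : ν ≠ 0) (hk : k ≠ 0)
    (h : inner ℝ ν k = (0 : ℝ)) : LinearIndependent ℝ ![ν, k] := by
  rw [LinearIndependent.pair_iff' hν]
  rintro a rfl
  rw [inner_smul_right, mul_eq_zero] at h
  rcases h with rfl | h
  · simp at hk
  · exact hν (inner_self_eq_zero.1 h)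

theorem lexTriple_eq_zero {ν k g : R3} (hν : ν ≠ 0) (hk : k ≠ 0) (h : inner ℝ ν k = (0 : ℝ))
    (hg : g ≠ 0) (hνg : inner ℝ ν g = (0 : ℝ)) (hkg : inner ℝ k g = (0 : ℝ)) (x : R3)
    (hx : lexTriple ν k g x = 0) : x = 0 := by
  rw [← map_zero (lexTriple ν k g)] at hx
  simp only [lexTriple, AddMonoidHom.coe_mk, ZeroHom.coe_mk, EmbeddingLike.apply_eq_iff_eq,
    Prod.mk.injEq, inner_zero_right] at hx
  exact eq_zero_of_orthogonal (linearIndependent_of_inner_eq_zero hν hk h) hg hνg hkg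
    hx.1 hx.2.1 hx.2.2

/-- The points `p ≠ q` of `S` lie on a common edge, cut out from the face `ν = 1` of `S` by the
functional `k` orthogonal to `ν`. -/
structure OnEdge (S : Finset R3) (ν k p q : R3) : Prop where
  le_one : ∀ r ∈ S, (inner ℝ ν r : ℝ) ≤ 1
  orth : inner ℝ ν k = (0 : ℝ)
  ne_zero : k ≠ 0
  ne : p ≠ q
  left_mem : p ∈ S
  right_mem : q ∈ S
  left_face : (inner ℝ ν p : ℝ) = 1
  right_face : (inner ℝ ν q : ℝ) = 1
  eq : (inner ℝ k q : ℝ) = inner ℝ k p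
  le : ∀ r ∈ S, (inner ℝ ν r : ℝ) = 1 → (inner ℝ k r : ℝ) ≤ inner ℝ k p

namespace OnEdge

variable {S : Finset R3} {v : R3 → C3} {ν k p q : R3}

theorem normal_ne_zero (h : OnEdge S ν k p q) : ν ≠ 0 := by
  rintro rfl
  simpa using h.left_face

theorem dir_ne_zero (h : OnEdge S ν k p q) : q - p ≠ 0 := sub_ne_zero.2 h.ne.symm

theorem inner_normal_dir (h : OnEdge S ν k p q) : inner ℝ ν (q - p) = (0 : ℝ) := by
  rw [inner_sub_right, h.left_face, h.right_face, sub_self]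

theorem inner_dir (h : OnEdge S ν k p q) : inner ℝ k (q - p) = (0 : ℝ) := by
  rw [inner_sub_right, h.eq, sub_self]

theorem isEdge (h : OnEdge S ν k p q) :
    IsEdge S (lexPair ν k) (lexPair ν k p) (q - p) where
  le r hr := by
    rw [lexPair_le, h.left_face]
    rcases lt_or_eq_of_le (h.le_one r hr) with h1 | h1
    · exact Or.inl h1
    · exact Or.inr ⟨h1, h.le r hr h1⟩
  pos := by
    rw [← map_zero (lexPair ν k)]
    refine lt_of_le_of_ne (lexPair_le.2 (Or.inl ?_)) ?_
    · simp [h.left_face]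
    · rw [Ne, lexPair_eq]
      simp [h.left_face]
  dir_ne_zero := h.dir_ne_zero
  ker x := by
    rw [← map_zero (lexPair ν k), lexPair_eq, inner_zero_right, inner_zero_right]
    constructor
    · rintro ⟨h1, h2⟩
      exact exists_smul_of_orthogonal
        (linearIndependent_of_inner_eq_zero h.normal_ne_zero h.ne_zero h.orth) h.dir_ne_zero
        h.inner_normal_dir h.inner_dir h1 h2
    · rintro ⟨s, rfl⟩
      rw [inner_smul_right, inner_smul_right, h.inner_normal_dir, h.inner_dir]
      simp

theorem lexPair_right (h : OnEdge S ν k p q) : lexPair ν k q = lexPair ν k p :=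
  lexPair_eq.2 ⟨h.right_face.trans h.left_face.symm, h.eq⟩

/-- If both points of an edge carry Beltrami vectors with the same eigenvalue and the edge has
no further points, then all coefficients are eigenvectors. -/
theorem defect_eq_zero (h : OnEdge S ν k p q) (hv : IsCollisionFree S v)
    (hE : ∀ r ∈ S, lexPair ν k r = lexPair ν k p → r = p ∨ r = q) {μ : ℝ}
    (hp : defect μ p (v p) = 0) (hq : defect μ q (v q) = 0) :
    ∀ n ∈ S, defect μ n (v n) = 0 := by
  by_contra hcon
  push Not at hcon
  obtain ⟨m, hm, hm0⟩ := hcon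
  set d := q - p with hd
  have hdd : 0 < (inner ℝ d d : ℝ) := real_inner_self_pos.2 h.dir_ne_zero
  have hdq : (inner ℝ d q : ℝ) = inner ℝ d p + inner ℝ d d := by
    rw [← inner_add_right, hd]; congr 1; abel
  have hinj : ∀ x, lexTriple ν k d x = 0 → x = 0 := lexTriple_eq_zero h.normal_ne_zero h.ne_zero
    h.orth h.dir_ne_zero h.inner_normal_dir h.inner_dir
  have hinj' : ∀ x, lexTriple ν k (-d) x = 0 → x = 0 := lexTriple_eq_zero h.normal_ne_zero
    h.ne_zero h.orth (neg_ne_zero.2 h.dir_ne_zero)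
    (by rw [inner_neg_right, h.inner_normal_dir, neg_zero])
    (by rw [inner_neg_right, h.inner_dir, neg_zero])
  have hne : (S.filter (fun n => defect μ n (v n) ≠ 0)).Nonempty := ⟨m, by simp [hm, hm0]⟩
  -- The two orders differ only in how they break ties along the edge. In `S` the first has top p
  -- and the second has top q; n₁ and n₂ are the corresponding topmost modes with nonzero defect,
  -- and they turn out to be s p and s q with the same s.
  obtain ⟨n₁, hn₁, htop₁⟩ :=
    (S.filter (fun n => defect μ n (v n) ≠ 0)).exists_max_image (lexTriple ν k (-d)) hne
  obtain ⟨n₂, hn₂, htop₂⟩ :=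
    (S.filter (fun n => defect μ n (v n) ≠ 0)).exists_max_image (lexTriple ν k d) hne
  rw [mem_filter] at hn₁ hn₂
  have htop₁' : ∀ a ∈ S, defect μ a (v a) ≠ 0 → lexTriple ν k (-d) a ≤ lexTriple ν k (-d) n₁ :=
    fun a ha ha' => htop₁ a (by simp [ha, ha'])
  have htop₂' : ∀ a ∈ S, defect μ a (v a) ≠ 0 → lexTriple ν k d a ≤ lexTriple ν k d n₂ :=
    fun a ha ha' => htop₂ a (by simp [ha, ha'])
  have hpair : ∀ a ∈ S, lexPair ν k a ≤ lexPair ν k p := h.isEdge.le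
  have htopp : ∀ a ∈ S, lexTriple ν k (-d) a ≤ lexTriple ν k (-d) p := by
    intro a ha
    rw [lexTriple_le]
    rcases lexPair_le.1 (hpair a ha) with h1 | ⟨h1, h2⟩
    · exact Or.inl h1
    refine Or.inr ⟨h1, ?_⟩
    rcases lt_or_eq_of_le h2 with h2 | h2
    · exact Or.inl h2
    refine Or.inr ⟨h2, ?_⟩
    rcases hE a ha (lexPair_eq.2 ⟨h1, h2⟩) with rfl | rfl
    · exact le_rfl
    · rw [inner_neg_left, inner_neg_left, hdq]; linarith
  have htopq : ∀ a ∈ S, lexTriple ν k d a ≤ lexTriple ν k d q := by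
    intro a ha
    rw [lexTriple_le, h.eq, h.right_face, ← h.left_face]
    rcases lexPair_le.1 (hpair a ha) with h1 | ⟨h1, h2⟩
    · exact Or.inl h1
    refine Or.inr ⟨h1, ?_⟩
    rcases lt_or_eq_of_le h2 with h2 | h2
    · exact Or.inl h2
    refine Or.inr ⟨h2, ?_⟩
    rcases hE a ha (lexPair_eq.2 ⟨h1, h2⟩) with rfl | rfl
    · rw [hdq]; linarith
    · exact le_rfl
  obtain ⟨s, hs⟩ := hv.parallel_of_top (lexTriple ν k (-d)) hinj' h.left_mem htopp hp hn₁.1 hn₁.2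
    htop₁'
  obtain ⟨s', hs'⟩ := hv.parallel_of_top (lexTriple ν k d) hinj h.right_mem htopq hq hn₂.1 hn₂.2
    htop₂'
  have hν₁ : (inner ℝ ν n₁ : ℝ) = s := by rw [hs, inner_smul_right, h.left_face, mul_one]
  have hν₂ : (inner ℝ ν n₂ : ℝ) = s' := by rw [hs', inner_smul_right, h.right_face, mul_one]
  have hss : s = s' := by
    have h1 := htop₁' n₂ hn₂.1 hn₂.2
    have h2 := htop₂' n₁ hn₁.1 hn₁.2
    rw [lexTriple_le, hν₁, hν₂] at h1 h2
    rcases h1 with h1 | h1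
    · rcases h2 with h2 | h2
      · linarith
      · exact h2.1
    · exact h1.1.symm
  subst hss
  have hs0 : 0 < s := by
    have hneg : defect μ (-n₁) (v (-n₁)) ≠ 0 := by
      rw [hv.conj n₁ hn₁.1, defect_neg]
      intro h0
      apply hn₁.2
      apply ext_C3
      · simpa [conjC3] using congrArg (fun w : C3 => w 0) h0
      · simpa [conjC3] using congrArg (fun w : C3 => w 1) h0
      · simpa [conjC3] using congrArg (fun w : C3 => w 2) h0
    have h1 := htop₁' (-n₁) (hv.neg_mem n₁ hn₁.1) hneg
    rw [lexTriple_le, inner_neg_right, hν₁] at h1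
    have h2 : s ≠ 0 := by
      rintro rfl
      rw [zero_smul] at hs
      exact hv.zero_notMem (hs ▸ hn₁.1)
    rcases h1 with h1 | h1
    · linarith
    · exact absurd (by linarith [h1.1]) h2
  have hs1 : s < 1 := by
    have h1 := h.le_one n₁ hn₁.1
    rw [hν₁] at h1
    refine lt_of_le_of_ne h1 ?_
    rintro rfl
    rw [one_smul] at hs
    exact hn₁.2 (hs ▸ hp)
  have hk₁ : (inner ℝ k n₁ : ℝ) = s * inner ℝ k p := by rw [hs, inner_smul_right]
  have hk₂ : (inner ℝ k n₂ : ℝ) = s * inner ℝ k p := by rw [hs', inner_smul_right, h.eq]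
  -- Now pair n₁ = s p with the other endpoint q. Being parallel to both p and q is impossible for
  -- n₁ ≠ 0.
  have hpar : ∃ c : ℝ, n₁ = c • q := hv.parallel_of_unique hn₁.1 h.right_mem hn₁.2 hq ?_ ?_ ?_
  · obtain ⟨c, hc⟩ := hpar
    rw [hs] at hc
    have hc' : s = c := by
      have := congrArg (fun x => (inner ℝ ν x : ℝ)) hc
      simpa [inner_smul_right, h.left_face, h.right_face] using this
    rw [← hc'] at hc
    exact h.ne (smul_right_injective R3 hs0.ne' hc)
  · intro hmem
    have := h.le_one _ hmem
    rw [inner_add_right, hν₁, h.right_face] at this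
    linarith
  · intro h0
    have : (inner ℝ ν (n₁ + q) : ℝ) = 0 := by rw [h0, inner_zero_right]
    rw [inner_add_right, hν₁, h.right_face] at this
    linarith
  · intro a ha b hb hab hwa
    have h1 : lexPair ν k a ≤ lexPair ν k n₁ := by
      rw [lexPair_le]
      have := htop₁' a ha hwa
      rw [lexTriple_le] at this
      rcases this with h1 | ⟨h1, h2 | h2⟩
      · exact Or.inl h1
      · exact Or.inr ⟨h1, h2.le⟩
      · exact Or.inr ⟨h1, h2.1.le⟩
    have h2 : lexPair ν k b ≤ lexPair ν k q := by rw [h.lexPair_right]; exact hpair b hb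
    have h3 : lexPair ν k a + lexPair ν k b = lexPair ν k n₁ + lexPair ν k q := by
      rw [← map_add, hab, map_add]
    have h4 : lexPair ν k a = lexPair ν k n₁ := by
      by_contra hne
      exact absurd h3 (add_lt_add_of_lt_of_le (lt_of_le_of_ne h1 hne) h2).ne
    have h5 : lexPair ν k b = lexPair ν k q := by
      rw [h4] at h3; exact add_left_cancel h3
    rcases hE b hb (h5.trans h.lexPair_right) with rfl | rfl
    · exfalso
      -- If the good summand were p, the bad one would be s p + d, which lies beyond the topmost n₂
      -- = s p + s d because s < 1.
      have ha' : a = n₁ + d := by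
        rw [hd, add_sub, ← hab, add_sub_cancel_right]
      have h6 := htop₂' a ha hwa
      rw [lexPair_eq, hν₁, hk₁] at h4
      rw [lexTriple_le, h4.1, h4.2, hν₂, hk₂] at h6
      rcases h6 with h6 | ⟨-, h6 | ⟨-, h6⟩⟩
      · exact lt_irrefl _ h6
      · exact lt_irrefl _ h6
      · rw [ha', hs', hs, inner_add_right, inner_smul_right, inner_smul_right, hdq] at h6
        nlinarith
    · exact add_right_cancel hab

end OnEdge

/-! ### Isotropic coefficients and Beltrami vectors -/

theorem sq_eq_of_defect_eq_zero {n : R3} {v : C3} (hv : v ≠ 0) (hdiv : ev v n = 0) {l : ℂ}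
    (h : Complex.I • crossC3 n v = l • v) : l ^ 2 = ((‖n‖ ^ 2 : ℝ) : ℂ) := by
  have h0 := congrArg (fun w : C3 => w 0) h
  have h1 := congrArg (fun w : C3 => w 1) h
  have h2 := congrArg (fun w : C3 => w 2) h
  simp only [PiLp.smul_apply, smul_eq_mul, crossC3_zero, crossC3_one, crossC3_two] at h0 h1 h2
  rw [ev_apply] at hdiv
  rw [← real_inner_self_eq_norm_sq, inner_eq_sum]
  have hI := Complex.I_mul_I
  -- Applying i n × twice to v gives -n × (n × v) = |n|² v, because n · v = 0.
  have key : ∀ i, (l ^ 2 - ((n 0 * n 0 + n 1 * n 1 + n 2 * n 2 : ℝ) : ℂ)) * v i = 0 := by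
    push_cast
    intro i
    fin_cases i
    · simp only [Fin.zero_eta]
      linear_combination (-l) * h0 - Complex.I * n 1 * h2 + Complex.I * n 2 * h1 +
        (n 1 * (n 0 * v 1 - n 1 * v 0) - n 2 * (n 2 * v 0 - n 0 * v 2)) * hI - n 0 * hdiv
    · simp only [Fin.mk_one]
      linear_combination (-l) * h1 - Complex.I * n 2 * h0 + Complex.I * n 0 * h2 +
        (n 2 * (n 1 * v 2 - n 2 * v 1) - n 0 * (n 0 * v 1 - n 1 * v 0)) * hI - n 1 * hdiv
    · simp only [Fin.reduceFinMk]
      linear_combination (-l) * h2 - Complex.I * n 0 * h1 + Complex.I * n 1 * h0 +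
        (n 0 * (n 2 * v 0 - n 0 * v 2) - n 1 * (n 1 * v 2 - n 2 * v 1)) * hI - n 2 * hdiv
  by_contra hne
  have hz : ∀ i, v i = 0 := fun i => (mul_eq_zero.1 (key i)).resolve_left (sub_ne_zero.2 hne)
  exact hv (ext_C3 (by simp [hz]) (by simp [hz]) (by simp [hz]))

theorem defect_eq_zero_iff {μ : ℝ} {n : R3} {v : C3} :
    defect μ n v = 0 ↔ Complex.I • crossC3 n v = (μ : ℂ) • v := by
  rw [defect, sub_eq_zero]

/-- A nonzero isotropic vector orthogonal to `n` is an eigenvector of `i n ×`. -/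
theorem exists_defect_eq_zero {n : R3} {v : C3} (hv : v ≠ 0) (hdiv : ev v n = 0)
    (hiso : dotC3 v v = 0) : ∃ μ : ℝ, μ ^ 2 = ‖n‖ ^ 2 ∧ defect μ n v = 0 := by
  obtain ⟨j, hj⟩ : ∃ j, v j ≠ 0 := by
    by_contra hcon
    push Not at hcon
    exact hv (ext_C3 (by simp [hcon]) (by simp [hcon]) (by simp [hcon]))
  have hdiv' := hdiv
  rw [ev_apply] at hdiv
  simp only [dotC3, Fin.sum_univ_three] at hiso
  -- The vector n × v is orthogonal to n and v; inside the plane orthogonal to n ≠ 0, the orthogonal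
  -- of the isotropic v is its own line.
  have hpar : ∀ i j, crossC3 n v i * v j = v i * crossC3 n v j := by
    intro i j
    fin_cases i <;> fin_cases j <;>
      simp only [Fin.zero_eta, Fin.mk_one, Fin.reduceFinMk, crossC3_zero, crossC3_one, crossC3_two]
    · ring
    · linear_combination v 2 * hdiv - n 2 * hiso
    · linear_combination n 1 * hiso - v 1 * hdiv
    · linear_combination n 2 * hiso - v 2 * hdiv
    · ring
    · linear_combination v 0 * hdiv - n 0 * hiso
    · linear_combination v 1 * hdiv - n 1 * hiso
    · linear_combination n 0 * hiso - v 0 * hdiv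
    · ring
  set l := Complex.I * crossC3 n v j / v j with hl
  have hw : Complex.I • crossC3 n v = l • v := by
    ext i
    simp only [PiLp.smul_apply, smul_eq_mul, hl]
    rw [div_mul_eq_mul_div, eq_div_iff hj]
    linear_combination Complex.I * hpar i j
  have hl2 := sq_eq_of_defect_eq_zero hv hdiv' hw
  push_cast at hl2
  rcases sq_eq_sq_iff_eq_or_eq_neg.1 hl2 with h | h
  · exact ⟨‖n‖, rfl, defect_eq_zero_iff.2 (by rw [← h]; exact hw)⟩
  · exact ⟨-‖n‖, by ring, defect_eq_zero_iff.2 (by push_cast; rw [← h]; exact hw)⟩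

namespace OnEdge

variable {S : Finset R3} {v : R3 → C3} {ν k p q : R3}

theorem linearIndependent (h : OnEdge S ν k p q) {r : R3}
    (hr : lexPair ν k r = lexPair ν k p) : LinearIndependent ℝ ![r, q - p] :=
  h.isEdge.linearIndependent hr

/-- An isotropic coefficient on an edge forces all coefficients to be Beltrami vectors. -/
theorem exists_defect_eq_zero_of_isotropic (h : OnEdge S ν k p q) (hv : IsCollisionFree S v)
    (hiso : dotC3 (v p) (v p) = 0) : ∃ μ : ℝ, ∀ n ∈ S, defect μ n (v n) = 0 := by
  obtain ⟨μ, hμ, hp⟩ := exists_defect_eq_zero (hv.ne_zero p h.left_mem)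
    (hv.div_free p h.left_mem) hiso
  have hli := h.linearIndependent rfl
  have hliq := h.linearIndependent h.lexPair_right
  have hpd := hv.div_free p h.left_mem
  have hqd := hv.div_free q h.right_mem
  set d := q - p with hd
  set e := crossRR p d with he
  -- Both endpoints give the same normal: p × d = q × d = p × q.
  have hqe : crossRR q d = e := by
    rw [he, hd]
    ext i; fin_cases i
    · simp [crossRR_zero]; ring
    · simp [crossRR_one]; ring
    · simp [crossRR_two]; ring
  have hdp : ∀ x : R3, crossRR d x = - crossRR x d := by
    intro x
    ext i; fin_cases i
    · simp [crossRR_zero]; ring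
    · simp [crossRR_one]; ring
    · simp [crossRR_two]; ring
  have hep := inner_crossRR_left p d
  have hed := inner_crossRR_right p d
  have hev : ∀ (r : R3), crossRR r d = e →
      ev (defect μ r (v r)) d = - (Complex.I * ev (v r) e) - μ * ev (v r) d := by
    intro r hr
    rw [defect, ev_sub_left, ev_smul_left, ev_smul_left, ev_crossC3_left, hdp, hr, map_neg]
    ring
  have h1 := hev p he.symm
  rw [hp, ev_zero_left] at h1
  have hreg : ev (v p) d ≠ 0 := by
    intro h0
    rw [h0] at h1
    refine hv.ne_zero p h.left_mem (eq_zero_of_ev hli (crossRR_ne_zero hli) hep hed hpd h0 ?_)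
    simpa using h1
  have hedge := h.isEdge.regular hv h.left_mem h.right_mem rfl h.lexPair_right h.ne hreg
  have hprop := h.isEdge.proportional hv h.left_mem h.right_mem rfl h.lexPair_right hed hep
  refine ⟨μ, h.defect_eq_zero hv hedge.2 hp ?_⟩
  -- The component along d of the eigenvector equation only fixes the ratio of v · e to v · d, and
  -- that ratio is constant along the edge.
  have h2 : Complex.I * ev (v q) e = - (μ * ev (v q) d) := by
    apply mul_right_cancel₀ hreg
    linear_combination (-Complex.I) * hprop + ev (v q) d * h1
  have hqq : μ ^ 2 = inner ℝ q q := by rw [hμ, hedge.1, real_inner_self_eq_norm_sq]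
  have hevq : ev (v q) (crossRR e q) = (μ : ℂ) ^ 2 * ev (v q) d := by
    have : crossRR e q = (inner ℝ q q : ℝ) • d - (inner ℝ q d : ℝ) • q := by
      rw [← hqe, inner_eq_sum, inner_eq_sum]
      ext i; fin_cases i
      · simp [crossRR_zero, crossRR_one, crossRR_two]; ring
      · simp [crossRR_zero, crossRR_one, crossRR_two]; ring
      · simp [crossRR_zero, crossRR_one, crossRR_two]; ring
    rw [this, map_sub, map_smul, map_smul, hqd, ← hqq]
    simp
  have hI := Complex.I_mul_I
  refine eq_zero_of_ev hliq (crossRR_ne_zero hliq) (inner_crossRR_left q d)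
    (inner_crossRR_right q d) (ev_defect_self hqd) ?_ ?_
  · rw [hev q hqe, h2]; ring
  · rw [hqe, defect, ev_sub_left, ev_smul_left, ev_smul_left, ev_crossC3_left, hevq]
    linear_combination ((μ : ℂ) * Complex.I) * h2 - μ * ev (v q) e * hI

end OnEdge

/-! ### Phases accumulated along a planar convex hull -/

/-- Following the upper hull of a planar set from `p` to its rightmost top point `b`, a phase `R`
that is transported along the hull edges with rotation `θ` accumulates a total rotation which is at
most the rotation along the chord. -/
theorem exists_hull_phase {ι : Type*} (F : Finset ι) (g x lo : ι → ℝ) (θ : ι → ι → ℝ) (R : ι → ℂ)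
    (h_lo : ∀ p ∈ F, ∀ q ∈ F, g p < g q → lo q - lo p < θ p q)
    (h_tri : ∀ p ∈ F, ∀ q ∈ F, ∀ r ∈ F, g p < g q → g q < g r →
      (x r - x p) * (g q - g p) ≤ (x q - x p) * (g r - g p) →
      θ p q + θ q r ≤ θ p r ∧
        (θ p q + θ q r = θ p r → (x r - x p) * (g q - g p) = (x q - x p) * (g r - g p)))
    (h_edge : ∀ p ∈ F, ∀ q ∈ F, ∀ m : ℝ, g p < g q → (∀ r ∈ F, x r - m * g r ≤ x p - m * g p) →
      x q - m * g q = x p - m * g p → R q = R p * Complex.exp (((4 * θ p q : ℝ) : ℂ) * Complex.I))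
    (b : ι) (hb : b ∈ F) (hbg : ∀ r ∈ F, g r ≤ g b) (hbx : ∀ r ∈ F, g r = g b → x r ≤ x b)
    (n : ℕ) : ∀ p ∈ F, (F.filter (fun r => g p < g r)).card ≤ n →
      (∃ m : ℝ, ∀ r ∈ F, x r - m * g r ≤ x p - m * g p) → g p < g b →
      ∃ Θ : ℝ, R b = R p * Complex.exp (((4 * Θ : ℝ) : ℂ) * Complex.I) ∧ lo b - lo p < Θ ∧
        Θ ≤ θ p b ∧
        (Θ = θ p b → ∀ r ∈ F, (x r - x p) * (g b - g p) ≤ (x b - x p) * (g r - g p)) := by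
  induction n with
  | zero =>
    intro p _ hcard _ hpb
    have : b ∈ F.filter (fun r => g p < g r) := by simp [hb, hpb]
    rw [Nat.le_zero, Finset.card_eq_zero] at hcard
    simp [hcard] at this
  | succ n ih =>
    rintro p hp hcard ⟨m, hm⟩ hpb
    -- The next hull edge has the maximal slope m' from p. Its line bounds all of F: on the right by
    -- maximality, on the left because m' ≤ m.
    obtain ⟨q', hq', hmax⟩ := (F.filter (fun r => g p < g r)).exists_max_image
      (fun r => (x r - x p) / (g r - g p)) ⟨b, by simp [hb, hpb]⟩
    rw [mem_filter] at hq'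
    set m' := (x q' - x p) / (g q' - g p) with hm'
    have hq'pos : 0 < g q' - g p := by linarith [hq'.2]
    have hright : ∀ r ∈ F, g p < g r → x r - x p ≤ m' * (g r - g p) := by
      intro r hr hpr
      have := hmax r (by simp [hr, hpr])
      rwa [div_le_iff₀ (by linarith)] at this
    have hmm : m' ≤ m := by
      rw [hm', div_le_iff₀ hq'pos]
      linarith [hm q' hq'.1]
    have hline : ∀ r ∈ F, x r - m' * g r ≤ x p - m' * g p := by
      intro r hr
      rcases lt_or_ge (g p) (g r) with h | h
      · linarith [hright r hr h]
      · nlinarith [hm r hr]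
    have hq'eq : x q' - m' * g q' = x p - m' * g p := by
      have : m' * (g q' - g p) = x q' - x p := div_mul_cancel₀ _ hq'pos.ne'
      linarith
    by_cases hqb : g q' = g b
    · have hbeq : x b - m' * g b = x p - m' * g p := by
        have h1 := hbx q' hq'.1 hqb
        have h2 := hline b hb
        rw [← hqb] at h2 ⊢
        linarith
      refine ⟨θ p b, h_edge p hp b hb m' hpb hline hbeq, h_lo p hp b hb hpb, le_rfl, ?_⟩
      intro _ r hr
      have h1 := hline r hr
      have h2 : x b - x p = m' * (g b - g p) := by linarith
      rw [h2]
      nlinarith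
    · have hqb' : g q' < g b := lt_of_le_of_ne (hbg q' hq'.1) hqb
      have hcard' : (F.filter (fun r => g q' < g r)).card ≤ n := by
        have hss : F.filter (fun r => g q' < g r) ⊂ F.filter (fun r => g p < g r) := by
          rw [Finset.ssubset_iff_of_subset]
          · exact ⟨q', by simp [hq'.1, hq'.2], by simp⟩
          · intro r hr
            rw [mem_filter] at hr ⊢
            exact ⟨hr.1, hq'.2.trans hr.2⟩
        have := Finset.card_lt_card hss
        omega
      obtain ⟨Θ, h1, h2, h3, h4⟩ := ih q' hq'.1 hcard'
        ⟨m', fun r hr => by rw [hq'eq]; exact hline r hr⟩ hqb'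
      have hslope : x q' - x p = m' * (g q' - g p) := by linarith
      have hbline := hline b hb
      have htri := h_tri p hp q' hq'.1 b hb hq'.2 hqb' (by rw [hslope]; nlinarith)
      refine ⟨θ p q' + Θ, ?_, ?_, by linarith [htri.1], ?_⟩
      · rw [h1, h_edge p hp q' hq'.1 m' hq'.2 hline hq'eq, mul_assoc, ← Complex.exp_add]
        congr 2; push_cast; ring
      · linarith [h_lo p hp q' hq'.1 hq'.2]
      · intro heq r hr
        have h5 : θ p q' + θ q' b = θ p b := le_antisymm htri.1 (by linarith)
        have h6 := htri.2 h5
        rw [hslope] at h6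
        have h7 : x b - x p = m' * (g b - g p) := by
          apply mul_right_cancel₀ hq'pos.ne'
          linarith
        have h8 := hline r hr
        rw [h7]
        nlinarith

theorem exists_hull_start {ι : Type*} (F : Finset ι) (g x : ι → ℝ) (p b : ι)
    (hb : b ∈ F) (hpb : g p < g b) (hpg : ∀ r ∈ F, g p ≤ g r)
    (hpx : ∀ r ∈ F, g r = g p → x r ≤ x p) :
    ∃ m : ℝ, ∀ r ∈ F, x r - m * g r ≤ x p - m * g p := by
  obtain ⟨q', hq', hmax⟩ := (F.filter (fun r => g p < g r)).exists_max_image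
    (fun r => (x r - x p) / (g r - g p)) ⟨b, by simp [hb, hpb]⟩
  refine ⟨(x q' - x p) / (g q' - g p), fun r hr => ?_⟩
  rcases lt_or_eq_of_le (hpg r hr) with h | h
  · have := hmax r (by simp [hr, h])
    rw [div_le_iff₀ (by linarith)] at this
    linarith
  · have := hpx r hr h.symm
    rw [h]; linarith

/-! ### Rotation angles in stereographic coordinates -/

section Phases

open Complex ComplexConjugate

theorem im_eq_norm_mul_sin {z : ℂ} {r t : ℝ} (h : z = r * exp (t * I)) : z.im = r * Real.sin t := by
  rw [h, im_ofReal_mul, exp_ofReal_mul_I_im]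

theorem re_eq_norm_mul_cos {z : ℂ} {r t : ℝ} (h : z = r * exp (t * I)) : z.re = r * Real.cos t := by
  rw [h, re_ofReal_mul, exp_ofReal_mul_I_re]

theorem sin_nonpos_iff_of_mem {t : ℝ} (h1 : -Real.pi < t) (h2 : t < Real.pi) :
    (Real.sin t ≤ 0 ↔ t ≤ 0) ∧ (0 ≤ Real.sin t ↔ 0 ≤ t) := by
  rcases lt_trichotomy t 0 with h | rfl | h
  · have := Real.sin_neg_of_neg_of_neg_pi_lt h h1
    constructor <;> constructor <;> intro <;> linarith
  · simp
  · have := Real.sin_pos_of_pos_of_lt_pi h h2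
    constructor <;> constructor <;> intro <;> linarith

/-- The rotation angle of parallel transport between points with stereographic coordinates
`a` and `b`. -/
def spinAngle (a b : ℂ) : ℝ := arg (1 + conj a * b)

theorem spinAngle_eq_zero {a b : ℂ} (h1 : 0 ≤ (conj a * b).re) (h2 : (conj a * b).im = 0) :
    spinAngle a b = 0 := by
  rw [spinAngle, arg_eq_zero_iff]
  constructor
  · simp only [add_re, one_re]; linarith
  · simp only [add_im, one_im, h2, add_zero]

theorem spinAngle_mem {a b : ℂ} (h1 : 0 ≤ (conj a * b).re) (h2 : 0 < (conj a * b).im) :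
    0 < spinAngle a b ∧ spinAngle a b < Real.pi / 2 := by
  have hre : 0 < (1 + conj a * b).re := by simp only [add_re, one_re]; linarith
  have him : 0 < (1 + conj a * b).im := by simp only [add_im, one_im]; linarith
  have hlt := abs_arg_lt_pi_div_two_iff.2 (Or.inl hre)
  refine ⟨lt_of_le_of_ne (arg_nonneg_iff.2 him.le) ?_, (abs_lt.1 hlt).2⟩
  intro h
  exact him.ne' (arg_eq_zero_iff.1 h.symm).2

theorem spinAngle_mem_Ico {a b : ℂ} (h1 : 0 ≤ (conj a * b).re) (h2 : 0 ≤ (conj a * b).im) :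
    0 ≤ spinAngle a b ∧ spinAngle a b < Real.pi / 2 := by
  rcases h2.eq_or_lt with h | h
  · rw [spinAngle_eq_zero h1 h.symm]
    exact ⟨le_rfl, by linarith [Real.pi_pos]⟩
  · exact ⟨(spinAngle_mem h1 h).1.le, (spinAngle_mem h1 h).2⟩

theorem spinAngle_exp (a b : ℂ) :
    1 + conj a * b = (‖1 + conj a * b‖ : ℝ) * exp (spinAngle a b * I) :=
  (norm_mul_exp_arg_mul_I _).symm

/-- Comparison of the rotation along two sides of a spherical triangle with the rotation along
the third, in terms of the orientation of the triangle. -/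
theorem spinAngle_triangle {a b c : ℂ} (h1 : 0 ≤ (conj a * b).re) (h2 : 0 ≤ (conj a * b).im)
    (h3 : 0 ≤ (conj b * c).re) (h4 : 0 ≤ (conj b * c).im) (h5 : 0 ≤ (conj a * c).re)
    (h6 : 0 ≤ (conj a * c).im) :
    (((1 + conj a * b) * (1 + conj b * c) * (1 + conj c * a)).im ≤ 0 ↔
      spinAngle a b + spinAngle b c ≤ spinAngle a c) ∧
    (0 ≤ ((1 + conj a * b) * (1 + conj b * c) * (1 + conj c * a)).im ↔
      spinAngle a c ≤ spinAngle a b + spinAngle b c) := by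
  have e1 := spinAngle_exp a b
  have e2 := spinAngle_exp b c
  have e3 := spinAngle_exp a c
  have m1 := spinAngle_mem_Ico h1 h2
  have m2 := spinAngle_mem_Ico h3 h4
  have m3 := spinAngle_mem_Ico h5 h6
  have e3' : 1 + conj c * a = (‖1 + conj a * c‖ : ℝ) * exp ((-spinAngle a c : ℝ) * I) := by
    have := congrArg conj e3
    simp only [map_add, map_one, map_mul, conj_conj, conj_ofReal, ← exp_conj, conj_I] at this
    rw [mul_comm (conj c) a, this]
    congr 2; push_cast; ring
  have hprod : (1 + conj a * b) * (1 + conj b * c) * (1 + conj c * a) =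
      ((‖1 + conj a * b‖ * ‖1 + conj b * c‖ * ‖1 + conj a * c‖ : ℝ) : ℂ) *
        exp ((spinAngle a b + spinAngle b c - spinAngle a c : ℝ) * I) := by
    rw [e3']
    nth_rewrite 1 [e1]
    nth_rewrite 1 [e2]
    have : ((spinAngle a b + spinAngle b c - spinAngle a c : ℝ) : ℂ) * I =
      spinAngle a b * I + spinAngle b c * I + ((-spinAngle a c : ℝ) : ℂ) * I := by push_cast; ring
    rw [this, exp_add, exp_add]; push_cast; ring
  have hpos : 0 < ‖1 + conj a * b‖ * ‖1 + conj b * c‖ * ‖1 + conj a * c‖ := by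
    have hne : ∀ z w : ℂ, 0 ≤ (conj z * w).re → 0 < ‖1 + conj z * w‖ := by
      intro z w h
      rw [norm_pos_iff]
      intro h0
      have := congrArg re h0
      simp only [add_re, one_re, zero_re] at this
      linarith
    exact mul_pos (mul_pos (hne _ _ h1) (hne _ _ h3)) (hne _ _ h5)
  rw [im_eq_norm_mul_sin hprod]
  -- All three angles lie in [0, π/2), so this combination lies in (-π, π), where the sign of the
  -- sine is the sign of the angle.
  have hs := sin_nonpos_iff_of_mem (t := spinAngle a b + spinAngle b c - spinAngle a c)
    (by linarith [Real.pi_pos]) (by linarith [Real.pi_pos])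
  constructor
  · rw [← sub_nonpos (a := spinAngle a b + spinAngle b c), ← hs.1]
    exact ⟨fun h => by by_contra h'; exact absurd (mul_pos hpos (not_le.1 h')) (not_lt.2 h),
      fun h => mul_nonpos_of_nonneg_of_nonpos hpos.le h⟩
  · rw [← sub_nonneg (b := spinAngle a c), ← hs.2]
    exact mul_nonneg_iff_of_pos_left hpos

/-- The product z = conj a · b has argument arg b - arg a, and adding 1 turns it towards 0: Im(z ·
conj(1 + z)) = Im z > 0. -/
theorem arg_sub_arg_mem {a b : ℂ} (ha : 0 < a.re) (hb : 0 < b.re) (h1 : 0 ≤ (conj a * b).re)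
    (h2 : 0 < (conj a * b).im) :
    spinAngle a b < arg b - arg a ∧ arg b - arg a ≤ Real.pi / 2 := by
  have ea : a = (‖a‖ : ℝ) * exp (arg a * I) := (norm_mul_exp_arg_mul_I _).symm
  have eb : b = (‖b‖ : ℝ) * exp (arg b * I) := (norm_mul_exp_arg_mul_I _).symm
  have hab : conj a * b = ((‖a‖ * ‖b‖ : ℝ) : ℂ) * exp ((arg b - arg a : ℝ) * I) := by
    have := congrArg conj ea
    simp only [map_mul, conj_ofReal, ← exp_conj, conj_I] at this
    rw [this]
    nth_rewrite 1 [eb]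
    have h' : ((arg b - arg a : ℝ) : ℂ) * I = arg a * (-I) + arg b * I := by push_cast; ring
    rw [h', exp_add]; push_cast; ring
  have hpos : 0 < ‖a‖ * ‖b‖ := by
    refine mul_pos (norm_pos_iff.2 ?_) (norm_pos_iff.2 ?_)
    · rintro rfl; simp at ha
    · rintro rfl; simp at hb
  have m := spinAngle_mem h1 h2
  have ba := abs_lt.1 (abs_arg_lt_pi_div_two_iff.2 (Or.inl ha))
  have bb := abs_lt.1 (abs_arg_lt_pi_div_two_iff.2 (Or.inl hb))
  have him := im_eq_norm_mul_sin hab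
  have hre := re_eq_norm_mul_cos hab
  have hsin : 0 < Real.sin (arg b - arg a) := by
    rw [him] at h2
    exact (mul_pos_iff_of_pos_left hpos).1 h2
  have hposd : 0 < arg b - arg a := by
    by_contra hcon
    have := (sin_nonpos_iff_of_mem (t := arg b - arg a) (by linarith) (by linarith)).1.2
      (not_lt.1 hcon)
    linarith
  have hle : arg b - arg a ≤ Real.pi / 2 := by
    by_contra hcon
    have := Real.cos_neg_of_pi_div_two_lt_of_lt (not_le.1 hcon) (by linarith [Real.pi_pos])
    rw [hre] at h1
    nlinarith
  refine ⟨?_, hle⟩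
  have e3 := spinAngle_exp a b
  have hprod : (conj a * b) * conj (1 + conj a * b) =
      ((‖a‖ * ‖b‖ * ‖1 + conj a * b‖ : ℝ) : ℂ) *
        exp ((arg b - arg a - spinAngle a b : ℝ) * I) := by
    have := congrArg conj e3
    simp only [map_mul, conj_ofReal, ← exp_conj, conj_I] at this
    rw [this, hab]
    have h' : ((arg b - arg a - spinAngle a b : ℝ) : ℂ) * I =
      ((arg b - arg a : ℝ) : ℂ) * I + spinAngle a b * (-I) := by push_cast; ring
    rw [h', exp_add]; push_cast; ring
  have him2 := im_eq_norm_mul_sin hprod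
  have him3 : ((conj a * b) * conj (1 + conj a * b)).im = (conj a * b).im := by
    rw [map_add, map_one, mul_add, mul_one, mul_conj]
    simp only [add_im, ofReal_im, add_zero]
  rw [him3] at him2
  by_contra hcon
  have := (sin_nonpos_iff_of_mem (t := arg b - arg a - spinAngle a b) (by linarith)
    (by linarith)).1.2 (by linarith)
  have h7 : 0 ≤ ‖a‖ * ‖b‖ * ‖1 + conj a * b‖ := by positivity
  nlinarith

end Phases

/-! ### Algebra of transport along an edge -/

section Algebra

open Complex ComplexConjugate

/-- Algebraic form of parallel transport: `a`, `b` are stereographic coordinates (`a'`, `b'` their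
conjugates), `(v₁, v₂, -i V)` and `(w₁, w₂, -i W)` are vectors orthogonal to the corresponding
points. -/
theorem transport_identity {v₁ v₂ V w₁ w₂ W a a' b b' : ℂ}
    (hv : v₁ * (1 - a * a') + v₂ * (a + a') - V * (a - a') = 0)
    (hw : w₁ * (1 - b * b') + w₂ * (b + b') - W * (b - b') = 0)
    (hlink : (v₁ * ((a + a') * (b - b') - (a - a') * (b + b')) +
        v₂ * ((a - a') * (1 - b * b') - (1 - a * a') * (b - b')) +
        V * ((1 - a * a') * (b + b') - (a + a') * (1 - b * b'))) *
          (w₁ * (1 - a * a') + w₂ * (a + a') - W * (a - a')) * (1 + b * b') +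
      (w₁ * ((a + a') * (b - b') - (a - a') * (b + b')) +
        w₂ * ((a - a') * (1 - b * b') - (1 - a * a') * (b - b')) +
        W * ((1 - a * a') * (b + b') - (a + a') * (1 - b * b'))) *
          (v₁ * (1 - b * b') + v₂ * (b + b') - V * (b - b')) * (1 + a * a') = 0)
    (hne : a ≠ b) (hne' : a' ≠ b') :
    (-2 * a' * v₁ + (1 - a' ^ 2) * v₂ - (1 + a' ^ 2) * V) *
        (-2 * b * w₁ + (1 - b ^ 2) * w₂ + (1 + b ^ 2) * W) * (1 + a * b') ^ 2 =
      (-2 * b' * w₁ + (1 - b' ^ 2) * w₂ - (1 + b' ^ 2) * W) *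
        (-2 * a * v₁ + (1 - a ^ 2) * v₂ + (1 + a ^ 2) * V) * (1 + a' * b) ^ 2 := by
  set Xv := -2 * a' * v₁ + (1 - a' ^ 2) * v₂ - (1 + a' ^ 2) * V with hXv
  set Yv := -2 * a * v₁ + (1 - a ^ 2) * v₂ + (1 + a ^ 2) * V with hYv
  set Xw := -2 * b' * w₁ + (1 - b' ^ 2) * w₂ - (1 + b' ^ 2) * W with hXw
  set Yw := -2 * b * w₁ + (1 - b ^ 2) * w₂ + (1 + b ^ 2) * W with hYw
  set P := 2 * (b - a) * (1 + a * b') with hP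
  set P' := 2 * (b' - a') * (1 + a' * b) with hP'
  set Q := 2 * (a - b) * (1 + b * a') with hQ
  set Q' := 2 * (a' - b') * (1 + b' * a) with hQ'
  set G := (1 - a * a') * (1 - b * b') + (a + a') * (b + b') - (a - a') * (b - b') with hG
  have e1 : 2 * (1 + a * a') ^ 2 * (v₁ * (1 - b * b') + v₂ * (b + b') - V * (b - b')) =
      Xv * P + Yv * P' := by
    rw [hXv, hYv, hP, hP']
    linear_combination (2 * G) * hv
  have e2 : 2 * (1 + b * b') ^ 2 * (w₁ * (1 - a * a') + w₂ * (a + a') - W * (a - a')) =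
      Xw * Q + Yw * Q' := by
    rw [hXw, hYw, hQ, hQ']
    linear_combination (2 * G) * hw
  have e3 : 2 * (1 + a * a') * (v₁ * ((a + a') * (b - b') - (a - a') * (b + b')) +
        v₂ * ((a - a') * (1 - b * b') - (1 - a * a') * (b - b')) +
        V * ((1 - a * a') * (b + b') - (a + a') * (1 - b * b'))) = Yv * P' - Xv * P := by
    rw [hXv, hYv, hP, hP']; ring
  have e4 : 2 * (1 + b * b') * (w₁ * ((a + a') * (b - b') - (a - a') * (b + b')) +
        w₂ * ((a - a') * (1 - b * b') - (1 - a * a') * (b - b')) +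
        W * ((1 - a * a') * (b + b') - (a + a') * (1 - b * b'))) = Xw * Q - Yw * Q' := by
    rw [hXw, hYw, hQ, hQ']; ring
  -- The pairings of v and w with the opposite point and with the common normal are now linear in
  -- their null components. In the link relation the products X X and Y Y cancel, leaving only mixed
  -- ones.
  have e5 : (Yv * P' - Xv * P) * (Xw * Q + Yw * Q') +
      (Xw * Q - Yw * Q') * (Xv * P + Yv * P') = 0 := by
    rw [← e1, ← e2, ← e3, ← e4]
    linear_combination (4 * (1 + a * a') * (1 + b * b')) * hlink
  have e6 : (b - a) * (b' - a') * (Xv * Yw * (1 + a * b') ^ 2 - Xw * Yv * (1 + a' * b) ^ 2) = 0 := by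
    have h8 : 8 * ((b - a) * (b' - a') *
        (Xv * Yw * (1 + a * b') ^ 2 - Xw * Yv * (1 + a' * b) ^ 2)) = 0 := by
      rw [hP, hP', hQ, hQ'] at e5
      linear_combination e5
    exact (mul_eq_zero.1 h8).resolve_left (by norm_num)
  have h9 := (mul_eq_zero.1 e6).resolve_left
    (mul_ne_zero (sub_ne_zero.2 hne.symm) (sub_ne_zero.2 hne'.symm))
  exact sub_eq_zero.1 h9

/-- With a' = conj a, the two factors pair v with the two isotropic directions orthogonal to the
point of coordinate a. They are both nonzero exactly when v is not isotropic. -/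
theorem isotropic_identity {v₁ v₂ V a a' : ℂ}
    (hv : v₁ * (1 - a * a') + v₂ * (a + a') - V * (a - a') = 0) :
    (-2 * a' * v₁ + (1 - a' ^ 2) * v₂ - (1 + a' ^ 2) * V) *
      (-2 * a * v₁ + (1 - a ^ 2) * v₂ + (1 + a ^ 2) * V) =
      (1 + a * a') ^ 2 * (v₁ ^ 2 + v₂ ^ 2 - V ^ 2) := by
  linear_combination
    (-(v₁ * (1 - a * a') + v₂ * (a + a') - V * (a - a'))) * hv

/-- The right side is the triple product of the vectors (1 - |a|², 2 Re a, 2 Im a), and likewise for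
b and c, so the imaginary part detects the orientation of the spherical triangle. -/
theorem im_bargmann (a b c : ℂ) :
    4 * ((1 + conj a * b) * (1 + conj b * c) * (1 + conj c * a)).im =
      (1 - normSq a) * (2 * b.re * (2 * c.im) - 2 * b.im * (2 * c.re)) -
      2 * a.re * ((1 - normSq b) * (2 * c.im) - 2 * b.im * (1 - normSq c)) +
      2 * a.im * ((1 - normSq b) * (2 * c.re) - 2 * b.re * (1 - normSq c)) := by
  simp [normSq_apply]
  ring

theorem phase_eq {X Y X' Y' a b : ℂ} (hX : X ≠ 0) (hX' : X' ≠ 0)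
    (hκ : 1 + conj a * b ≠ 0)
    (h : X * Y' * (1 + a * conj b) ^ 2 = X' * Y * (1 + conj a * b) ^ 2) :
    Y' / X' = Y / X * exp (((4 * spinAngle a b : ℝ) : ℂ) * I) := by
  have e := spinAngle_exp a b
  have e' : 1 + a * conj b = (‖1 + conj a * b‖ : ℝ) * exp (-(spinAngle a b * I)) := by
    have := congrArg conj e
    simp only [map_add, map_one, map_mul, conj_conj, conj_ofReal, ← exp_conj, conj_I] at this
    rw [this]; congr 2; ring
  have hn : ((‖1 + conj a * b‖ : ℝ) : ℂ) ≠ 0 := by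
    exact_mod_cast norm_ne_zero_iff.2 hκ
  rw [e'] at h
  nth_rewrite 2 [e] at h
  have h1 : X * Y' * exp (-(spinAngle a b * I)) ^ 2 = X' * Y * exp (spinAngle a b * I) ^ 2 := by
    apply mul_right_cancel₀ (pow_ne_zero 2 hn)
    linear_combination h
  rw [← exp_nat_mul, ← exp_nat_mul] at h1
  have h2 : X * Y' = X' * Y * exp (((4 * spinAngle a b : ℝ) : ℂ) * I) := by
    have := congrArg (fun z => z * exp ((2 : ℕ) * (spinAngle a b * I))) h1
    simp only [mul_assoc, ← exp_add] at this
    rw [show ((2 : ℕ) : ℂ) * -(spinAngle a b * I) + (2 : ℕ) * (spinAngle a b * I) = 0 by ring,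
      exp_zero, mul_one] at this
    rw [this, mul_assoc]
    congr 3; push_cast; ring
  rw [div_eq_iff hX']
  field_simp
  linear_combination h2

end Algebra

/-! ### Adapted frames and polarizations on a face -/

theorem ev_eq_sum (B : OrthonormalBasis (Fin 3) ℝ R3) (v : C3) (y : R3) :
    ev v y = ((inner ℝ (B 0) y : ℝ) : ℂ) * ev v (B 0) + ((inner ℝ (B 1) y : ℝ) : ℂ) * ev v (B 1) +
      ((inner ℝ (B 2) y : ℝ) : ℂ) * ev v (B 2) := by
  conv_lhs => rw [← B.sum_repr' y]
  rw [map_sum, Fin.sum_univ_three]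
  simp only [map_smul, Complex.real_smul]

theorem inner_eq_sum_basis (B : OrthonormalBasis (Fin 3) ℝ R3) (y z : R3) :
    (inner ℝ y z : ℝ) = inner ℝ (B 0) y * inner ℝ (B 0) z + inner ℝ (B 1) y * inner ℝ (B 1) z +
      inner ℝ (B 2) y * inner ℝ (B 2) z := by
  rw [← B.sum_inner_mul_inner y z, Fin.sum_univ_three, real_inner_comm, real_inner_comm y (B 1),
    real_inner_comm y (B 2)]

theorem dotC3_self_eq_sum (B : OrthonormalBasis (Fin 3) ℝ R3) (v : C3) :
    dotC3 v v = ev v (B 0) ^ 2 + ev v (B 1) ^ 2 + ev v (B 2) ^ 2 := by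
  have hev : ∀ i, ev v (B i) = ((inner ℝ (B i) (reC3 v) : ℝ) : ℂ) +
      ((inner ℝ (B i) (imC3 v) : ℝ) : ℂ) * Complex.I := by
    intro i
    rw [← ev_re, ← ev_im, Complex.re_add_im]
  have h1 := inner_eq_sum_basis B (reC3 v) (reC3 v)
  have h2 := inner_eq_sum_basis B (imC3 v) (imC3 v)
  have h3 := inner_eq_sum_basis B (reC3 v) (imC3 v)
  rw [inner_eq_sum] at h1 h2 h3
  have hv : ∀ i, v i = ((reC3 v i : ℝ) : ℂ) + ((imC3 v i : ℝ) : ℂ) * Complex.I := fun i =>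
    (Complex.re_add_im _).symm
  have hI := Complex.I_sq
  rw [hev, hev, hev]
  simp only [dotC3, Fin.sum_univ_three]
  rw [hv 0, hv 1, hv 2]
  have h1' := congrArg (fun r : ℝ => (r : ℂ)) h1
  have h2' := congrArg (fun r : ℝ => (r : ℂ)) h2
  have h3' := congrArg (fun r : ℝ => (r : ℂ)) h3
  push_cast at h1' h2' h3'
  linear_combination h1' + Complex.I ^ 2 * h2' + 2 * Complex.I * h3'

/-- An orthonormal frame adapted to a face `ν = 1` of `S`, with `B 1` normal to the face, such that
the face is seen from the axis `B 0` under an angle of at most `π / 2`. -/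
structure FacetFrame (S : Finset R3) (ν : R3) (B : OrthonormalBasis (Fin 3) ℝ R3) (h : ℝ) :
    Prop where
  pos : 0 < h
  le_one : ∀ r ∈ S, (inner ℝ ν r : ℝ) ≤ 1
  normal : B 1 = h • ν
  angle : ∀ p ∈ S, ∀ q ∈ S, (inner ℝ ν p : ℝ) = 1 → (inner ℝ ν q : ℝ) = 1 →
    0 ≤ h ^ 2 + inner ℝ (B 2) p * inner ℝ (B 2) q
  spans : ∀ x : R3, (∀ p ∈ S, (inner ℝ ν p : ℝ) = 1 → (inner ℝ p x : ℝ) = 0) → x = 0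

/-- Stereographic coordinate, with respect to the frame `B`, of the direction of `p`. -/
def stereo (B : OrthonormalBasis (Fin 3) ℝ R3) (p : R3) : ℂ :=
  (((inner ℝ (B 1) p : ℝ) : ℂ) + ((inner ℝ (B 2) p : ℝ) : ℂ) * Complex.I) /
    ((‖p‖ + inner ℝ (B 0) p : ℝ) : ℂ)

/-- Component of `v` along the conjugate null vector at stereographic coordinate `a`. -/
def nullX (B : OrthonormalBasis (Fin 3) ℝ R3) (v : C3) (a : ℂ) : ℂ :=
  -2 * (starRingEnd ℂ) a * ev v (B 0) + (1 - (starRingEnd ℂ) a ^ 2) * ev v (B 1) -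
    (1 + (starRingEnd ℂ) a ^ 2) * (Complex.I * ev v (B 2))

/-- Component of `v` along the null vector at stereographic coordinate `a`. -/
def nullY (B : OrthonormalBasis (Fin 3) ℝ R3) (v : C3) (a : ℂ) : ℂ :=
  -2 * a * ev v (B 0) + (1 - a ^ 2) * ev v (B 1) + (1 + a ^ 2) * (Complex.I * ev v (B 2))

namespace FacetFrame

variable {S : Finset R3} {v : R3 → C3} {ν : R3} {B : OrthonormalBasis (Fin 3) ℝ R3} {h : ℝ}

theorem inner_one (hB : FacetFrame S ν B h) {p : R3} (hp : (inner ℝ ν p : ℝ) = 1) :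
    (inner ℝ (B 1) p : ℝ) = h := by
  rw [hB.normal, inner_smul_left, hp]; simp

theorem norm_sq (hB : FacetFrame S ν B h) {p : R3} (hp : (inner ℝ ν p : ℝ) = 1) :
    ‖p‖ ^ 2 = inner ℝ (B 0) p ^ 2 + h ^ 2 + inner ℝ (B 2) p ^ 2 := by
  rw [← real_inner_self_eq_norm_sq, inner_eq_sum_basis B, hB.inner_one hp]; ring

theorem norm_add_pos (hB : FacetFrame S ν B h) {p : R3} (hp : (inner ℝ ν p : ℝ) = 1) :
    0 < ‖p‖ + inner ℝ (B 0) p := by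
  have h1 := hB.norm_sq hp
  have h2 : |(inner ℝ (B 0) p : ℝ)| < ‖p‖ :=
    abs_lt_of_sq_lt_sq (by nlinarith [hB.pos]) (norm_nonneg _)
  linarith [(abs_lt.1 h2).1]

theorem stereo_re (hB : FacetFrame S ν B h) {p : R3} (hp : (inner ℝ ν p : ℝ) = 1) :
    (stereo B p).re = h / (‖p‖ + inner ℝ (B 0) p) := by
  rw [stereo, Complex.div_ofReal_re, hB.inner_one hp]; simp

theorem stereo_im (p : R3) :
    (stereo B p).im = inner ℝ (B 2) p / (‖p‖ + inner ℝ (B 0) p) := by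
  rw [stereo, Complex.div_ofReal_im]; simp

theorem normSq_stereo (hB : FacetFrame S ν B h) {p : R3} (hp : (inner ℝ ν p : ℝ) = 1) :
    Complex.normSq (stereo B p) = (‖p‖ - inner ℝ (B 0) p) / (‖p‖ + inner ℝ (B 0) p) := by
  have h1 := hB.norm_sq hp
  have h2 := hB.norm_add_pos hp
  rw [Complex.normSq_apply, hB.stereo_re hp, stereo_im]
  field_simp
  linarith

theorem conj_mul_stereo_re (hB : FacetFrame S ν B h) {p q : R3} (hp : (inner ℝ ν p : ℝ) = 1)
    (hq : (inner ℝ ν q : ℝ) = 1) :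
    ((starRingEnd ℂ) (stereo B p) * stereo B q).re =
      (h ^ 2 + inner ℝ (B 2) p * inner ℝ (B 2) q) /
        ((‖p‖ + inner ℝ (B 0) p) * (‖q‖ + inner ℝ (B 0) q)) := by
  have h1 := (hB.norm_add_pos hp).ne'
  have h2 := (hB.norm_add_pos hq).ne'
  rw [Complex.mul_re, Complex.conj_re, Complex.conj_im, hB.stereo_re hp, hB.stereo_re hq,
    stereo_im, stereo_im]
  field_simp
  ring

theorem conj_mul_stereo_im (hB : FacetFrame S ν B h) {p q : R3} (hp : (inner ℝ ν p : ℝ) = 1)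
    (hq : (inner ℝ ν q : ℝ) = 1) :
    ((starRingEnd ℂ) (stereo B p) * stereo B q).im =
      h * (inner ℝ (B 2) q - inner ℝ (B 2) p) /
        ((‖p‖ + inner ℝ (B 0) p) * (‖q‖ + inner ℝ (B 0) q)) := by
  have h1 := (hB.norm_add_pos hp).ne'
  have h2 := (hB.norm_add_pos hq).ne'
  rw [Complex.mul_im, Complex.conj_re, Complex.conj_im, hB.stereo_re hp, hB.stereo_re hq,
    stereo_im, stereo_im]
  field_simp
  ring

theorem conj_mul_re_nonneg (hB : FacetFrame S ν B h) {p q : R3} (hp : p ∈ S) (hq : q ∈ S)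
    (hp' : (inner ℝ ν p : ℝ) = 1) (hq' : (inner ℝ ν q : ℝ) = 1) :
    0 ≤ ((starRingEnd ℂ) (stereo B p) * stereo B q).re := by
  rw [hB.conj_mul_stereo_re hp' hq']
  exact div_nonneg (hB.angle p hp q hq hp' hq')
    (mul_pos (hB.norm_add_pos hp') (hB.norm_add_pos hq')).le

theorem conj_mul_im_pos (hB : FacetFrame S ν B h) {p q : R3}
    (hp' : (inner ℝ ν p : ℝ) = 1) (hq' : (inner ℝ ν q : ℝ) = 1)
    (hpq : (inner ℝ (B 2) p : ℝ) < inner ℝ (B 2) q) :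
    0 < ((starRingEnd ℂ) (stereo B p) * stereo B q).im := by
  rw [hB.conj_mul_stereo_im hp' hq']
  exact div_pos (mul_pos hB.pos (by linarith))
    (mul_pos (hB.norm_add_pos hp') (hB.norm_add_pos hq'))

/-- The coordinates of `p` in terms of its stereographic coordinate. -/
theorem coords (hB : FacetFrame S ν B h) {p : R3} (hp : (inner ℝ ν p : ℝ) = 1) :
    ∃ K : ℝ, 0 < K ∧ (inner ℝ (B 0) p : ℝ) = K * (1 - Complex.normSq (stereo B p)) ∧
      h = K * (2 * (stereo B p).re) ∧ (inner ℝ (B 2) p : ℝ) = K * (2 * (stereo B p).im) ∧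
      ‖p‖ = K * (1 + Complex.normSq (stereo B p)) := by
  have h2 := hB.norm_add_pos hp
  refine ⟨(‖p‖ + inner ℝ (B 0) p) / 2, by positivity, ?_, ?_, ?_, ?_⟩
  · rw [hB.normSq_stereo hp]; field_simp; ring
  · rw [hB.stereo_re hp]; field_simp
  · rw [stereo_im]; field_simp
  · rw [hB.normSq_stereo hp]; field_simp; ring

/-- All points of the face have height h along `B 1`, so their triple product is h times the planar
orientation on the left. Each point is a positive multiple of its stereographic vector, and
`im_bargmann` applies. -/
theorem bargmann_sign (hB : FacetFrame S ν B h) {p q r : R3} (hp : (inner ℝ ν p : ℝ) = 1)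
    (hq : (inner ℝ ν q : ℝ) = 1) (hr : (inner ℝ ν r : ℝ) = 1) :
    ∃ c : ℝ, 0 < c ∧
      (inner ℝ (B 0) r - inner ℝ (B 0) p) * (inner ℝ (B 2) q - inner ℝ (B 2) p) -
        (inner ℝ (B 0) q - inner ℝ (B 0) p) * (inner ℝ (B 2) r - inner ℝ (B 2) p) =
      c * ((1 + (starRingEnd ℂ) (stereo B p) * stereo B q) *
        (1 + (starRingEnd ℂ) (stereo B q) * stereo B r) *
        (1 + (starRingEnd ℂ) (stereo B r) * stereo B p)).im := by
  obtain ⟨K, hK, e0, e1, e2, -⟩ := hB.coords hp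
  obtain ⟨L, hL, f0, f1, f2, -⟩ := hB.coords hq
  obtain ⟨M, hM, g0, g1, g2, -⟩ := hB.coords hr
  have hh := hB.pos
  refine ⟨4 * K * L * M / h, by positivity, ?_⟩
  have hb := im_bargmann (stereo B p) (stereo B q) (stereo B r)
  set z := ((1 + (starRingEnd ℂ) (stereo B p) * stereo B q) *
        (1 + (starRingEnd ℂ) (stereo B q) * stereo B r) *
        (1 + (starRingEnd ℂ) (stereo B r) * stereo B p)).im
  set a := stereo B p
  set b := stereo B q
  set c := stereo B r
  have hz : 4 * K * L * M / h * z = K * L * M * (4 * z) / h := by ring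
  rw [hz, hb, eq_div_iff hh.ne']
  have t1 : h * (inner ℝ (B 2) r : ℝ) - inner ℝ (B 2) q * h =
      L * M * (2 * b.re * (2 * c.im) - 2 * b.im * (2 * c.re)) := by
    nth_rewrite 1 [f1]
    nth_rewrite 1 [g1]
    rw [f2, g2]; ring
  have t2 : (inner ℝ (B 0) q : ℝ) * inner ℝ (B 2) r - inner ℝ (B 2) q * inner ℝ (B 0) r =
      L * M * ((1 - Complex.normSq b) * (2 * c.im) - 2 * b.im * (1 - Complex.normSq c)) := by
    rw [f0, g0, f2, g2]; ring
  have t3 : (inner ℝ (B 0) q : ℝ) * h - h * inner ℝ (B 0) r =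
      L * M * ((1 - Complex.normSq b) * (2 * c.re) - 2 * b.re * (1 - Complex.normSq c)) := by
    nth_rewrite 2 [f1]
    nth_rewrite 1 [g1]
    rw [f0, g0]; ring
  calc _ = (inner ℝ (B 0) p : ℝ) * (h * (inner ℝ (B 2) r : ℝ) - inner ℝ (B 2) q * h) -
        h * ((inner ℝ (B 0) q : ℝ) * inner ℝ (B 2) r - inner ℝ (B 2) q * inner ℝ (B 0) r) +
        inner ℝ (B 2) p * ((inner ℝ (B 0) q : ℝ) * h - h * inner ℝ (B 0) r) := by ring
    _ = (K * (1 - Complex.normSq a)) * (L * M * (2 * b.re * (2 * c.im) - 2 * b.im * (2 * c.re))) -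
        (K * (2 * a.re)) *
          (L * M * ((1 - Complex.normSq b) * (2 * c.im) - 2 * b.im * (1 - Complex.normSq c))) +
        (K * (2 * a.im)) *
          (L * M * ((1 - Complex.normSq b) * (2 * c.re) - 2 * b.re * (1 - Complex.normSq c))) := by
        rw [t1, t2, t3, ← e0, ← e1, ← e2]
    _ = _ := by ring

theorem coords_complex (hB : FacetFrame S ν B h) {p : R3} (hp : (inner ℝ ν p : ℝ) = 1) :
    ∃ K : ℝ, 0 < K ∧ ((inner ℝ (B 0) p : ℝ) : ℂ) =
        K * (1 - stereo B p * (starRingEnd ℂ) (stereo B p)) ∧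
      ((inner ℝ (B 1) p : ℝ) : ℂ) = K * (stereo B p + (starRingEnd ℂ) (stereo B p)) ∧
      ((inner ℝ (B 2) p : ℝ) : ℂ) =
        -Complex.I * (K * (stereo B p - (starRingEnd ℂ) (stereo B p))) ∧
      ((‖p‖ : ℝ) : ℂ) = K * (1 + stereo B p * (starRingEnd ℂ) (stereo B p)) := by
  obtain ⟨K, hK, e0, e1, e2, e3⟩ := hB.coords hp
  refine ⟨K, hK, ?_, ?_, ?_, ?_⟩
  · rw [e0, Complex.mul_conj]; push_cast; ring
  · rw [hB.inner_one hp, Complex.add_conj]; nth_rewrite 1 [e1]; push_cast; ring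
  · rw [e2, Complex.sub_conj]
    push_cast
    linear_combination ((K : ℂ) * 2 * (stereo B p).im) * Complex.I_sq
  · rw [e3, Complex.mul_conj]; push_cast; ring

theorem stereo_ne (hB : FacetFrame S ν B h) {p q : R3} (hp : (inner ℝ ν p : ℝ) = 1)
    (hq : (inner ℝ ν q : ℝ) = 1) (hpq : p ≠ q) : stereo B p ≠ stereo B q := by
  intro heq
  obtain ⟨K, hK, e0, e1, e2, -⟩ := hB.coords hp
  obtain ⟨L, hL, f0, f1, f2, -⟩ := hB.coords hq
  have hre : (stereo B q).re ≠ 0 := by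
    rw [hB.stereo_re hq]; exact (div_pos hB.pos (hB.norm_add_pos hq)).ne'
  rw [heq] at e0 e1 e2
  have hKL : K = L := by
    rw [e1] at f1
    have h2 : (2 * (stereo B q).re) ≠ 0 := mul_ne_zero two_ne_zero hre
    exact mul_right_cancel₀ h2 f1
  subst hKL
  apply hpq
  rw [← B.sum_repr' p, ← B.sum_repr' q, Fin.sum_univ_three, Fin.sum_univ_three, e0, e2, f0, f2,
    hB.inner_one hp, hB.inner_one hq]

theorem ev_stereo (hB : FacetFrame S ν B h) (hv : IsCollisionFree S v) {p : R3} (hp : p ∈ S)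
    (hp' : (inner ℝ ν p : ℝ) = 1) :
    ev (v p) (B 0) * (1 - stereo B p * (starRingEnd ℂ) (stereo B p)) +
      ev (v p) (B 1) * (stereo B p + (starRingEnd ℂ) (stereo B p)) -
      (Complex.I * ev (v p) (B 2)) * (stereo B p - (starRingEnd ℂ) (stereo B p)) = 0 := by
  obtain ⟨K, hK, e0, e1, e2, -⟩ := hB.coords_complex hp'
  have h1 := hv.div_free p hp
  rw [ev_eq_sum B, e0, e1, e2] at h1
  have hK' : (K : ℂ) ≠ 0 := by exact_mod_cast hK.ne'
  apply mul_left_cancel₀ hK'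
  linear_combination h1

theorem null_ne_zero (hB : FacetFrame S ν B h) (hv : IsCollisionFree S v) {p : R3} (hp : p ∈ S)
    (hp' : (inner ℝ ν p : ℝ) = 1) (hiso : dotC3 (v p) (v p) ≠ 0) :
    nullX B (v p) (stereo B p) ≠ 0 ∧ nullY B (v p) (stereo B p) ≠ 0 := by
  rw [← mul_ne_zero_iff, nullX, nullY, isotropic_identity (hB.ev_stereo hv hp hp')]
  refine mul_ne_zero (pow_ne_zero 2 ?_) ?_
  · rw [Complex.mul_conj]
    have := Complex.normSq_nonneg (stereo B p)
    have h2 : (1 + Complex.normSq (stereo B p) : ℝ) ≠ 0 := by positivity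
    exact_mod_cast h2
  · rw [dotC3_self_eq_sum B] at hiso
    rw [mul_pow, Complex.I_sq]
    convert hiso using 1
    ring

/-- The polarization at `p` relative to the frame. -/
def polarization (B : OrthonormalBasis (Fin 3) ℝ R3) (v : R3 → C3) (p : R3) : ℂ :=
  nullY B (v p) (stereo B p) / nullX B (v p) (stereo B p)

theorem polarization_transport (hB : FacetFrame S ν B h) (hv : IsCollisionFree S v) {k p q : R3}
    (hE : OnEdge S ν k p q) (hp : dotC3 (v p) (v p) ≠ 0) (hq : dotC3 (v q) (v q) ≠ 0) :
    polarization B v q = polarization B v p *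
      Complex.exp (((4 * spinAngle (stereo B p) (stereo B q) : ℝ) : ℂ) * Complex.I) := by
  have hXp := hB.null_ne_zero hv hE.left_mem hE.left_face hp
  have hXq := hB.null_ne_zero hv hE.right_mem hE.right_face hq
  have hne := hB.stereo_ne hE.left_face hE.right_face hE.ne
  have hκ : 1 + (starRingEnd ℂ) (stereo B p) * stereo B q ≠ 0 := by
    intro h0
    have h1 := congrArg Complex.re h0
    have h2 := hB.conj_mul_re_nonneg hE.left_mem hE.right_mem hE.left_face hE.right_face
    simp only [Complex.add_re, Complex.one_re, Complex.zero_re] at h1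
    linarith
  refine phase_eq hXp.1 hXq.1 hκ ?_
  refine transport_identity (hB.ev_stereo hv hE.left_mem hE.left_face)
    (hB.ev_stereo hv hE.right_mem hE.right_face) ?_ hne
    (fun h => hne ((starRingEnd ℂ).injective h))
  obtain ⟨K, hK, e0, e1, e2, e3⟩ := hB.coords_complex hE.left_face
  obtain ⟨L, hL, f0, f1, f2, f3⟩ := hB.coords_complex hE.right_face
  have hK' : (K : ℂ) ≠ 0 := by exact_mod_cast hK.ne'
  have hL' : (L : ℂ) ≠ 0 := by exact_mod_cast hL.ne'
  have hpq : ev (v p) (q - p) = ev (v p) q := by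
    rw [map_sub, hv.div_free p hE.left_mem, sub_zero]
  have hqp : ev (v q) (q - p) = - ev (v q) p := by
    rw [map_sub, hv.div_free q hE.right_mem, zero_sub]
  set a := stereo B p with ha
  set a' := (starRingEnd ℂ) a with ha'
  set b := stereo B q with hb
  set b' := (starRingEnd ℂ) b with hb'
  have evp : ev (v p) q = L * (ev (v p) (B 0) * (1 - b * b') + ev (v p) (B 1) * (b + b') -
      (Complex.I * ev (v p) (B 2)) * (b - b')) := by
    rw [ev_eq_sum B, f0, f1, f2]; ring
  have evq : ev (v q) p = K * (ev (v q) (B 0) * (1 - a * a') + ev (v q) (B 1) * (a + a') -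
      (Complex.I * ev (v q) (B 2)) * (a - a')) := by
    rw [ev_eq_sum B, e0, e1, e2]; ring
  -- On a singular edge both v_p · q and v_q · p vanish and the link relation is trivial. On a
  -- regular edge |p| = |q| absorbs the scaling factors K and L.
  by_cases hreg : ev (v p) (q - p) = 0
  · have hreg' : ev (v q) (q - p) = 0 := by
      by_contra hcon
      exact hE.isEdge.ne_zero_of_ne_zero hv hE.right_mem hE.left_mem hE.lexPair_right rfl hcon hreg
    rw [hpq, evp] at hreg
    rw [hqp, neg_eq_zero, evq] at hreg'
    have h1 := (mul_eq_zero.1 hreg).resolve_left hL'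
    have h2 := (mul_eq_zero.1 hreg').resolve_left hK'
    rw [h1, h2]; ring
  · have hnorm := (hE.isEdge.regular hv hE.left_mem hE.right_mem rfl hE.lexPair_right hE.ne
      hreg).1
    have hnorm' : (K : ℂ) * (1 + a * a') = L * (1 + b * b') := by rw [← e3, ← f3, hnorm]
    have hn0 : (K : ℂ) * (1 + a * a') ≠ 0 := by
      rw [← e3]
      have : p ≠ 0 := fun h0 => hv.zero_notMem (h0 ▸ hE.left_mem)
      exact_mod_cast norm_ne_zero_iff.2 this
    -- The frame coordinates of a cross product of p and q, hence of a vector orthogonal to both.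
    set c₀ : ℝ := inner ℝ (B 1) p * inner ℝ (B 2) q - inner ℝ (B 2) p * inner ℝ (B 1) q with hc₀
    set c₁ : ℝ := inner ℝ (B 2) p * inner ℝ (B 0) q - inner ℝ (B 0) p * inner ℝ (B 2) q with hc₁
    set c₂ : ℝ := inner ℝ (B 0) p * inner ℝ (B 1) q - inner ℝ (B 1) p * inner ℝ (B 0) q with hc₂
    set e : R3 := c₀ • B 0 + c₁ • B 1 + c₂ • B 2 with he
    have hB0 : ∀ i, (inner ℝ (B i) e : ℝ) = ![c₀, c₁, c₂] i := by
      intro i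
      rw [he]
      simp only [inner_add_right, inner_smul_right]
      fin_cases i <;> simp [orthonormal_iff_ite.1 B.orthonormal]
    have hep : (inner ℝ p e : ℝ) = 0 := by
      rw [inner_eq_sum_basis B, hB0, hB0, hB0]
      simp [hc₀, hc₁, hc₂]; ring
    have heq : (inner ℝ q e : ℝ) = 0 := by
      rw [inner_eq_sum_basis B, hB0, hB0, hB0]
      simp [hc₀, hc₁, hc₂]; ring
    have hed : (inner ℝ (q - p) e : ℝ) = 0 := by rw [inner_sub_left, hep, heq, sub_zero]
    have hprop := hE.isEdge.proportional hv hE.left_mem hE.right_mem rfl hE.lexPair_right hed hep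
    have hI := Complex.I_sq
    have eve : ∀ w : C3, ev w e = -Complex.I * (K * L) *
        (ev w (B 0) * ((a + a') * (b - b') - (a - a') * (b + b')) +
        ev w (B 1) * ((a - a') * (1 - b * b') - (1 - a * a') * (b - b')) +
        Complex.I * ev w (B 2) * ((1 - a * a') * (b + b') - (a + a') * (1 - b * b'))) := by
      intro w
      rw [he, map_add, map_add, map_smul, map_smul, map_smul, Complex.real_smul, Complex.real_smul,
        Complex.real_smul, hc₀, hc₁, hc₂]
      push_cast
      rw [e0, e1, e2, f0, f1, f2]
      linear_combination (K * L * ev w (B 2) *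
        ((1 - a * a') * (b + b') - (a + a') * (1 - b * b'))) * hI
    rw [hpq, hqp, eve, eve, evp, evq] at hprop
    have hcan : Complex.I * (K * L) * ((K : ℂ) * (1 + a * a')) ≠ 0 :=
      mul_ne_zero (mul_ne_zero Complex.I_ne_zero (mul_ne_zero hK' hL')) hn0
    apply mul_left_cancel₀ hcan
    rw [mul_zero]
    linear_combination (1 + a * a') * (1 + b * b') * hprop +
      Complex.I * (K * L) * (1 + a * a') *
        ((ev (v q) (B 0) * ((a + a') * (b - b') - (a - a') * (b + b')) +
        ev (v q) (B 1) * ((a - a') * (1 - b * b') - (1 - a * a') * (b - b')) +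
        Complex.I * ev (v q) (B 2) * ((1 - a * a') * (b + b') - (a + a') * (1 - b * b'))) *
        (ev (v p) (B 0) * (1 - b * b') + ev (v p) (B 1) * (b + b') -
          (Complex.I * ev (v p) (B 2)) * (b - b'))) * hnorm'

end FacetFrame

/-! ### Holonomy around a face and existence of an isotropic coefficient -/

/-- If the parallel transport `R` around the boundary of the convex hull of the planar points
`(g, x)` is consistent, these points are collinear. -/
theorem collinear_of_hull_holonomy {ι : Type*} (F : Finset ι) (g x φ : ι → ℝ) (θ : ι → ι → ℝ)
    (R : ι → ℂ)
    (h_zero : ∀ p ∈ F, ∀ q ∈ F, g p = g q → θ p q = 0)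
    (h_pos : ∀ p ∈ F, ∀ q ∈ F, g p < g q → 0 < θ p q)
    (h_arg : ∀ p ∈ F, ∀ q ∈ F, g p < g q → θ p q < φ q - φ p ∧ φ q - φ p ≤ Real.pi / 2)
    (h_tri : ∀ p ∈ F, ∀ q ∈ F, ∀ r ∈ F, g p ≤ g q → g q ≤ g r → g p < g r →
      ((x r - x p) * (g q - g p) - (x q - x p) * (g r - g p) ≤ 0 ↔ θ p q + θ q r ≤ θ p r) ∧
        (0 ≤ (x r - x p) * (g q - g p) - (x q - x p) * (g r - g p) ↔ θ p r ≤ θ p q + θ q r))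
    (h_edge : ∀ p ∈ F, ∀ q ∈ F, ∀ α β : ℝ, (α ≠ 0 ∨ β ≠ 0) → p ≠ q →
      (∀ r ∈ F, α * x r + β * g r ≤ α * x p + β * g p) →
      α * x q + β * g q = α * x p + β * g p →
      R q = R p * Complex.exp (((4 * θ p q : ℝ) : ℂ) * Complex.I))
    (hR : ∀ p ∈ F, R p ≠ 0) (hne : ∃ p ∈ F, ∃ q ∈ F, g p < g q) :
    ∃ m c : ℝ, ∀ r ∈ F, x r = m * g r + c := by
  obtain ⟨p₀, hp₀, q₀, hq₀, hpq₀⟩ := hne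
  obtain ⟨a₀, ha₀, hamin⟩ := F.exists_min_image g ⟨p₀, hp₀⟩
  obtain ⟨b₀, hb₀, hbmax⟩ := F.exists_max_image g ⟨p₀, hp₀⟩
  obtain ⟨a, ha, hax⟩ := (F.filter (fun r => g r = g a₀)).exists_max_image x ⟨a₀, by simp [ha₀]⟩
  obtain ⟨a', ha', hax'⟩ := (F.filter (fun r => g r = g a₀)).exists_min_image x ⟨a₀, by simp [ha₀]⟩
  obtain ⟨b, hb, hbx⟩ := (F.filter (fun r => g r = g b₀)).exists_max_image x ⟨b₀, by simp [hb₀]⟩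
  obtain ⟨b', hb', hbx'⟩ := (F.filter (fun r => g r = g b₀)).exists_min_image x ⟨b₀, by simp [hb₀]⟩
  have hxa := hax a' ha'
  have hxb := hbx b' hb'
  simp only [mem_filter] at ha ha' hb hb' hax hax' hbx hbx'
  obtain ⟨ha, hga⟩ := ha
  obtain ⟨ha', hga'⟩ := ha'
  obtain ⟨hb, hgb⟩ := hb
  obtain ⟨hb', hgb'⟩ := hb'
  have hlt : g a₀ < g b₀ := by linarith [hamin p₀ hp₀, hbmax q₀ hq₀]
  -- The extreme columns are themselves hull edges, with rotation zero.
  have hRa : R a' = R a := by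
    by_cases h : a = a'
    · rw [h]
    · have := h_edge a ha a' ha' 0 (-1) (by simp) h
        (fun r hr => by linarith [hamin r hr]) (by rw [hga, hga']; ring)
      rwa [h_zero a ha a' ha' (by rw [hga, hga']), mul_zero, Complex.ofReal_zero, zero_mul,
        Complex.exp_zero, mul_one] at this
  have hRb : R b' = R b := by
    by_cases h : b = b'
    · rw [h]
    · have := h_edge b hb b' hb' 0 1 (by simp) h
        (fun r hr => by linarith [hbmax r hr]) (by rw [hgb, hgb']; ring)
      rwa [h_zero b hb b' hb' (by rw [hgb, hgb']), mul_zero, Complex.ofReal_zero, zero_mul,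
        Complex.exp_zero, mul_one] at this
  have hne' : ∀ p q, g p < g q → p ≠ q := by
    rintro p _ hpq rfl
    exact lt_irrefl _ hpq
  obtain ⟨Θ, hΘ, hΘ1, hΘ2, hΘ3⟩ := exists_hull_phase F g x 0 θ R
    (fun p hp q hq hpq => by simpa using h_pos p hp q hq hpq)
    (fun p hp q hq r hr hpq hqr hD => by
      have ht := h_tri p hp q hq r hr hpq.le hqr.le (hpq.trans hqr)
      exact ⟨ht.1.1 (by linarith), fun he => le_antisymm hD (by linarith [ht.2.2 he.ge])⟩)
    (fun p hp q hq m hpq hm he => h_edge p hp q hq 1 (-m) (by simp) (hne' p q hpq)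
      (fun r hr => by linarith [hm r hr]) (by linarith))
    b hb (fun r hr => hgb ▸ hbmax r hr) (fun r hr hgr => hbx r ⟨hr, hgr.trans hgb⟩)
    _ a ha le_rfl
    (exists_hull_start F g x a b hb (by linarith) (fun r hr => hga ▸ hamin r hr)
      (fun r hr hgr => hax r ⟨hr, hgr.trans hga⟩)) (by linarith)
  -- The lower hull is the upper hull of the reflected set, with rotations and phases inverted; the
  -- lower bound now comes from -φ instead of 0.
  obtain ⟨Θ', hΘ', hΘ1', hΘ2', hΘ3'⟩ := exists_hull_phase F g (fun p => -x p) (fun p => -φ p)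
    (fun p q => -θ p q) (fun p => (R p)⁻¹)
    (fun p hp q hq hpq => by linarith [(h_arg p hp q hq hpq).1])
    (fun p hp q hq r hr hpq hqr hD => by
      have ht := h_tri p hp q hq r hr hpq.le hqr.le (hpq.trans hqr)
      have h1 := ht.2.1 (by linarith)
      exact ⟨by linarith, fun he => le_antisymm hD (by linarith [ht.1.2 (by linarith)])⟩)
    (fun p hp q hq m hpq hm he => by
      have := h_edge p hp q hq (-1) (-m) (by simp) (hne' p q hpq)
        (fun r hr => by linarith [hm r hr]) (by linarith)
      simp only [this]
      rw [mul_inv, ← Complex.exp_neg]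
      congr 2
      push_cast; ring)
    b' hb' (fun r hr => hgb' ▸ hbmax r hr)
    (fun r hr hgr => neg_le_neg (hbx' r ⟨hr, hgr.trans hgb'⟩))
    _ a' ha' le_rfl
    (exists_hull_start F g (fun p => -x p) a' b' hb' (by linarith) (fun r hr => hga' ▸ hamin r hr)
      (fun r hr hgr => neg_le_neg (hax' r ⟨hr, hgr.trans hga'⟩))) (by linarith)
  have hφ := (h_arg a' ha' b' hb' (by linarith)).2
  -- Two degenerate triangles compare the top and bottom chords: θ(a, b) ≤ θ(a, b') ≤ θ(a', b').
  -- Hence Θ + Θ' ≤ 0.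
  have t1 := h_tri a ha b' hb' b hb (by linarith) (by linarith) (by linarith)
  have t2 := h_tri a ha a' ha' b' hb' (by linarith) (by linarith) (by linarith)
  rw [h_zero b' hb' b hb (by rw [hgb, hgb']), hga, hgb, hgb'] at t1
  rw [h_zero a ha a' ha' (by rw [hga, hga']), hga, hga', hgb'] at t2
  have hd : 0 < g b₀ - g a₀ := by linarith
  have u1 := t1.2.1 (by nlinarith [mul_nonneg (sub_nonneg.2 hxb) hd.le])
  have u2 := t2.2.1 (by nlinarith [mul_nonneg (sub_nonneg.2 hxa) hd.le])
  have hexp : Complex.exp (((4 * (Θ + Θ') : ℝ) : ℂ) * Complex.I) = 1 := by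
    have hRb0 := hR b hb
    have hRa0 := hR a ha
    rw [hRa, hRb, hΘ] at hΘ'
    have : ((4 * (Θ + Θ') : ℝ) : ℂ) * Complex.I =
      ((4 * Θ : ℝ) : ℂ) * Complex.I + ((4 * Θ' : ℝ) : ℂ) * Complex.I := by push_cast; ring
    rw [this, Complex.exp_add]
    have h0 := Complex.exp_ne_zero (((4 * Θ : ℝ) : ℂ) * Complex.I)
    field_simp at hΘ'
    rw [mul_comm ((4 * Θ' : ℝ) : ℂ)]
    exact hΘ'.symm
  obtain ⟨n, hn⟩ := Complex.exp_eq_one_iff.1 hexp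
  have hn' : 4 * (Θ + Θ') = n * (2 * Real.pi) := by
    have h1 : ((4 * (Θ + Θ') : ℝ) : ℂ) = ((n * (2 * Real.pi) : ℝ) : ℂ) := by
      apply mul_right_cancel₀ Complex.I_ne_zero
      rw [hn]; push_cast; ring
    exact_mod_cast h1
  simp only [Pi.zero_apply, sub_zero] at hΘ1
  have hpi := Real.pi_pos
  -- The lower bounds give Θ + Θ' > -(φ b' - φ a') ≥ -π/2, so a multiple of 2π in (-2π, 0] remains.
  -- Equality then holds in every comparison.
  have hn0 : n = 0 := by
    have h1 : (n : ℝ) ≤ 0 := by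
      by_contra hc
      push Not at hc
      have := mul_pos hc (by linarith : 0 < 2 * Real.pi)
      linarith
    have h2 : (-1 : ℝ) < n := by
      by_contra hc
      push Not at hc
      have := mul_le_mul_of_nonneg_right hc (by linarith : 0 ≤ 2 * Real.pi)
      linarith
    have h1' : n ≤ 0 := by exact_mod_cast h1
    have h2' : -1 < n := by exact_mod_cast h2
    omega
  have hsum : Θ + Θ' = 0 := by
    rw [hn0] at hn'; push_cast at hn'; linarith
  have hx1 : x b = x b' := by
    have := t1.1.2 (by linarith)
    have h2 : (x b - x b') * (g b₀ - g a₀) ≤ 0 := by linarith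
    nlinarith
  have hx2 : x a = x a' := by
    have := t2.1.2 (by linarith)
    have h2 : (x a - x a') * (g b₀ - g a₀) ≤ 0 := by linarith
    nlinarith
  have hup := hΘ3 (by linarith)
  have hlow := hΘ3' (by linarith)
  refine ⟨(x b - x a) / (g b₀ - g a₀), x a - (x b - x a) / (g b₀ - g a₀) * g a₀, fun r hr => ?_⟩
  have h1 := hup r hr
  have h2 := hlow r hr
  rw [hga, hgb] at h1
  rw [hga', hgb', ← hx1, ← hx2] at h2
  field_simp
  linarith

theorem FacetFrame.exists_isotropic {S : Finset R3} {v : R3 → C3} {ν : R3}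
    {B : OrthonormalBasis (Fin 3) ℝ R3} {h : ℝ} (hB : FacetFrame S ν B h)
    (hv : IsCollisionFree S v) : ∃ k p q, OnEdge S ν k p q ∧ dotC3 (v p) (v p) = 0 := by
  by_contra hcon
  push Not at hcon
  have hswap : ∀ k p q, OnEdge S ν k p q → dotC3 (v q) (v q) ≠ 0 := fun k p q hE =>
    hcon k q p ⟨hE.le_one, hE.orth, hE.ne_zero, hE.ne.symm, hE.right_mem, hE.left_mem,
      hE.right_face, hE.left_face, hE.eq.symm, fun r hr hr' => hE.eq ▸ hE.le r hr hr'⟩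
  have hF : ∀ {r}, r ∈ S.filter (fun r => (inner ℝ ν r : ℝ) = 1) ↔ r ∈ S ∧ (inner ℝ ν r : ℝ) = 1 :=
    by simp
  have hort : ∀ i, i ≠ 1 → (inner ℝ (B i) ν : ℝ) = 0 := by
    intro i hi
    have h1 : (inner ℝ (B i) (B 1) : ℝ) = 0 := by
      rw [orthonormal_iff_ite.1 B.orthonormal, if_neg hi]
    rw [hB.normal, inner_smul_right] at h1
    exact (mul_eq_zero.1 h1).resolve_left hB.pos.ne'
  have o00 : (inner ℝ (B 0) (B 0) : ℝ) = 1 := by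
    rw [orthonormal_iff_ite.1 B.orthonormal, if_pos rfl]
  have o22 : (inner ℝ (B 2) (B 2) : ℝ) = 1 := by
    rw [orthonormal_iff_ite.1 B.orthonormal, if_pos rfl]
  have o02 : (inner ℝ (B 0) (B 2) : ℝ) = 0 := B.orthonormal.2 (by decide)
  have o20 : (inner ℝ (B 2) (B 0) : ℝ) = 0 := B.orthonormal.2 (by decide)
  have hmono : ∀ p ∈ S.filter (fun r => (inner ℝ ν r : ℝ) = 1),
      ∀ q ∈ S.filter (fun r => (inner ℝ ν r : ℝ) = 1),
      (inner ℝ (B 2) p : ℝ) ≤ inner ℝ (B 2) q →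
      0 ≤ ((starRingEnd ℂ) (stereo B p) * stereo B q).re ∧
        0 ≤ ((starRingEnd ℂ) (stereo B p) * stereo B q).im := by
    intro p hp q hq hpq
    rw [hF] at hp hq
    refine ⟨hB.conj_mul_re_nonneg hp.1 hq.1 hp.2 hq.2, ?_⟩
    rw [hB.conj_mul_stereo_im hp.2 hq.2]
    exact div_nonneg (mul_nonneg hB.pos.le (by linarith))
      (mul_pos (hB.norm_add_pos hp.2) (hB.norm_add_pos hq.2)).le
  -- As ν · r = 1 on the face, an affine relation there is a linear one, contradicting that the face
  -- spans.
  have hfinal : ∀ α β γ : ℝ, (α ≠ 0 ∨ β ≠ 0) → (∀ r ∈ S.filter (fun r => (inner ℝ ν r : ℝ) = 1),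
      α * inner ℝ (B 0) r + β * inner ℝ (B 2) r = γ) → False := by
    intro α β γ hαβ hr
    have h0 := hB.spans (α • B 0 + β • B 2 - γ • ν) (by
      intro p hp hp'
      have := hr p (hF.2 ⟨hp, hp'⟩)
      rw [real_inner_comm, inner_sub_left, inner_add_left, inner_smul_left, inner_smul_left,
        inner_smul_left, hp']
      simp only [conj_trivial]
      linarith)
    have c0 := congrArg (fun y => (inner ℝ (B 0) y : ℝ)) h0
    have c2 := congrArg (fun y => (inner ℝ (B 2) y : ℝ)) h0
    simp only [inner_sub_right, inner_add_right, inner_smul_right, o00, o02, o20, o22, hort 0 (by decide),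
      hort 2 (by decide), inner_zero_right] at c0 c2
    simp at c0 c2
    rcases hαβ with hh | hh
    · exact hh c0
    · exact hh c2
  have hcol := collinear_of_hull_holonomy (S.filter (fun r => (inner ℝ ν r : ℝ) = 1))
    (fun r => inner ℝ (B 2) r) (fun r => inner ℝ (B 0) r) (fun r => Complex.arg (stereo B r))
    (fun p q => spinAngle (stereo B p) (stereo B q)) 
    -- The value 1 only keeps the phase nonzero at isotropic points; by assumption none of these
    -- lies on an edge.
    (fun p => if dotC3 (v p) (v p) = 0 then 1 else polarization B v p) ?_ ?_ ?_ ?_ ?_ ?_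
  · by_cases hg : ∃ p ∈ S.filter (fun r => (inner ℝ ν r : ℝ) = 1),
        ∃ q ∈ S.filter (fun r => (inner ℝ ν r : ℝ) = 1),
        (inner ℝ (B 2) p : ℝ) < inner ℝ (B 2) q
    · obtain ⟨m, c, hmc⟩ := hcol hg
      exact hfinal 1 (-m) c (by simp) (fun r hr => by linarith [hmc r hr])
    · push Not at hg
      rcases (S.filter (fun r => (inner ℝ ν r : ℝ) = 1)).eq_empty_or_nonempty with he | ⟨p, hp⟩
      · exact hfinal 1 0 0 (by simp) (by simp [he])
      · exact hfinal 0 1 (inner ℝ (B 2) p) (by simp)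
          (fun r hr => by rw [zero_mul, one_mul, zero_add]; exact le_antisymm (hg p hp r hr) (hg r hr p hp))
  · intro p hp q hq hpq
    have h1 := hmono p hp q hq hpq.le
    refine spinAngle_eq_zero h1.1 ?_
    rw [hB.conj_mul_stereo_im (hF.1 hp).2 (hF.1 hq).2, ← hpq]; simp
  · intro p hp q hq hpq
    exact (spinAngle_mem (hmono p hp q hq hpq.le).1
      (hB.conj_mul_im_pos (hF.1 hp).2 (hF.1 hq).2 hpq)).1
  · intro p hp q hq hpq
    refine arg_sub_arg_mem ?_ ?_ (hmono p hp q hq hpq.le).1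
      (hB.conj_mul_im_pos (hF.1 hp).2 (hF.1 hq).2 hpq)
    · rw [hB.stereo_re (hF.1 hp).2]; exact div_pos hB.pos (hB.norm_add_pos (hF.1 hp).2)
    · rw [hB.stereo_re (hF.1 hq).2]; exact div_pos hB.pos (hB.norm_add_pos (hF.1 hq).2)
  · intro p hp q hq r hr hpq hqr _
    obtain ⟨c, hc, he⟩ := hB.bargmann_sign (hF.1 hp).2 (hF.1 hq).2 (hF.1 hr).2
    have ht := spinAngle_triangle (hmono p hp q hq hpq).1 (hmono p hp q hq hpq).2
      (hmono q hq r hr hqr).1 (hmono q hq r hr hqr).2 (hmono p hp r hr (hpq.trans hqr)).1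
      (hmono p hp r hr (hpq.trans hqr)).2
    rw [he, ← ht.1, ← ht.2]
    exact ⟨⟨fun hh => by by_contra h'; exact absurd (mul_pos hc (not_le.1 h')) (not_lt.2 hh),
      fun hh => mul_nonpos_of_nonneg_of_nonpos hc.le hh⟩, mul_nonneg_iff_of_pos_left hc⟩
  · intro p hp q hq α β hαβ hpq hle heq
    have hin : ∀ r, (inner ℝ (α • B 0 + β • B 2) r : ℝ) =
        α * inner ℝ (B 0) r + β * inner ℝ (B 2) r := by
      intro r
      rw [inner_add_left, inner_smul_left, inner_smul_left]; simp
    have hE : OnEdge S ν (α • B 0 + β • B 2) p q := by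
      refine ⟨hB.le_one, ?_, ?_, hpq, (hF.1 hp).1, (hF.1 hq).1, (hF.1 hp).2, (hF.1 hq).2, ?_, ?_⟩
      · rw [real_inner_comm, hin, hort 0 (by decide), hort 2 (by decide)]; simp
      · intro h0
        have h1 := congrArg (fun y => (inner ℝ (B 0) y : ℝ)) h0
        have h2 := congrArg (fun y => (inner ℝ (B 2) y : ℝ)) h0
        simp only [inner_add_right, inner_smul_right, o00, o02, o20, o22, inner_zero_right] at h1 h2
        simp at h1 h2
        rcases hαβ with hh | hh
        · exact hh h1
        · exact hh h2
      · rw [hin, hin, heq]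
      · intro r hr hr'
        rw [hin, hin]
        exact hle r (hF.2 ⟨hr, hr'⟩)
    have h1 := hcon _ _ _ hE
    have h2 := hswap _ _ _ hE
    simp only [if_neg h1, if_neg h2]
    exact hB.polarization_transport hv hE h1 h2
  · intro p hp
    split_ifs with h0
    · exact one_ne_zero
    · have := hB.null_ne_zero hv (hF.1 hp).1 (hF.1 hp).2 h0
      exact div_ne_zero this.2 this.1

/-! ### The polar body and the choice of a face -/

/-- The polar body of a finite set of vectors. -/
def polarBody (S : Finset R3) : Set R3 := {ν | ∀ p ∈ S, (inner ℝ ν p : ℝ) ≤ 1}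

theorem convex_polarBody (S : Finset R3) : Convex ℝ (polarBody S) := by
  intro x hx y hy a b ha hb hab p hp
  rw [inner_add_left, inner_smul_left, inner_smul_left]
  simp only [conj_trivial]
  nlinarith [mul_le_mul_of_nonneg_left (hx p hp) ha, mul_le_mul_of_nonneg_left (hy p hp) hb]

theorem abs_inner_le_of_mem_polarBody {S : Finset R3} (hneg : ∀ n ∈ S, -n ∈ S) {ν : R3}
    (hν : ν ∈ polarBody S) {p : R3} (hp : p ∈ S) : |(inner ℝ ν p : ℝ)| ≤ 1 := by
  rw [abs_le]
  have := hν _ (hneg p hp)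
  rw [inner_neg_right] at this
  exact ⟨by linarith, hν p hp⟩

theorem isCompact_polarBody {S : Finset R3} (hneg : ∀ n ∈ S, -n ∈ S)
    (hspan : ∀ x : R3, (∀ n ∈ S, (inner ℝ n x : ℝ) = 0) → x = 0) : IsCompact (polarBody S) := by
  refine Metric.isCompact_of_isClosed_isBounded ?_ ?_
  · have : polarBody S = ⋂ p ∈ S, {ν : R3 | (inner ℝ ν p : ℝ) ≤ 1} := by
      ext; simp [polarBody]
    rw [this]
    exact isClosed_biInter fun p _ => isClosed_le (by fun_prop) continuous_const
  · let L : R3 →ₗ[ℝ] (S → ℝ) := LinearMap.pi fun p => (innerₛₗ ℝ (p : R3))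
    have hL : LinearMap.ker L = ⊥ := by
      rw [LinearMap.ker_eq_bot']
      intro x hx
      exact hspan x fun n hn => congrFun hx ⟨n, hn⟩
    obtain ⟨K, hK, hLK⟩ := LinearMap.exists_antilipschitzWith L hL
    refine (Metric.isBounded_closedBall (x := (0 : R3)) (r := K)).subset fun ν hν => ?_
    rw [mem_closedBall_zero_iff]
    have h1 := hLK.le_mul_dist ν 0
    rw [map_zero, dist_zero_right, dist_zero_right] at h1
    refine h1.trans (mul_le_of_le_one_right K.coe_nonneg ?_)
    rw [pi_norm_le_iff_of_nonneg zero_le_one]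
    rintro ⟨p, hp⟩
    change ‖(inner ℝ p ν : ℝ)‖ ≤ 1
    rw [real_inner_comm]
    exact abs_inner_le_of_mem_polarBody hneg hν hp

/-- Active constraints do not see y, and the finitely many strict ones survive a small displacement.
-/
theorem exists_add_mem_polarBody {S : Finset R3} {ν y : R3} (hν : ν ∈ polarBody S)
    (hy : ∀ p ∈ S, (inner ℝ ν p : ℝ) = 1 → (inner ℝ p y : ℝ) = 0) :
    ∃ ε : ℝ, 0 < ε ∧ ν + ε • y ∈ polarBody S ∧ ν - ε • y ∈ polarBody S := by
  have h : ∀ᶠ ε : ℝ in nhdsWithin 0 (Set.Ioi 0),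
      ∀ p ∈ S, (inner ℝ ν p : ℝ) + ε * |(inner ℝ y p : ℝ)| ≤ 1 := by
    rw [Finset.eventually_all]
    intro p hp
    rcases (hν p hp).lt_or_eq with h | h
    · have hc : Continuous fun ε : ℝ => (inner ℝ ν p : ℝ) + ε * |(inner ℝ y p : ℝ)| := by fun_prop
      have := hc.continuousAt (x := 0) |>.eventually_lt continuousAt_const
        (by simpa using h : _ < (1 : ℝ))
      exact (this.filter_mono nhdsWithin_le_nhds).mono fun _ h => h.le
    · have h0 := hy p hp h
      rw [real_inner_comm] at h0
      exact Filter.Eventually.of_forall fun ε => by rw [h0, h]; simp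
  obtain ⟨ε, hε, hpos⟩ := (h.and self_mem_nhdsWithin).exists
  have hpos : 0 < ε := hpos
  refine ⟨ε, hpos, fun p hp => ?_, fun p hp => ?_⟩
  · have h1 := hε p hp
    rw [inner_add_left, inner_smul_left, conj_trivial]
    nlinarith [le_abs_self (inner ℝ y p : ℝ)]
  · have h1 := hε p hp
    rw [inner_sub_left, inner_smul_left, conj_trivial]
    nlinarith [neg_abs_le (inner ℝ y p : ℝ)]

theorem zero_mem_polarBody (S : Finset R3) : (0 : R3) ∈ polarBody S := fun p _ => by simp

/-- Otherwise Krein–Milman would confine the polar body to the line of ν', although it contains a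
short vector orthogonal to ν'. -/
theorem exists_extreme_not_smul {S : Finset R3} (hneg : ∀ n ∈ S, -n ∈ S)
    (hspan : ∀ x : R3, (∀ n ∈ S, (inner ℝ n x : ℝ) = 0) → x = 0) (ν' : R3) :
    ∃ ν ∈ (polarBody S).extremePoints ℝ, ∀ a : ℝ, ν ≠ a • ν' := by
  by_contra hcon
  push Not at hcon
  obtain ⟨e, he, he1, -⟩ := exists_orthogonal ν' 0
  obtain ⟨ε, hε, hmem, -⟩ := exists_add_mem_polarBody (y := e) (zero_mem_polarBody S)
    (by intro p _ h; simp at h)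
  have hK := closure_convexHull_extremePoints (isCompact_polarBody hneg hspan) (convex_polarBody S)
  have hsub : polarBody S ⊆ (Submodule.span ℝ {ν'} : Submodule ℝ R3) := by
    rw [← hK]
    refine closure_minimal (convexHull_min ?_ (Submodule.convex _)) (Submodule.closed_of_finiteDimensional _)
    intro ν hν
    obtain ⟨a, rfl⟩ := hcon ν hν
    exact Submodule.smul_mem _ _ (Submodule.mem_span_singleton_self _)
  obtain ⟨a, ha⟩ := Submodule.mem_span_singleton.1 (hsub hmem)
  have h1 : (inner ℝ (a • ν') e : ℝ) = 0 := by rw [inner_smul_left, he1, mul_zero]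
  rw [ha, zero_add, inner_smul_left, conj_trivial, mul_eq_zero] at h1
  rcases h1 with h1 | h1
  · exact hε.ne' h1
  · exact he (inner_self_eq_zero.1 h1)

theorem spans_face_of_extreme {S : Finset R3} {ν : R3}
    (hν : ν ∈ (polarBody S).extremePoints ℝ) (y : R3)
    (hy : ∀ p ∈ S, (inner ℝ ν p : ℝ) = 1 → (inner ℝ p y : ℝ) = 0) : y = 0 := by
  obtain ⟨ε, hε, h1, h2⟩ := exists_add_mem_polarBody hν.1 hy
  have := hν.2 h1 h2 ⟨1 / 2, 1 / 2, by norm_num, by norm_num, by norm_num, by module⟩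
  have h3 : ε • y = 0 := by simpa using this
  exact (smul_eq_zero.1 h3).resolve_left hε.ne'

theorem exists_frame {ν ν' : R3} (hν : ν ≠ 0) : ∃ B : OrthonormalBasis (Fin 3) ℝ R3,
    B 1 = ‖ν‖⁻¹ • ν ∧ (inner ℝ (B 0) ν' : ℝ) = 0 := by
  obtain ⟨e, he, he1, he2⟩ := exists_orthogonal ν ν'
  have hν0 := norm_ne_zero_iff.2 hν
  have he0 := norm_ne_zero_iff.2 he
  have hv : Orthonormal ℝ (({0, 1} : Set (Fin 3)).domRestrict ![‖e‖⁻¹ • e, ‖ν‖⁻¹ • ν, 0]) := by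
    have h01 : (inner ℝ (‖ν‖⁻¹ • ν) (‖e‖⁻¹ • e) : ℝ) = 0 := by
      rw [inner_smul_left, inner_smul_right, he1]; simp
    constructor
    · rintro ⟨i, rfl | rfl⟩
      · change ‖‖e‖⁻¹ • e‖ = 1
        simp [norm_smul, he0]
      · change ‖‖ν‖⁻¹ • ν‖ = 1
        simp [norm_smul, hν0]
    · rintro ⟨i, rfl | rfl⟩ ⟨j, rfl | rfl⟩ hij
      · exact absurd rfl hij
      · exact (real_inner_comm _ _).trans h01
      · exact h01
      · exact absurd rfl hij
  obtain ⟨B, hB⟩ := hv.exists_orthonormalBasis_extension_of_card_eq (by simp)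
  refine ⟨B, hB 1 (by simp), ?_⟩
  rw [hB 0 (by simp)]
  simp only [Matrix.cons_val_zero]
  rw [inner_smul_left, real_inner_comm, he2, mul_zero]

theorem one_sub_sq_add_mul_nonneg {s t y : ℝ} (hs : |s| ≤ 1) (ht : |t| ≤ 1) {w : ℝ} (hw : 0 ≤ w)
    (hwy : 1 ≤ w + y ^ 2) : 0 ≤ w + (s - y) * (t - y) := by
  rw [abs_le] at hs ht
  rcases le_or_gt y 1 with h1 | h1
  · rcases le_or_gt (-1) y with h2 | h2
    -- For |y| ≤ 1, twice 1 - y² + (s - y)(t - y) equals (1 - s)(1 - t)(1 + y) + (1 + s)(1 + t)(1 -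
    -- y).
    · nlinarith [mul_nonneg (mul_nonneg (sub_nonneg.2 hs.2) (sub_nonneg.2 ht.2))
        (by linarith : 0 ≤ 1 + y), mul_nonneg (mul_nonneg (by linarith : 0 ≤ 1 + s)
        (by linarith : 0 ≤ 1 + t)) (by linarith : 0 ≤ 1 - y)]
    · nlinarith [mul_nonneg (by linarith : 0 ≤ s - y) (by linarith : 0 ≤ t - y)]
  · nlinarith [mul_nonneg (by linarith : 0 ≤ y - s) (by linarith : 0 ≤ y - t)]

/-- Let ν' be a longest vector of the polar body and ν an extreme point off its line; take the axis
orthogonal to both. On the face of ν, the bounds |ν' · p| ≤ 1 confine the remaining coordinate to an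
interval, and |ν| ≤ |ν'| makes that interval subtend at most a right angle. -/
theorem exists_facetFrame {S : Finset R3} (hneg : ∀ n ∈ S, -n ∈ S)
    (hspan : ∀ x : R3, (∀ n ∈ S, (inner ℝ n x : ℝ) = 0) → x = 0) :
    ∃ ν B h, FacetFrame S ν B h := by
  obtain ⟨ν', hν', hmax⟩ := (isCompact_polarBody hneg hspan).exists_isMaxOn
    ⟨0, zero_mem_polarBody S⟩ continuous_norm.continuousOn
  obtain ⟨ν, hν, hne⟩ := exists_extreme_not_smul hneg hspan ν'
  have hν0 : ν ≠ 0 := by simpa using hne 0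
  have hle : ‖ν‖ ≤ ‖ν'‖ := hmax hν.1
  have hpos := norm_pos_iff.2 hν0
  obtain ⟨B, hB1, hB0⟩ := exists_frame (ν' := ν') hν0
  have hnu : ν = ‖ν‖ • B 1 := by rw [hB1, smul_smul, mul_inv_cancel₀ hpos.ne', one_smul]
  set Y := (inner ℝ (B 1) ν' : ℝ) with hY
  set Z := (inner ℝ (B 2) ν' : ℝ) with hZ
  have hsq : ‖ν'‖ ^ 2 = Y ^ 2 + Z ^ 2 := by
    rw [← real_inner_self_eq_norm_sq, inner_eq_sum_basis B, hB0]; ring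
  have hZ0 : Z ≠ 0 := by
    intro hz
    have h1 : ν' = Y • B 1 := by
      conv_lhs => rw [← B.sum_repr' ν', Fin.sum_univ_three, hB0, ← hZ, hz]
      simp [hY]
    have hY0 : Y ≠ 0 := by
      rintro h0
      rw [h0, hz] at hsq
      have : 0 < ‖ν'‖ := hpos.trans_le hle
      nlinarith
    apply hne (‖ν‖ * Y⁻¹)
    rw [h1, smul_smul, mul_assoc, inv_mul_cancel₀ hY0, mul_one]
    exact hnu
  refine ⟨ν, B, ‖ν‖⁻¹, inv_pos.2 hpos, hν.1, hB1, ?_, fun y hy => spans_face_of_extreme hν y hy⟩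
  intro p hp q hq hp1 hq1
  have hT : ∀ r, (inner ℝ ν r : ℝ) = 1 →
      (inner ℝ ν' r : ℝ) = Y * ‖ν‖⁻¹ + Z * inner ℝ (B 2) r := by
    intro r hr
    have : (inner ℝ (B 1) r : ℝ) = ‖ν‖⁻¹ := by rw [hB1, inner_smul_left, hr]; simp
    rw [inner_eq_sum_basis B, hB0, this]; ring
  have hp2 := abs_inner_le_of_mem_polarBody hneg hν' hp
  have hq2 := abs_inner_le_of_mem_polarBody hneg hν' hq
  have hwy : 1 ≤ (Z * ‖ν‖⁻¹) ^ 2 + (Y * ‖ν‖⁻¹) ^ 2 := by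
    have : (Z * ‖ν‖⁻¹) ^ 2 + (Y * ‖ν‖⁻¹) ^ 2 = ‖ν'‖ ^ 2 / ‖ν‖ ^ 2 := by
      rw [hsq]; field_simp; ring
    rw [this, one_le_div (by positivity)]
    gcongr
  have key := one_sub_sq_add_mul_nonneg hp2 hq2 (sq_nonneg _) hwy
  rw [hT p hp1, hT q hq1] at key
  have hZ2 : 0 < Z ^ 2 := by positivity
  refine (mul_nonneg_iff_of_pos_left hZ2).1 ?_
  calc _ ≤ _ := key
    _ = _ := by ring

theorem IsCollisionFree.exists_defect_eq_zero {S : Finset R3} {v : R3 → C3}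
    (hv : IsCollisionFree S v) : ∃ μ : ℝ, ∀ n ∈ S, defect μ n (v n) = 0 := by
  obtain ⟨ν, B, h, hB⟩ := exists_facetFrame hv.neg_mem hv.spans
  obtain ⟨k, p, q, hE, hiso⟩ := hB.exists_isotropic hv
  exact hE.exists_defect_eq_zero_of_isotropic hv hiso

/-! ### Uniqueness for the mode equations and the Beltrami interaction -/

theorem eq_zero_of_norm_deriv_le {E : Type*} [NormedAddCommGroup E] [NormedSpace ℝ E] {I : Set ℝ}
    (hI : I.OrdConnected) {f f' : ℝ → E} (hf : ∀ t ∈ I, HasDerivAt f (f' t) t) {t₀ : ℝ}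
    (ht₀ : t₀ ∈ I) (h0 : f t₀ = 0)
    (hK : ∀ J ⊆ I, IsCompact J → ∃ K : ℝ, ∀ s ∈ J, ‖f' s‖ ≤ K * ‖f s‖) :
    ∀ t ∈ I, f t = 0 := by
  intro t ht
  rcases le_total t₀ t with h | h
  · have hsub := hI.out ht₀ ht
    obtain ⟨K, hK⟩ := hK _ hsub isCompact_Icc
    exact eq_zero_of_abs_deriv_le_mul_abs_self_of_eq_zero_right
      (fun s hs => (hf s (hsub hs)).continuousAt.continuousWithinAt)
      (fun s hs => (hf s (hsub (Set.Ico_subset_Icc_self hs))).hasDerivWithinAt) h0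
      (fun s hs => hK s (Set.Ico_subset_Icc_self hs)) t ⟨h, le_rfl⟩
  · have hsub := hI.out ht ht₀
    obtain ⟨K, hK⟩ := hK _ hsub isCompact_Icc
    have hm : ∀ s ∈ Set.Icc (-t₀) (-t), -s ∈ Set.Icc t t₀ := fun s hs =>
      ⟨by linarith [hs.2], by linarith [hs.1]⟩
    have hd : ∀ s ∈ Set.Icc (-t₀) (-t), HasDerivAt (fun r => f (-r)) (-f' (-s)) s := by
      intro s hs
      have := (hf (-s) (hsub (hm s hs))).scomp s (hasDerivAt_neg s)
      simpa [Function.comp_def] using this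
    have := eq_zero_of_abs_deriv_le_mul_abs_self_of_eq_zero_right (f := fun r => f (-r))
      (fun s hs => (hd s hs).continuousAt.continuousWithinAt)
      (fun s hs => (hd s (Set.Ico_subset_Icc_self hs)).hasDerivWithinAt) (by simpa using h0)
      (fun s hs => by
        rw [norm_neg]; exact hK (-s) (hm s (Set.Ico_subset_Icc_self hs))) (-t)
      ⟨by linarith, le_rfl⟩
    simpa using this

theorem interaction_congr {S : Finset R3} {v w : R3 → C3} (h : ∀ n ∈ S, v n = w n) (n : R3) :
    interaction S v n = interaction S w n := by
  refine Finset.sum_congr rfl fun q hq => ?_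
  simp only [mem_filter, mem_product] at hq
  rw [h _ hq.1.1, h _ hq.1.2]

theorem interaction_eq_zero_of_forall {S : Finset R3} {v : R3 → C3} {n : R3}
    (h : ∀ p ∈ S, ∀ q ∈ S, p + q = n → v p = 0 ∨ v q = 0) : interaction S v n = 0 := by
  refine Finset.sum_eq_zero fun q hq => ?_
  simp only [mem_filter, mem_product] at hq
  rcases h _ hq.1.1 _ hq.1.2 hq.2 with h0 | h0 <;> simp [h0, dotC3]

theorem interaction_subset {S S₀ : Finset R3} {v : R3 → C3} (hsub : S₀ ⊆ S)
    (h : ∀ n ∈ S, n ∉ S₀ → v n = 0) (n : R3) : interaction S₀ v n = interaction S v n := by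
  refine Finset.sum_subset ?_ ?_
  · intro q
    simp only [mem_filter, mem_product]
    exact fun hq => ⟨⟨hsub hq.1.1, hsub hq.1.2⟩, hq.2⟩
  · intro q hq hq'
    simp only [mem_filter, mem_product] at hq hq'
    by_cases h1 : q.1 ∈ S₀
    · have h2 : q.2 ∉ S₀ := fun h2 => hq' ⟨⟨h1, h2⟩, hq.2⟩
      simp [h _ hq.1.2 h2, dotC3]
    · simp [h _ hq.1.1 h1, dotC3]

theorem helmholtz_sub (n : R3) (v w : C3) : helmholtz n v - helmholtz n w = helmholtz n (v - w) :=
  (map_sub _ _ _).symm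

theorem norm_helmholtz_le (n : R3) (v : C3) : ‖helmholtz n v‖ ≤ ‖v‖ :=
  Submodule.norm_starProjection_apply_le _ _

theorem helmholtz_eq_zero_iff {n : R3} {v : C3} :
    helmholtz n v = 0 ↔ ∃ l : ℂ, v = l • toC3 n := by
  rw [helmholtz, Submodule.starProjection_apply_eq_zero_iff, Submodule.orthogonal_orthogonal,
    Submodule.mem_span_singleton]
  simp only [eq_comm]

theorem contDiff_interaction (S : Finset R3) (n : R3) :
    ContDiff ℂ 1 fun x : S → C3 => interaction S (fun m => if h : m ∈ S then x ⟨m, h⟩ else 0) n := by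
  have h1 : ∀ m, ContDiff ℂ 1 fun x : S → C3 => if h : m ∈ S then x ⟨m, h⟩ else (0 : C3) := by
    intro m
    by_cases h : m ∈ S
    · simp only [h, dif_pos]; exact contDiff_apply ℂ C3 (⟨m, h⟩ : S)
    · simp only [h, dif_neg, not_false_eq_true]; exact contDiff_const
  have h2 : ∀ m (y : R3), ContDiff ℂ 1
      fun x : S → C3 => dotC3 (if h : m ∈ S then x ⟨m, h⟩ else (0 : C3)) (toC3 y) := by
    intro m y
    refine ContDiff.sum fun i _ => ContDiff.mul ?_ contDiff_const
    exact (EuclideanSpace.proj (𝕜 := ℂ) i).contDiff.comp (h1 m)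
  exact ContDiff.sum fun q _ => ((h2 _ _).smul (h1 _)).add ((h2 _ _).smul (h1 _))

theorem exists_norm_interaction_sub_le (S : Finset R3) (n : R3) (R : ℝ) :
    ∃ K : ℝ, 0 ≤ K ∧ ∀ v w : R3 → C3, ‖fun m : S => v m‖ ≤ R → ‖fun m : S => w m‖ ≤ R →
      ‖interaction S v n - interaction S w n‖ ≤ K * ‖fun m : S => v m - w m‖ := by
  obtain ⟨K, hK⟩ := ((contDiff_interaction S n).restrict_scalars ℝ).contDiffOn.exists_lipschitzOnWith one_ne_zero
    (convex_closedBall (0 : S → C3) R) (isCompact_closedBall _ _)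
  refine ⟨K, K.coe_nonneg, fun v w hv hw => ?_⟩
  have h := hK.norm_sub_le (mem_closedBall_zero_iff.2 hv) (mem_closedBall_zero_iff.2 hw)
  have hc : ∀ v : R3 → C3, interaction S (fun m => if h : m ∈ S then v m else 0) n =
      interaction S v n := fun v => interaction_congr (fun m hm => by simp [hm]) n
  rw [hc, hc] at h
  exact h

/-- A Grönwall argument with a local Lipschitz bound for the interaction. Only the modes in `A` need
to satisfy the equations; this permits comparison with a truncated family that is no solution on the
other modes. -/
theorem modes_unique {I : Set ℝ} (hI_open : IsOpen I) (hI : I.OrdConnected) {S : Finset R3}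
    (A : Set R3) {c w : R3 → ℝ → C3}
    (hc : ∀ n ∈ S, ContinuousOn (c n) I) (hw : ∀ n ∈ S, ContinuousOn (w n) I)
    (hc' : ∀ n ∈ S, n ∈ A → ∀ t ∈ I, HasDerivAt (c n)
      (-((Complex.I / 2) • helmholtz n (interaction S (fun m => c m t) n))) t)
    (hw' : ∀ n ∈ S, n ∈ A → ∀ t ∈ I, HasDerivAt (w n)
      (-((Complex.I / 2) • helmholtz n (interaction S (fun m => w m t) n))) t)
    (hcw : ∀ n ∈ S, n ∉ A → ∀ t ∈ I, c n t = w n t) {t₀ : ℝ} (ht₀ : t₀ ∈ I)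
    (h0 : ∀ n ∈ S, n ∈ A → c n t₀ = w n t₀) :
    ∀ n ∈ S, ∀ t ∈ I, c n t = w n t := by
  classical
  have key := eq_zero_of_norm_deriv_le hI (f := fun t (n : S) => c n t - w n t)
    (f' := fun t (n : S) => if (n : R3) ∈ A then
      -((Complex.I / 2) • helmholtz n (interaction S (fun m => c m t) n)) -
      -((Complex.I / 2) • helmholtz n (interaction S (fun m => w m t) n)) else 0) ?_ ht₀ ?_ ?_
  · intro n hn t ht
    exact sub_eq_zero.1 (congrFun (key t ht) ⟨n, hn⟩)
  · intro t ht
    rw [hasDerivAt_pi]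
    rintro ⟨n, hn⟩
    by_cases hA : n ∈ A
    · simp only [hA, if_true]
      exact (hc' n hn hA t ht).sub (hw' n hn hA t ht)
    · simp only [hA, if_false]
      refine (hasDerivAt_const t (0 : C3)).congr_of_eventuallyEq ?_
      filter_upwards [hI_open.mem_nhds ht] with s hs
      exact sub_eq_zero.2 (hcw n hn hA s hs)
  · funext ⟨n, hn⟩
    by_cases hA : n ∈ A
    · exact sub_eq_zero.2 (h0 n hn hA)
    · exact sub_eq_zero.2 (hcw n hn hA t₀ ht₀)
  · intro J hJ hJc
    have hcJ : ContinuousOn (fun t (n : S) => c n t) J :=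
      continuousOn_pi.2 fun n => (hc n n.2).mono hJ
    have hwJ : ContinuousOn (fun t (n : S) => w n t) J :=
      continuousOn_pi.2 fun n => (hw n n.2).mono hJ
    obtain ⟨R₁, hR₁⟩ := hJc.exists_bound_of_continuousOn hcJ
    obtain ⟨R₂, hR₂⟩ := hJc.exists_bound_of_continuousOn hwJ
    choose K hK0 hK using fun n : S => exists_norm_interaction_sub_le S n (max R₁ R₂)
    refine ⟨∑ n, K n, fun s hs => ?_⟩
    have hKs : 0 ≤ ∑ n, K n := Finset.sum_nonneg fun n _ => hK0 n
    rw [pi_norm_le_iff_of_nonneg (mul_nonneg hKs (norm_nonneg _))]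
    intro n
    split_ifs with hA
    · have h1 := hK n (fun m => c m s) (fun m => w m s) ((hR₁ s hs).trans (le_max_left _ _))
        ((hR₂ s hs).trans (le_max_right _ _))
      have h2 : K n ≤ ∑ n, K n := Finset.single_le_sum (fun n _ => hK0 n) (mem_univ n)
      have h3 : -((Complex.I / 2) • helmholtz n (interaction S (fun m => c m s) n)) -
          -((Complex.I / 2) • helmholtz n (interaction S (fun m => w m s) n)) =
          -((Complex.I / 2) • helmholtz n (interaction S (fun m => c m s) n -
            interaction S (fun m => w m s) n)) := by
        rw [← helmholtz_sub, smul_sub]; abel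
      rw [h3, norm_neg, norm_smul]
      have h4 : ‖Complex.I / 2‖ ≤ 1 := by norm_num
      calc _ ≤ 1 * ‖helmholtz n (interaction S (fun m => c m s) n -
            interaction S (fun m => w m s) n)‖ := by gcongr
        _ ≤ _ := by rw [one_mul]; exact norm_helmholtz_le _ _
        _ ≤ _ := h1
        _ ≤ _ := by gcongr
    · rw [norm_zero]; exact mul_nonneg hKs (norm_nonneg _)

/-- For a Beltrami field ω × u = 0, so the nonlinearity is the gradient of |u|²/2. The multiplier is
accordingly the convolution of v · v. -/
theorem interaction_of_defect_eq_zero {S : Finset R3} {v : R3 → C3} {μ : ℝ}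
    (h : ∀ n ∈ S, defect μ n (v n) = 0) (n : R3) :
    ∃ l : ℂ, interaction S v n = l • toC3 n := by
  classical
  refine ⟨∑ q ∈ (S ×ˢ S).filter (fun q => q.1 + q.2 = n), dotC3 (v q.1) (v q.2), ?_⟩
  rw [interaction, Finset.sum_smul]
  refine Finset.sum_congr rfl fun q hq => ?_
  simp only [mem_filter, mem_product] at hq
  obtain ⟨⟨hp, hq⟩, rfl⟩ := hq
  have hc : ∀ p ∈ S, ∀ i, Complex.I * crossC3 p (v p) i = μ * v p i := by
    intro p hp i
    have := congrArg (fun w : C3 => w i) (h p hp)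
    simpa [defect, sub_eq_zero] using this
  have p0 := hc _ hp 0
  have p1 := hc _ hp 1
  have p2 := hc _ hp 2
  have q0 := hc _ hq 0
  have q1 := hc _ hq 1
  have q2 := hc _ hq 2
  rw [crossC3_zero] at p0 q0
  rw [crossC3_one] at p1 q1
  rw [crossC3_two] at p2 q2
  have hI := Complex.I_sq
  obtain ⟨p, q⟩ := q
  simp only at *
  apply ext_C3 <;> simp only [dotC3, toC3, Fin.sum_univ_three, PiLp.add_apply, PiLp.smul_apply,
    smul_eq_mul, Complex.ofReal_add]
  · linear_combination (-Complex.I) * (p1 * v q 2 - p2 * v q 1 + q1 * v p 2 - q2 * v p 1) +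
      ((p 2 * v p 0 - p 0 * v p 2) * v q 2 - (p 0 * v p 1 - p 1 * v p 0) * v q 1 + (q 2 * v q 0 - q 0 * v q 2) * v p 2 - (q 0 * v q 1 - q 1 * v q 0) * v p 1) * hI
  · linear_combination (-Complex.I) * (p2 * v q 0 - p0 * v q 2 + q2 * v p 0 - q0 * v p 2) +
      ((p 0 * v p 1 - p 1 * v p 0) * v q 0 - (p 1 * v p 2 - p 2 * v p 1) * v q 2 + (q 0 * v q 1 - q 1 * v q 0) * v p 0 - (q 1 * v q 2 - q 2 * v q 1) * v p 2) * hI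
  · linear_combination (-Complex.I) * (p0 * v q 1 - p1 * v q 0 + q0 * v p 1 - q1 * v p 0) +
      ((p 1 * v p 2 - p 2 * v p 1) * v q 1 - (p 2 * v p 0 - p 0 * v p 2) * v q 0 + (q 1 * v q 2 - q 2 * v q 1) * v p 1 - (q 2 * v q 0 - q 0 * v q 2) * v p 0) * hI

/-! ### Maximal support and constancy in time -/

theorem spans_of_not_containedInPlane {A : Set R3} (hA : ¬ IsContainedInPlane A) (x : R3)
    (hx : ∀ n ∈ A, (inner ℝ n x : ℝ) = 0) : x = 0 := by
  by_contra h0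
  refine hA ⟨((Submodule.span ℝ {x})ᗮ).toAffineSubspace, ?_, fun n hn => ?_⟩
  · rw [Submodule.toAffineSubspace_direction]
    have : Fact (Module.finrank ℝ R3 = 2 + 1) := ⟨by simp⟩
    exact Submodule.finrank_orthogonal_span_singleton h0
  · change n ∈ (Submodule.span ℝ {x})ᗮ
    rw [Submodule.mem_orthogonal_singleton_iff_inner_left]
    exact hx n hn

theorem nonempty_of_not_containedInPlane {A : Set R3} (hA : ¬ IsContainedInPlane A) :
    A.Nonempty := by
  by_contra h
  rw [Set.not_nonempty_iff_eq_empty] at h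
  have := spans_of_not_containedInPlane hA (EuclideanSpace.single 0 1) (by simp [h])
  simp at this

open Classical in
/-- A time at which the largest possible number of modes is active. -/
theorem exists_max_support {I : Set ℝ} (hI : I.Nonempty) (S : Finset R3) (c : R3 → ℝ → C3) :
    ∃ t₀ ∈ I, ∀ t ∈ I, (S.filter (fun n => c n t ≠ 0)).card ≤
      (S.filter (fun n => c n t₀ ≠ 0)).card := by
  have hbdd : BddAbove ((fun t => (S.filter (fun n => c n t ≠ 0)).card) '' I) := by
    refine ⟨S.card, ?_⟩
    rintro _ ⟨t, -, rfl⟩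
    exact card_filter_le _ _
  obtain ⟨t₀, ht₀, h⟩ := Nat.sSup_mem (hI.image _) hbdd
  exact ⟨t₀, ht₀, fun t ht => (le_csSup hbdd ⟨t, ht, rfl⟩).trans_eq h.symm⟩

theorem helmholtz_smul_toC3 (n : R3) (l : ℂ) : helmholtz n (l • toC3 n) = 0 :=
  helmholtz_eq_zero_iff.2 ⟨l, rfl⟩

theorem subset_outputSet (S : Finset R3) {n : R3} (hn : n ∈ S) : n ∈ outputSet S := Or.inl hn

open Classical in
theorem isCollisionFree_support {I : Set ℝ} (hI_open : IsOpen I) (hI : I.OrdConnected)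
    {S : Finset R3} {c : R3 → ℝ → C3} {u : ℝ → R3 → R3} (hu : HasFiniteModesOn I S c u)
    (hsol : SolvesProjectedEuler I S c) (hspan : ∀ x : R3, (∀ n ∈ S, (inner ℝ n x : ℝ) = 0) → x = 0)
    {t₀ : ℝ} (ht₀ : t₀ ∈ I) (hmax : ∀ t ∈ I, (S.filter (fun n => c n t ≠ 0)).card ≤
      (S.filter (fun n => c n t₀ ≠ 0)).card) :
    IsCollisionFree (S.filter (fun n => c n t₀ ≠ 0)) (fun n => c n t₀) := by
  have hcont : ∀ n ∈ S, ContinuousOn (c n) I := fun n hn t ht =>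
    (hsol n (subset_outputSet S hn) t ht).continuousAt.continuousWithinAt
  refine ⟨?_, ?_, ?_, ?_, ?_, ?_, ?_⟩
  · exact fun h => hu.zero_notMem (mem_filter.1 h).1
  · intro n hn
    rw [mem_filter] at hn ⊢
    refine ⟨hu.neg_mem n hn.1, ?_⟩
    rw [hu.coeff_neg n hn.1 t₀ ht₀]
    intro h0
    apply hn.2
    ext i
    simpa [conjC3] using congrArg (fun w : C3 => w i) h0
  · exact fun n hn => (mem_filter.1 hn).2
  · exact fun n hn => hu.coeff_neg n (mem_filter.1 hn).1 t₀ ht₀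
  · intro n hn
    rw [← dotC3_toC3, dotC3_comm]
    exact hu.div_free n (mem_filter.1 hn).1 t₀ ht₀
  · intro n hn hn0
    rw [interaction_subset (filter_subset _ S) (fun m hm hm' => by simpa [hm] using hm')]
    by_cases hout : n ∈ outputSet S
    · have hd := hsol n hout t₀ ht₀
      -- Modes active at t₀ stay active nearby, and maximality leaves room for no others. An
      -- inactive mode thus vanishes near t₀ and has derivative zero.
      have hev : c n =ᶠ[nhds t₀] fun _ => 0 := by
        by_cases hnS : n ∈ S
        · have h1 : ∀ᶠ t in nhds t₀, ∀ m ∈ S.filter (fun n => c n t₀ ≠ 0), c m t ≠ 0 := by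
            rw [Finset.eventually_all]
            intro m hm
            rw [mem_filter] at hm
            exact ((hcont m hm.1).continuousAt (hI_open.mem_nhds ht₀)).eventually_ne hm.2
          filter_upwards [h1, hI_open.mem_nhds ht₀] with t ht htI
          have hsub : S.filter (fun n => c n t₀ ≠ 0) ⊆ S.filter (fun n => c n t ≠ 0) := by
            intro m hm
            exact mem_filter.2 ⟨(mem_filter.1 hm).1, ht m hm⟩
          have heq := Finset.eq_of_subset_of_card_le hsub (hmax t htI)
          by_contra hcon
          exact hn (heq ▸ mem_filter.2 ⟨hnS, hcon⟩)
        · filter_upwards [hI_open.mem_nhds ht₀] with t ht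
          exact hu.coeff_off n hnS t ht
      have h0 := hd.unique ((hasDerivAt_const t₀ (0 : C3)).congr_of_eventuallyEq hev)
      rw [neg_eq_zero, smul_eq_zero] at h0
      exact helmholtz_eq_zero_iff.1 (h0.resolve_left (by simp))
    · refine ⟨0, ?_⟩
      rw [zero_smul]
      refine interaction_eq_zero_of_forall fun p hp q hq hpq => ?_
      exact absurd (Or.inr ⟨hn0, p, hp, q, hq, hpq⟩) hout
  · intro x hx
    apply hspan
    intro n hn
    by_contra hnx
    -- Compare with the family truncated to the plane orthogonal to x. Two frequencies in the plane
    -- never sum to one outside it, so zero solves the truncated equations there. If all active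
    -- modes at t₀ lay in the plane, the modes outside it would vanish throughout `I`.
    have key := modes_unique hI_open hI {m : R3 | (inner ℝ m x : ℝ) ≠ 0} (S := S) (c := c)
      (w := fun m t => if (inner ℝ m x : ℝ) ≠ 0 then 0 else c m t) hcont ?_
      (fun m hm _ t ht => hsol m (subset_outputSet S hm) t ht) ?_ ?_ ht₀ ?_ n hn
    · obtain ⟨t, ht, hne⟩ := hu.coeff_ne_zero n hn
      exact hne (by rw [key t ht, if_pos hnx])
    · intro m hm
      by_cases h : (inner ℝ m x : ℝ) ≠ 0
      · simp only [if_pos h]; exact continuousOn_const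
      · simp only [if_neg h]; exact hcont m hm
    · intro m hm hmx t ht
      have hmx : (inner ℝ m x : ℝ) ≠ 0 := hmx
      rw [interaction_eq_zero_of_forall]
      · simp only [if_pos hmx]
        rw [show helmholtz m 0 = 0 from map_zero _, smul_zero, neg_zero]
        exact hasDerivAt_const t 0
      · rintro p - q - rfl
        by_cases hp : (inner ℝ p x : ℝ) ≠ 0
        · exact Or.inl (if_pos hp)
        · refine Or.inr (if_pos fun hq => hmx ?_)
          rw [inner_add_left, hq, not_not.1 hp, add_zero]
    · intro m _ hmx t _
      exact (if_neg hmx).symm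
    · intro m hm hmx
      have hmx : (inner ℝ m x : ℝ) ≠ 0 := hmx
      rw [if_pos hmx]
      by_contra h0
      exact hmx (hx m (mem_filter.2 ⟨hm, h0⟩))

theorem exists_beltrami_coefficients {I : Set ℝ} (hI_open : IsOpen I) (hI : I.OrdConnected)
    {S : Finset R3} {c : R3 → ℝ → C3} {u : ℝ → R3 → R3} (hu : HasFiniteModesOn I S c u)
    (hsol : SolvesProjectedEuler I S c) (hS : ¬ IsContainedInPlane (S : Set R3)) :
    ∃ t₀ ∈ I, ∃ μ : ℝ, ∀ n ∈ S, (∀ t ∈ I, c n t = c n t₀) ∧ defect μ n (c n t₀) = 0 := by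
  classical
  have hspan := spans_of_not_containedInPlane hS
  obtain ⟨n₀, hn₀⟩ := nonempty_of_not_containedInPlane hS
  obtain ⟨t₁, ht₁, -⟩ := hu.coeff_ne_zero n₀ hn₀
  obtain ⟨t₀, ht₀, hmax⟩ := exists_max_support ⟨t₁, ht₁⟩ S c
  have hcf := isCollisionFree_support hI_open hI hu hsol hspan ht₀ hmax
  obtain ⟨μ, hμ⟩ := hcf.exists_defect_eq_zero
  -- The values frozen at t₀ form a stationary solution, because the projected interaction of
  -- Beltrami modes is zero.
  have hconst : ∀ n ∈ S, ∀ t ∈ I, c n t = c n t₀ := by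
    refine modes_unique hI_open hI Set.univ (w := fun n _ => c n t₀)
      (fun n hn t ht => (hsol n (subset_outputSet S hn) t ht).continuousAt.continuousWithinAt)
      (fun n _ => continuousOn_const) (fun n hn _ t ht => hsol n (subset_outputSet S hn) t ht)
      (fun n hn _ t ht => ?_) (fun n _ h => absurd (Set.mem_univ n) h) ht₀ (fun n _ _ => rfl)
    obtain ⟨l, hl⟩ := interaction_of_defect_eq_zero hμ n
    rw [interaction_subset (filter_subset _ S) (fun m hm hm' => by simpa [hm] using hm')] at hl
    rw [hl, helmholtz_smul_toC3, smul_zero, neg_zero]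
    exact hasDerivAt_const t _
  refine ⟨t₀, ht₀, μ, fun n hn => ⟨hconst n hn, hμ n (mem_filter.2 ⟨hn, ?_⟩)⟩⟩
  obtain ⟨t, ht, h⟩ := hu.coeff_ne_zero n hn
  rwa [hconst n hn t ht] at h

/-! ### Curl of a finite-mode field and geometry of the support -/

theorem hasFDerivAt_mode (n x : R3) : HasFDerivAt (mode n)
    (mode n x • (Complex.I • Complex.ofRealCLM.comp (innerSL ℝ n))) x := by
  have h1 : HasFDerivAt (fun y : R3 => Complex.I * ((inner ℝ n y : ℝ) : ℂ))
      (Complex.I • Complex.ofRealCLM.comp (innerSL ℝ n)) x :=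
    (Complex.ofRealCLM.comp (innerSL ℝ n)).hasFDerivAt.const_mul Complex.I
  exact h1.cexp

namespace HasFiniteModes

variable {S : Finset R3} {a : R3 → C3} {b : R3 → R3}

theorem pderiv_eq (hb : HasFiniteModes S a b) (i j : Fin 3) (x : R3) :
    ((pderiv i j b x : ℝ) : ℂ) = ∑ n ∈ S, a n j * (Complex.I * (n i : ℂ) * mode n x) := by
  have hg : HasFDerivAt (fun y => ∑ n ∈ S, a n j * mode n y)
      (∑ n ∈ S, a n j • (mode n x • (Complex.I • Complex.ofRealCLM.comp (innerSL ℝ n)))) x :=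
    HasFDerivAt.fun_sum fun n _ => (hasFDerivAt_mode n x).const_mul _
  have hre : (fun y => b y j) = fun y => Complex.reCLM (∑ n ∈ S, a n j * mode n y) := by
    funext y
    rw [← hb.expansion y j]; rfl
  have hbd : DifferentiableAt ℝ (fun y => b y j) x := by
    rw [hre]
    exact (Complex.reCLM.hasFDerivAt.comp x hg).differentiableAt
  have h2 := Complex.ofRealCLM.hasFDerivAt.comp x hbd.hasFDerivAt
  have h3 : (Complex.ofRealCLM ∘ fun y => b y j) = fun y => ∑ n ∈ S, a n j * mode n y := by
    funext y
    exact hb.expansion y j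
  rw [h3] at h2
  have h4 := congrArg (fun L : R3 →L[ℝ] ℂ => L (EuclideanSpace.single i 1)) (h2.unique hg)
  simp only [ContinuousLinearMap.comp_apply, Complex.ofRealCLM_apply] at h4
  rw [pderiv, h4, _root_.sum_apply]
  refine Finset.sum_congr rfl fun n _ => ?_
  have hin : (inner ℝ n (EuclideanSpace.single i 1) : ℝ) = n i := by
    simp [EuclideanSpace.inner_single_right]
  simp only [_root_.smul_apply, ContinuousLinearMap.comp_apply, innerSL_apply_apply,
    Complex.ofRealCLM_apply, smul_eq_mul, hin]
  ring

theorem curl_eq (hb : HasFiniteModes S a b) {μ : ℝ} (hμ : ∀ n ∈ S, defect μ n (a n) = 0)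
    (x : R3) (i : Fin 3) : ((curl b x i : ℝ) : ℂ) = (μ : ℂ) * ((b x i : ℝ) : ℂ) := by
  have hc : ∀ n ∈ S, ∀ i, Complex.I * crossC3 n (a n) i = μ * a n i := by
    intro n hn i
    have := congrArg (fun w : C3 => w i) (hμ n hn)
    simpa [defect, sub_eq_zero] using this
  rw [hb.expansion, Finset.mul_sum]
  have key : ∀ i, ∑ n ∈ S, (μ : ℂ) * (a n i * mode n x) =
      ∑ n ∈ S, Complex.I * crossC3 n (a n) i * mode n x := fun i =>
    Finset.sum_congr rfl fun n hn => by rw [hc n hn]; ring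
  rw [key]
  fin_cases i
  · change ((pderiv 1 2 b x - pderiv 2 1 b x : ℝ) : ℂ) = _
    rw [Complex.ofReal_sub, hb.pderiv_eq, hb.pderiv_eq, ← Finset.sum_sub_distrib]
    refine Finset.sum_congr rfl fun n _ => ?_
    simp only [Fin.zero_eta, crossC3_zero]; ring
  · change ((pderiv 2 0 b x - pderiv 0 2 b x : ℝ) : ℂ) = _
    rw [Complex.ofReal_sub, hb.pderiv_eq, hb.pderiv_eq, ← Finset.sum_sub_distrib]
    refine Finset.sum_congr rfl fun n _ => ?_
    simp only [Fin.mk_one, crossC3_one]; ring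
  · change ((pderiv 0 1 b x - pderiv 1 0 b x : ℝ) : ℂ) = _
    rw [Complex.ofReal_sub, hb.pderiv_eq, hb.pderiv_eq, ← Finset.sum_sub_distrib]
    refine Finset.sum_congr rfl fun n _ => ?_
    simp only [Fin.reduceFinMk, crossC3_two]; ring

end HasFiniteModes

/-- The hull lies in the closed ball, and by strict convexity every point of the sphere is extreme
in the ball, hence in any subset containing it. -/
theorem subset_extremePoints_of_subset_sphere {A : Set R3} {r : ℝ}
    (hA : A ⊆ Metric.sphere 0 r) : A ⊆ (convexHull ℝ A).extremePoints ℝ := by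
  rcases A.eq_empty_or_nonempty with rfl | ⟨p, hp⟩
  · exact Set.empty_subset _
  · have hsub : convexHull ℝ A ⊆ Metric.closedBall 0 r :=
      convexHull_min (hA.trans Metric.sphere_subset_closedBall) (convex_closedBall 0 r)
    intro n hn
    refine inter_extremePoints_subset_extremePoints_of_subset hsub ⟨subset_convexHull ℝ A hn, ?_⟩
    rw [StrictConvexSpace.extremePoints_closedBall_eq_sphere]
    exact hA hn

end FiniteModeEuler

end

open FiniteModeEuler in
theorem theorem4p1
    (I : Set ℝ) (hI_open : IsOpen I) (hI_interval : I.OrdConnected)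
    (S : Finset FiniteModeEuler.R3)
    (c : FiniteModeEuler.R3 → ℝ → FiniteModeEuler.C3)
    (u : ℝ → FiniteModeEuler.R3 → FiniteModeEuler.R3)
    (hu : FiniteModeEuler.HasFiniteModesOn I S c u)
    (hsol : FiniteModeEuler.SolvesProjectedEuler I S c)
    (hS : ¬ FiniteModeEuler.IsContainedInPlane (S : Set FiniteModeEuler.R3)) :
    ∃ (b : FiniteModeEuler.R3 → FiniteModeEuler.R3)
      (a : FiniteModeEuler.R3 → FiniteModeEuler.C3),
      (∀ t ∈ I, ∀ x, u t x = b x) ∧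
      FiniteModeEuler.IsBeltramiFlow b ∧
      FiniteModeEuler.HasFiniteModes S a b ∧
      (∀ n ∈ S, ∀ t ∈ I, c n t = a n) ∧
      (∃ r : ℝ, 0 < r ∧ (S : Set FiniteModeEuler.R3) ⊆ Metric.sphere 0 r) ∧
      ((∀ n ∈ S, FiniteModeEuler.IsPosBeltramiVector n (a n)) ∨
        (∀ n ∈ S, FiniteModeEuler.IsNegBeltramiVector n (a n))) ∧
      (S : Set FiniteModeEuler.R3) ⊆
        (convexHull ℝ (S : Set FiniteModeEuler.R3)).extremePoints ℝ := by
  obtain ⟨t₀, ht₀, μ, hμ⟩ := exists_beltrami_coefficients hI_open hI_interval hu hsol hS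
  have hne : ∀ n ∈ S, c n t₀ ≠ 0 := by
    intro n hn
    obtain ⟨t, ht, h⟩ := hu.coeff_ne_zero n hn
    rwa [(hμ n hn).1 t ht] at h
  have hmodes : HasFiniteModes S (fun n => c n t₀) (u t₀) :=
    ⟨hu.zero_notMem, hu.neg_mem, hne, fun n hn => hu.coeff_off n hn t₀ ht₀,
      fun n hn => hu.coeff_neg n hn t₀ ht₀, fun n hn => hu.div_free n hn t₀ ht₀,
      hu.expansion t₀ ht₀⟩
  have heig : ∀ n ∈ S, Complex.I • crossC3 n (c n t₀) = (μ : ℂ) • c n t₀ := fun n hn =>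
    sub_eq_zero.1 (hμ n hn).2
  -- On vectors orthogonal to n the only eigenvalues of i n × are ±|n|, so the common μ fixes both
  -- the radius and, by its sign, the type of all the vectors.
  have hnorm : ∀ n ∈ S, ‖n‖ = |μ| := by
    intro n hn
    have hdiv := hu.div_free n hn t₀ ht₀
    rw [dotC3_comm, dotC3_toC3] at hdiv
    have h := sq_eq_of_defect_eq_zero (hne n hn) hdiv (heig n hn)
    have h' : ‖n‖ ^ 2 = μ ^ 2 := by exact_mod_cast h.symm
    rw [← abs_norm]
    exact (sq_eq_sq_iff_abs_eq_abs _ _).1 h'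
  have hμ0 : μ ≠ 0 := by
    rintro rfl
    obtain ⟨n, hn⟩ := nonempty_of_not_containedInPlane hS
    have h := hnorm n hn
    rw [abs_zero, norm_eq_zero] at h
    exact hu.zero_notMem (h ▸ hn)
  have hsphere : (S : Set R3) ⊆ Metric.sphere 0 |μ| := fun n hn =>
    mem_sphere_zero_iff_norm.2 (hnorm n hn)
  refine ⟨u t₀, fun n => c n t₀, fun t ht x => ?_, ⟨⟨S, _, hmodes⟩, μ,
    hmodes.curl_eq fun n hn => (hμ n hn).2⟩, hmodes, fun n hn => (hμ n hn).1,
    ⟨|μ|, abs_pos.2 hμ0, hsphere⟩, ?_, subset_extremePoints_of_subset_sphere hsphere⟩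
  · ext i
    apply Complex.ofReal_injective
    rw [hu.expansion t ht, hu.expansion t₀ ht₀]
    exact Finset.sum_congr rfl fun n hn => by rw [(hμ n hn).1 t ht]
  · rcases le_total 0 μ with h | h
    · left
      intro n hn
      refine ⟨hne n hn, ?_⟩
      rw [heig n hn, hnorm n hn, abs_of_nonneg h]
    · right
      intro n hn
      refine ⟨hne n hn, ?_⟩
      rw [heig n hn, hnorm n hn, abs_of_nonpos h]
      simp
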